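/- An instance of $k$-Supplier with Outliers consists of a finite undirected graph $G=(V,E)$ with positive rational edge lengths, a set $V_S\subseteq V$ of suppliers, a set $V_C\subseteq V$ of clients, and integers $k,p\ge 0$. A solution is a pair $(S,O)$ of a set $S\subseteq V_S$ of at most $k$ opened suppliers and a set $O\subseteq V_C$ of at most $p$ outliers. Its cost is $\max_{c\in V_C\setminus O}\min_{s\in S}\mathrm{dist}(c,s)\in[0,\infty]$, where $\mathrm{dist}$ is the shortest-path distance in $G$ (the cost is $0$ if $V_C\setminus O=\emptyset$, and $\infty$ if some client outside $O$ cannot reach any opened supplier). Let $\mathrm{OPT}\in[0,\infty]$ be the least cost of a solution. A tree decomposition of $G$ is a tree together with a bag $X_t\subseteq V$ for every node $t$ such that every vertex lies in some bag, both ends of every edge lie together in some bag, and for every vertex the nodes whose bags contain it induce a connected subtree; its width is $\max_t|X_t|-1$ (read as $0$ if $G$ has no vertices). **Theorem.** $k$-Supplier with Outliers admits an efficient parameterized approximation scheme parameterized by the treewidth of the input graph: there are a deterministic algorithm and a constant $c$ such that, given any instance, any tree decomposition of its graph, of width $\mathrm{tw}$, and any rational $\varepsilon>0$, the algorithm halts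 and returns a solution $(S,O)$, that is, at most $k$ opened suppliers and at most $p$ outliers, of cost at most $(1+\varepsilon)\,\mathrm{OPT}$. Its running time is $\mathcal O^*\big((\mathrm{tw}/\varepsilon)^{\mathcal O(\mathrm{tw})}\big)$ for $\varepsilon\le 1$; precisely, for every $\varepsilon>0$ it makes at most $$c\cdot N^{c}\cdot\left(\frac{\mathrm{tw}}{\min(\varepsilon,1)}\right)^{c\cdot\mathrm{tw}}$$ steps, where $N$ is the size of the input (instance, tree decomposition and $\varepsilon$, all numbers in binary) and $0^0=1$. Steps are counted in a pointer-machine model: while programs over binary trees whose unit-cost operations are allocating a cell, following a pointer and testing for the empty tree; this model is polynomially equivalent to Turing machines. -/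

import Mathlib

open scoped ENNReal

noncomputable section

namespace KSwO

/-! ### The machine model: programs over binary trees, with a step count -/

/-- The values that programs manipulate: binary trees built from `nil` by pairing, that is,
pointers to the cells of a heap. -/
inductive Val : Type
  | nil : Val
  | cons : Val → Val → Val

namespace Val

/-- The number of nodes of a tree; this is the size of an input. -/
def size : Val → ℕ
  | nil => 1
  | cons a b => a.size + b.size + 1

/-- The left component (`nil` for `nil`). -/
def head : Val → Val
  | nil => nil
  | cons a _ => a

/-- The right component (`nil` for `nil`). -/
def tail : Val → Val
  | nil => nil
  | cons _ b => b

end Val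

/-- While programs over binary trees (in the style of Jones' language `WHILE`), written with
combinators. A program acts on a current value. Its only operations are the unit-cost pointer
operations of a list machine: allocate a cell, follow a pointer, test for `nil`. In particular
there is no arithmetic and no equality test for trees. A program that makes `t` steps allocates at
most `t` cells, so this model and Turing machines simulate each other with polynomial overhead. -/
inductive Prog : Type
  /-- keep the current value -/
  | skip : Prog
  /-- the constant `nil` -/
  | nil : Prog
  /-- the left component -/
  | head : Prog
  /-- the right component -/
  | tail : Prog
  /-- run both programs on the current value and allocate a cell with the two results -/
  | cons : Prog → Prog → Prog
  /-- sequential composition: first the first program, then the second one -/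
  | seq : Prog → Prog → Prog
  /-- `ite b f g`: run `b` on the current value `x`; if the result is not `nil`, run `f` on `x`,
  otherwise run `g` on `x` -/
  | ite : Prog → Prog → Prog → Prog
  /-- `loop b f`: as long as the result of `b` on the current value is not `nil`, replace the
  current value by the result of `f` on it -/
  | loop : Prog → Prog → Prog

/-- `Prog.Run P x y t`: started on `x`, the program `P` halts with the result `y` after exactly `t`
steps. Every elementary operation and every control decision is one step. -/
inductive Prog.Run : Prog → Val → Val → ℕ → Prop
  | skip (x : Val) : Run .skip x x 1
  | nil (x : Val) : Run .nil x .nil 1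
  | head (x : Val) : Run .head x x.head 1
  | tail (x : Val) : Run .tail x x.tail 1
  | cons {f g : Prog} {x y z : Val} {s t : ℕ} (hf : Run f x y s) (hg : Run g x z t) :
      Run (.cons f g) x (.cons y z) (s + t + 1)
  | seq {f g : Prog} {x y z : Val} {s t : ℕ} (hf : Run f x y s) (hg : Run g y z t) :
      Run (.seq f g) x z (s + t + 1)
  | ite_true {b f g : Prog} {x u v y : Val} {s t : ℕ} (hb : Run b x (.cons u v) s)
      (hf : Run f x y t) : Run (.ite b f g) x y (s + t + 1)
  | ite_false {b f g : Prog} {x y : Val} {s t : ℕ} (hb : Run b x .nil s)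
      (hg : Run g x y t) : Run (.ite b f g) x y (s + t + 1)
  | loop_stop {b f : Prog} {x : Val} {s : ℕ} (hb : Run b x .nil s) :
      Run (.loop b f) x x (s + 1)
  | loop_step {b f : Prog} {x u v y z : Val} {r s t : ℕ} (hb : Run b x (.cons u v) r)
      (hf : Run f x y s) (hl : Run (.loop b f) y z t) : Run (.loop b f) x z (r + s + t + 1)

/-! ### Encoding of finite data as trees -/

/-- A truth value. -/
def encBool : Bool → Val
  | false => .nil
  | true => .cons .nil .nil

/-- A list, as a chain of cells. -/
def encList : List Val → Val
  | [] => .nil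
  | a :: l => .cons a (encList l)

/-- A natural number in binary, as the list of its bits, least significant bit first. -/
def encNat (m : ℕ) : Val := encList (m.bits.map encBool)

/-- A nonnegative rational number, as the pair of its numerator and its denominator in lowest
terms, both in binary. This is never `nil`. -/
def encRat (q : ℚ) : Val := .cons (encNat q.num.natAbs) (encNat q.den)

/-- A function on `{0, …, n - 1}`, as the list of its values. -/
def encFun {n : ℕ} (f : Fin n → Val) : Val := encList (List.ofFn f)

/-- A subset of `{0, …, n - 1}`, as its list of membership bits. -/
def encSet {n : ℕ} (s : Finset (Fin n)) : Val := encFun fun i => encBool (decide (i ∈ s))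

/-! ### `k`-Supplier with Outliers -/

/-- An instance of `k`-Supplier with Outliers: a finite undirected graph with positive rational
edge lengths (the values of `len` off the edges play no role), a set of suppliers, a set of
clients, the number `k` of suppliers that may be opened and the number `p` of clients that may be
left unserved. -/
structure Instance where
  /-- number of vertices -/
  n : ℕ
  /-- the graph -/
  graph : SimpleGraph (Fin n)
  /-- edge lengths -/
  len : Sym2 (Fin n) → ℚ
  len_pos : ∀ e ∈ graph.edgeSet, 0 < len e
  /-- the suppliers -/
  suppliers : Finset (Fin n)
  /-- the clients -/
  clients : Finset (Fin n)
  /-- the number of suppliers that may be opened -/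
  k : ℕ
  /-- the number of outliers that are allowed -/
  p : ℕ

namespace Instance

variable (I : Instance)

/-- The length of a walk: the sum of the lengths of its edges. -/
def walkLength {u v : Fin I.n} (w : I.graph.Walk u v) : ℚ := (w.edges.map I.len).sum

/-- The shortest-path distance, `∞` between different components. -/
def dist (u v : Fin I.n) : ℝ≥0∞ :=
  ⨅ w : I.graph.Walk u v, ENNReal.ofReal ((I.walkLength w : ℚ) : ℝ)

/-- `S` is a set of at most `k` suppliers (the opened ones) and `O` is a set of at most `p` clients
(the outliers). -/
structure IsSolution (S O : Finset (Fin I.n)) : Prop where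
  subset_suppliers : S ⊆ I.suppliers
  card_le_k : S.card ≤ I.k
  subset_clients : O ⊆ I.clients
  card_le_p : O.card ≤ I.p

/-- The cost of a solution: the largest distance of a client that is not an outlier from its
nearest opened supplier. It is `∞` if some such client cannot reach an opened supplier. -/
def cost (S O : Finset (Fin I.n)) : ℝ≥0∞ :=
  ⨆ c ∈ I.clients \ O, ⨅ s ∈ S, I.dist c s

/-- The optimum: the least cost of a solution. -/
def opt : ℝ≥0∞ :=
  ⨅ (S : Finset (Fin I.n)) (O : Finset (Fin I.n)) (_ : I.IsSolution S O), I.cost S O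

open Classical in
/-- The encoding of an instance: the adjacency matrix with the edge lengths as entries (`nil` for
a pair that is not an edge), the suppliers, the clients, `k` and `p`. -/
def enc : Val :=
  encList
    [encFun fun u => encFun fun v => if I.graph.Adj u v then encRat (I.len s(u, v)) else .nil,
      encSet I.suppliers, encSet I.clients, encNat I.k, encNat I.p]

end Instance

/-! ### Tree decompositions -/

/-- A tree decomposition of a graph on `{0, …, n - 1}`. -/
structure TreeDecomposition {n : ℕ} (G : SimpleGraph (Fin n)) where
  /-- number of nodes of the tree -/
  m : ℕ
  /-- the tree -/
  tree : SimpleGraph (Fin m)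
  isTree : tree.IsTree
  /-- the bags -/
  bag : Fin m → Finset (Fin n)
  vertex_mem : ∀ v : Fin n, ∃ t : Fin m, v ∈ bag t
  edge_mem : ∀ u v : Fin n, G.Adj u v → ∃ t : Fin m, u ∈ bag t ∧ v ∈ bag t
  connected : ∀ v : Fin n, (tree.induce {t : Fin m | v ∈ bag t}).Connected

namespace TreeDecomposition

variable {n : ℕ} {G : SimpleGraph (Fin n)} (T : TreeDecomposition G)

/-- The width: the largest size of a bag, minus one (`0` for the graph without vertices). -/
def width : ℕ := (Finset.univ.sup fun t : Fin T.m => (T.bag t).card) - 1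

open Classical in
/-- The encoding of a tree decomposition: the adjacency matrix of the tree, and the bags. -/
def enc : Val :=
  .cons (encFun fun s => encFun fun t => encBool (decide (T.tree.Adj s t)))
    (encFun fun t => encSet (T.bag t))

end TreeDecomposition

/-! ### Input and output of the algorithm -/

/-- The input of the algorithm: an instance, a tree decomposition of its graph, and `ε`. -/
def encInput (I : Instance) (T : TreeDecomposition I.graph) (ε : ℚ) : Val :=
  encList [I.enc, T.enc, encRat ε]

/-- The output of the algorithm: the opened suppliers and the outliers. -/
def encOutput {n : ℕ} (S O : Finset (Fin n)) : Val := .cons (encSet S) (encSet O)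

end KSwO

end

/-! Solutions are described by labellings of the vertices. Let `r` be a guess for the optimum (edge
lengths scaled to integers), `K` an integer that is at least `1/ε`, `h` a bound of order log `m` for
a number of hops (`m` is the number of tree nodes), and `H = hK`. Label 1 marks the opened
suppliers, the largest label `top = H + h + 2` the unserved vertices. Any other label of `v` must be
justified by a vertex `u` with a smaller label and at finite distance `d`, such that `label u * r +
H * d ≤ label v * r`. Following justifications from a served vertex ends at an opened supplier, and
the inequalities telescope to `r + H * l ≤ (H + h + 1) * r`, that is, `l ≤ (1 + 1/K) * r`
(`exists_walk_of_row`, `exists_walk_le_of_row`).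

Conversely, a solution of radius `r` yields a labelling: `v` gets 1 plus the least `k + ⌊H * e / r⌋`
over the walks of length `e ≤ r` to an opened supplier that consist of `k ≤ h` hops. The unit earned
by every hop pays for the rounding, so the next vertex on the walk justifies the label of `v`
(`labelling_meetSat`). A hop joins two vertices that are seen together at one stage of a recursion
over the tree. The recursion removes a weighted centroid and continues with the components: a piece
with at most two boundary nodes is halved, a piece with three boundary nodes falls apart into pieces
with at most two (`PieceOK.exists_good`, `PieceOK.child`). The depth is therefore logarithmic. A
walk can change from one piece to another only through boundary bags, so it can be cut into about
two hops per level (`exists_hops`).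

The dynamic program over this recursion remembers, for a piece, the labels of the vertices in
boundary bags, which of them are already justified, and the numbers of opened suppliers and of
unserved clients. One row is kept for every such key; correctness is `pieceItem_sound` (every row is
a valid labelling) and `pieceItem_rep` (every valid labelling has a row with the same key). The
guesses are 0 and all finite distances; the smallest guess with a row within the budgets is at most
the radius of any solution of finite cost.

At most four bags are joined at a time, so tables have at most `(n + 1)² * (2 * (top + 1)) ^ (4 *
(tw + 1))` rows, up to the degenerate case of empty bags, where `top` is of order `K` log `m`. The
power of the logarithm is harmless: `x ^ t ≤ t! * exp x` bounds it by `tw ^ tw` times a polynomial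
in `m` (`size_add_one_pow_le`). For width 0 the claimed bound leaves no room for `1/ε`, but then the
graph has no edges and `K = 1` is precise enough.

For the machine model, functions computed in polynomial time are shown to be closed under
composition, folds and tree-like recursion. The size measure of an input may exceed the size of its
encoding: adding `K` and the table bound to it makes the whole algorithm polynomial (`Poly.solve`),
and this padded measure obeys the claimed bound (`Input.bd_padded`). Tables are cut off at the
bound, so the time analysis needs no correctness invariant. -/

open scoped ENNReal

noncomputable section

namespace KSwO

/-! ### Polynomial-time functions between encoded types -/

/-- Types whose elements are encoded as trees, with a size measure that dominates the number of
nodes of the encoding. -/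
class Enc (α : Type) where
  /-- the encoding -/
  enc : α → Val
  /-- the size measure -/
  sz : α → ℕ
  size_le : ∀ a, (enc a).size ≤ sz a

open Enc (enc sz)

theorem Val.size_pos (v : Val) : 0 < v.size := by cases v <;> simp [Val.size]

theorem sz_pos {α : Type} [Enc α] (a : α) : 1 ≤ sz a :=
  (Val.size_pos _).trans_le (Enc.size_le a)

instance : Enc Unit := ⟨fun _ => .nil, fun _ => 1, fun _ => le_rfl⟩
instance : Enc Bool := ⟨encBool, fun b => (encBool b).size, fun _ => le_rfl⟩
instance : Enc ℕ := ⟨encNat, fun b => (encNat b).size, fun _ => le_rfl⟩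

instance {α β : Type} [Enc α] [Enc β] : Enc (α × β) where
  enc p := .cons (enc p.1) (enc p.2)
  sz p := sz p.1 + sz p.2 + 1
  size_le p := by simpa [Val.size] using add_le_add (Enc.size_le p.1) (Enc.size_le p.2)

/-- The size measure of lists. -/
def szList {α : Type} [Enc α] : List α → ℕ
  | [] => 1
  | a :: l => sz a + szList l + 1

instance {α : Type} [Enc α] : Enc (List α) where
  enc l := encList (l.map enc)
  sz := szList
  size_le l := by
    induction l with
    | nil => simp [encList, Val.size, szList]
    | cons a l ih =>
      simpa [encList, Val.size, szList] using add_le_add (Enc.size_le a) ih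

instance {α : Type} [Enc α] : Enc (Option α) where
  enc o := o.elim .nil fun a => .cons (enc a) .nil
  sz o := o.elim 1 fun a => sz a + 2
  size_le o := by
    cases o with
    | none => simp [Val.size]
    | some a => simpa [Val.size] using Enc.size_le a

instance : Enc ℕ∞ := inferInstanceAs (Enc (Option ℕ))

section Sizes

variable {α β : Type} [Enc α] [Enc β]

@[simp] theorem sz_pair (a : α) (b : β) : sz (a, b) = sz a + sz b + 1 := rfl
@[simp] theorem sz_nil : sz ([] : List α) = 1 := rfl
@[simp] theorem sz_cons (a : α) (l : List α) : sz (a :: l) = sz a + sz l + 1 := rfl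
@[simp] theorem sz_none : sz (none : Option α) = 1 := rfl
@[simp] theorem sz_some (a : α) : sz (some a) = sz a + 2 := rfl
@[simp] theorem sz_unit (a : Unit) : sz a = 1 := rfl

theorem sz_bool (b : Bool) : sz b ≤ 3 := by cases b <;> simp [sz, encBool, Val.size]

theorem sz_append (l l' : List α) : sz (l ++ l') + 1 = sz l + sz l' := by
  induction l with
  | nil => simp; ring
  | cons a l ih => simp only [List.cons_append, sz_cons]; omega

theorem sz_reverse (l : List α) : sz l.reverse = sz l := by
  induction l with
  | nil => simp
  | cons a l ih =>
    have := sz_append l.reverse [a]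
    simp only [List.reverse_cons, sz_cons, sz_nil] at *
    omega

theorem sz_mem_lt {a : α} {l : List α} (h : a ∈ l) : sz a < sz l := by
  induction l with
  | nil => simp at h
  | cons b l ih =>
    rcases List.mem_cons.1 h with rfl | h
    · simp only [sz_cons]; omega
    · have := ih h
      simp only [sz_cons]; omega

theorem sz_sublist {l l' : List α} (h : l.Sublist l') : sz l ≤ sz l' := by
  induction h with
  | slnil => exact le_rfl
  | cons a _ ih => simp only [sz_cons]; omega
  | cons_cons a _ ih => simp only [sz_cons]; omega

theorem length_lt_sz (l : List α) : l.length < sz l := by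
  induction l with
  | nil => simp
  | cons a l ih => simp only [sz_cons, List.length_cons]; omega

theorem sz_list_le {l : List α} {B : ℕ} (h : ∀ a ∈ l, sz a ≤ B) :
    sz l ≤ l.length * (B + 1) + 1 := by
  induction l with
  | nil => simp
  | cons a l ih =>
    have h1 := h a (by simp)
    have h2 := ih fun b hb => h b (by simp [hb])
    simp only [sz_cons, List.length_cons, add_mul]
    omega

end Sizes

/-! ### Polynomial bounds -/

section Bounds

variable {α β γ : Type} [Enc α] [Enc β] [Enc γ]

/-- `g` is bounded by a polynomial in the size measure. -/
def PBd (g : α → ℕ) : Prop := ∃ c, ∀ a, g a ≤ c * sz a ^ c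

theorem PBd.mono {f g : α → ℕ} (hg : PBd g) (h : ∀ a, f a ≤ g a) : PBd f :=
  let ⟨c, hc⟩ := hg
  ⟨c, fun a => (h a).trans (hc a)⟩

theorem PBd.const (k : ℕ) : PBd fun _ : α => k :=
  ⟨k, fun a => Nat.le_mul_of_pos_right _ (pow_pos (sz_pos a) _)⟩

theorem PBd.szBd : PBd fun a : α => Enc.sz a := ⟨1, fun a => by simp⟩

theorem PBd.add {f g : α → ℕ} (hf : PBd f) (hg : PBd g) : PBd fun a => f a + g a := by
  obtain ⟨c, hc⟩ := hf
  obtain ⟨d, hd⟩ := hg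
  refine ⟨c + d, fun a => ?_⟩
  have h1 : Enc.sz a ^ c ≤ Enc.sz a ^ (c + d) := Nat.pow_le_pow_right (sz_pos a) (by omega)
  have h2 : Enc.sz a ^ d ≤ Enc.sz a ^ (c + d) := Nat.pow_le_pow_right (sz_pos a) (by omega)
  calc f a + g a ≤ c * Enc.sz a ^ c + d * Enc.sz a ^ d := add_le_add (hc a) (hd a)
    _ ≤ c * Enc.sz a ^ (c + d) + d * Enc.sz a ^ (c + d) := by gcongr
    _ = _ := by ring

theorem PBd.mul {f g : α → ℕ} (hf : PBd f) (hg : PBd g) : PBd fun a => f a * g a := by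
  obtain ⟨c, hc⟩ := hf
  obtain ⟨d, hd⟩ := hg
  refine ⟨c * d + c + d, fun a => ?_⟩
  calc f a * g a ≤ (c * Enc.sz a ^ c) * (d * Enc.sz a ^ d) := Nat.mul_le_mul (hc a) (hd a)
    _ = c * d * Enc.sz a ^ (c + d) := by ring
    _ ≤ _ := Nat.mul_le_mul (by omega) (Nat.pow_le_pow_right (sz_pos a) (by omega))

theorem PBd.pow {f : α → ℕ} (hf : PBd f) (k : ℕ) : PBd fun a => f a ^ k := by
  induction k with
  | zero => simpa using PBd.const 1
  | succ k ih => simpa [pow_succ] using ih.mul hf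

theorem PBd.poly {f : α → ℕ} (hf : PBd f) (c : ℕ) : PBd fun a => c * f a ^ c :=
  (PBd.const c).mul (hf.pow c)

theorem PBd.comp {g : β → ℕ} {f : α → β} (hg : PBd g) (hf : PBd fun a => Enc.sz (f a)) :
    PBd fun a => g (f a) := by
  obtain ⟨c, hc⟩ := hg
  exact (hf.poly c).mono fun a => hc _

/-! ### Functions computed in polynomial time, and their closure properties -/

/-- `f` is computed by a program in time polynomial in the size measure, and the size of its
values is polynomially bounded. -/
@[fun_prop]
def Poly (f : α → β) : Prop :=
  ∃ (P : Prog) (b : α → ℕ), PBd b ∧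
    ∀ a, Enc.sz (f a) ≤ b a ∧ ∃ t ≤ b a, P.Run (enc a) (enc (f a)) t

theorem Poly.intro {f : α → β} (P : Prog) (b : α → ℕ) (hb : PBd b)
    (h : ∀ a, Enc.sz (f a) ≤ b a ∧ ∃ t ≤ b a, P.Run (enc a) (enc (f a)) t) : Poly f :=
  ⟨P, b, hb, h⟩

theorem Poly.szBd {f : α → β} (hf : Poly f) : PBd fun a => Enc.sz (f a) :=
  let ⟨_, _, hb, h⟩ := hf
  hb.mono fun a => (h a).1

@[fun_prop]
theorem Poly.id : Poly fun a : α => a :=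
  ⟨.skip, fun a => Enc.sz a, PBd.szBd, fun a => ⟨le_rfl, 1, sz_pos a, .skip _⟩⟩

@[fun_prop]
theorem Poly.comp {f : β → γ} {g : α → β} (hf : Poly f) (hg : Poly g) :
    Poly fun a => f (g a) := by
  have hs := hg.szBd
  obtain ⟨P, b, hb, h⟩ := hf
  obtain ⟨Q, d, hd, h'⟩ := hg
  refine .intro (.seq Q P) _ ((hd.add (hb.comp hs)).add (.const 1)) fun a => ?_
  obtain ⟨h1, t, ht, hr⟩ := h (g a)
  obtain ⟨_, s, hs, hr'⟩ := h' a
  exact ⟨by omega, s + t + 1, by omega, .seq hr' hr⟩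

@[fun_prop]
theorem Poly.pair {f : α → β} {g : α → γ} (hf : Poly f) (hg : Poly g) :
    Poly fun a => (f a, g a) := by
  obtain ⟨P, b, hb, h⟩ := hf
  obtain ⟨Q, d, hd, h'⟩ := hg
  refine .intro (.cons P Q) _ ((hb.add hd).add (.const 1)) fun a => ?_
  obtain ⟨h1, t, ht, hr⟩ := h a
  obtain ⟨h2, s, hs, hr'⟩ := h' a
  exact ⟨by simp only [sz_pair]; omega, t + s + 1, by omega, .cons hr hr'⟩

theorem Poly.fst' : Poly fun p : α × β => p.1 :=
  ⟨.head, fun a => Enc.sz a, PBd.szBd, fun a => ⟨by rw [← Prod.mk.eta (p := a)]; simp only [sz_pair]; omega,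
    1, sz_pos a, .head (enc a)⟩⟩

theorem Poly.snd' : Poly fun p : α × β => p.2 :=
  ⟨.tail, fun a => Enc.sz a, PBd.szBd, fun a => ⟨by rw [← Prod.mk.eta (p := a)]; simp only [sz_pair]; omega,
    1, sz_pos a, .tail (enc a)⟩⟩

@[fun_prop]
theorem Poly.fst {f : α → β × γ} (hf : Poly f) : Poly fun a => (f a).1 := Poly.fst'.comp hf

@[fun_prop]
theorem Poly.snd {f : α → β × γ} (hf : Poly f) : Poly fun a => (f a).2 := Poly.snd'.comp hf

/-- A program with a constant result. -/
def constProg : Val → Prog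
  | .nil => .nil
  | .cons a b => .cons (constProg a) (constProg b)

theorem constProg_run (v x : Val) : (constProg v).Run x v v.size := by
  induction v with
  | nil => exact .nil x
  | cons a b iha ihb => exact .cons iha ihb

@[fun_prop]
theorem Poly.const (b : β) : Poly fun _ : α => b :=
  ⟨constProg (enc b), fun _ => Enc.sz b, .const _, fun _ =>
    ⟨le_rfl, _, Enc.size_le b, constProg_run _ _⟩⟩

/-- A function into a type with a finer encoding. -/
theorem Poly.of_enc {δ : Type} [Enc δ] {f : α → β} {g : α → δ} (hg : Poly g)
    (h : ∀ a, enc (f a) = enc (g a)) (hs : PBd fun a => Enc.sz (f a)) : Poly f := by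
  obtain ⟨P, b, hb, h'⟩ := hg
  refine .intro P _ (hs.add hb) fun a => ⟨by omega, ?_⟩
  obtain ⟨-, t, ht, hr⟩ := h' a
  exact ⟨t, by omega, by rw [h]; exact hr⟩

@[fun_prop]
theorem Poly.cond {c : α → Bool} {f g : α → β} (hc : Poly c) (hf : Poly f) (hg : Poly g) :
    Poly fun a => bif c a then f a else g a := by
  obtain ⟨P, b, hb, h⟩ := hc
  obtain ⟨Q, d, hd, h'⟩ := hf
  obtain ⟨R, e, he, h''⟩ := hg
  refine .intro (.ite P Q R) _ (((hb.add hd).add he).add (.const 1)) fun a => ?_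
  obtain ⟨-, t, ht, hr⟩ := h a
  obtain ⟨h1, s, hs, hr'⟩ := h' a
  obtain ⟨h2, u, hu, hr''⟩ := h'' a
  cases hca : c a with
  | true =>
    rw [hca] at hr
    exact ⟨by simp only [cond_true]; omega, t + s + 1, by omega, .ite_true hr hr'⟩
  | false =>
    rw [hca] at hr
    exact ⟨by simp only [cond_false]; omega, t + u + 1, by omega, .ite_false hr hr''⟩

/-- Case distinction on a list. -/
theorem Poly.list_cases {l : α → List β} {f : α → γ} {g : α → β → List β → γ} (hl : Poly l)
    (hf : Poly f) (hg : Poly fun p : α × β × List β => g p.1 p.2.1 p.2.2) :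
    Poly fun a => match l a with
      | [] => f a
      | x :: r => g a x r := by
  have hls := hl.szBd
  obtain ⟨P, b, hb, h⟩ := hl
  obtain ⟨Q, d, hd, h'⟩ := hf
  obtain ⟨R, e, he, h''⟩ := hg
  obtain ⟨c, hc⟩ := he
  let S : α → ℕ := fun a => Enc.sz a + b a + 1
  have hS : PBd S := (PBd.szBd.add hb).add (.const 1)
  -- The program first builds the cell of `a` and `l a`. Its tail is `nil` exactly for the empty
  -- list; otherwise the cell already is the encoding of `(a, x, r)`, so `R` applies without
  -- rearrangement.
  refine .intro (.seq (.cons .skip P) (.ite .tail R (.seq .head Q))) _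
    (((hb.add hd).add (hS.poly c)).add (.const 10)) fun a => ?_
  obtain ⟨h1, t, ht, hr⟩ := h a
  cases hla : l a with
  | nil =>
    obtain ⟨h2, s, hs, hr'⟩ := h' a
    rw [hla] at hr
    refine ⟨by simp only; omega, (1 + t + 1) + (1 + (1 + s + 1) + 1) + 1, by omega, ?_⟩
    exact .seq (.cons (.skip _) hr) (.ite_false (.tail (.cons _ .nil)) (.seq (.head (.cons _ _)) hr'))
  | cons x r =>
    obtain ⟨h2, s, hs, hr'⟩ := h'' (a, x, r)
    beta_reduce at h2 hr'
    have h3 := hc (a, x, r)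
    have h4 : Enc.sz (a, x, r) ≤ S a := by
      rw [hla] at h1
      simp only [sz_pair, sz_cons, S] at *
      omega
    have h5 : c * Enc.sz (a, x, r) ^ c ≤ c * S a ^ c := by gcongr
    rw [hla] at hr
    refine ⟨by simp only at h2 ⊢; omega, (1 + t + 1) + (1 + s + 1) + 1, by omega, ?_⟩
    exact .seq (.cons (.skip _) hr)
      (.ite_true (.tail (.cons _ (.cons (enc x) (encList (r.map enc))))) hr')

/-- Case distinction on an option. -/
theorem Poly.option_cases {o : α → Option β} {f : α → γ} {g : α → β → γ} (ho : Poly o)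
    (hf : Poly f) (hg : Poly fun p : α × β => g p.1 p.2) :
    Poly fun a => match o a with
      | none => f a
      | some x => g a x := by
  -- An option has the same encoding as the list of its elements.
  have h : Poly fun a => (o a).toList := by
    refine .of_enc ho (fun a => ?_) (ho.szBd.mono fun a => ?_)
    · cases o a <;> rfl
    · cases o a with
      | none => exact le_rfl
      | some x => simp
  have h2 : Poly fun a => match (o a).toList with
      | [] => f a
      | x :: _ => g a x :=
    Poly.list_cases (g := fun a x _ => g a x) h hf
      (hg.comp (f := fun p : α × β => g p.1 p.2) (g := fun p : α × β × List β => (p.1, p.2.1))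
        (by fun_prop))
  convert h2 using 2 with a
  cases o a <;> rfl

/-- The program for `List.foldl`. -/
theorem foldl_run {σ : Type} [Enc σ] {g : α → σ → β → σ} {G : Prog} (K : ℕ) (a : α) (l : List β)
    (s : σ)
    (h : ∀ l₁ x l₂, l = l₁ ++ x :: l₂ → ∃ t ≤ K,
      G.Run (enc (a, l₁.foldl (g a) s, x)) (enc (g a (l₁.foldl (g a) s) x)) t) :
    ∃ t ≤ (l.length + 1) * (K + 40),
      (Prog.loop (.seq .tail .tail) (.cons .head (.cons
        (.seq (.cons .head (.cons (.seq .tail .head) (.seq .tail (.seq .tail .head)))) G)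
        (.seq .tail (.seq .tail .tail))))).Run (enc (a, s, l))
        (enc (a, l.foldl (g a) s, ([] : List β))) t := by
  induction l generalizing s with
  | nil =>
    refine ⟨(1 + 1 + 1) + 1, by simp, ?_⟩
    constructor
    exact .seq (.tail (.cons _ (.cons _ .nil))) (.tail (.cons _ .nil))
  | cons x l ih =>
    obtain ⟨t, ht, hr⟩ := h [] x l rfl
    obtain ⟨u, hu, hr'⟩ := ih (g a s x) fun l₁ y l₂ hl => h (x :: l₁) y l₂ (by simp [hl])
    change G.Run (enc (a, s, x)) (enc (g a s x)) t at hr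
    -- The loop state is `(a, s, x :: l)`. The body extracts `(a, s, x)` for `G` and keeps `a` and
    -- the rest of the list; the constant 40 pays for this rearrangement.
    have hF := Prog.Run.seq (x := .cons (enc a) (.cons (enc s) (.cons (enc x) (enc l))))
      (.cons (.head (.cons _ _))
        (.cons (.seq (.tail (.cons _ (.cons _ _))) (.head (.cons _ _)))
          (.seq (.tail (.cons _ (.cons _ (.cons _ _))))
            (.seq (.tail (.cons _ (.cons _ _))) (.head (.cons _ _)))))) hr
    have hR := Prog.Run.seq (.tail (.cons (enc a) (.cons (enc s) (.cons (enc x) (enc l)))))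
      (.seq (.tail (.cons (enc s) (.cons (enc x) (enc l)))) (.tail (.cons (enc x) (enc l))))
    refine ⟨_, ?_, .loop_step (u := enc x) (v := enc l)
      (.seq (.tail (.cons _ (.cons _ _))) (.tail (.cons _ (.cons _ _))))
      (.cons (.head (.cons _ _)) (.cons hF hR)) hr'⟩
    simp only [List.length_cons, add_mul] at *
    omega

/-- Iteration over a list, with a polynomial bound on the intermediate values. -/
theorem Poly.foldl {σ : Type} [Enc σ] {l : α → List β} {g : α → σ → β → σ} {i : α → σ}
    (hl : Poly l) (hi : Poly i) (hg : Poly fun p : α × σ × β => g p.1 p.2.1 p.2.2)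
    {B : α → ℕ} (hB : PBd B)
    (hb : ∀ a l₁ l₂, l a = l₁ ++ l₂ → Enc.sz (l₁.foldl (g a) (i a)) ≤ B a) :
    Poly fun a => (l a).foldl (g a) (i a) := by
  obtain ⟨P, b, hbb, h⟩ := hl
  obtain ⟨Q, d, hd, h'⟩ := hi
  obtain ⟨G, e, he, h''⟩ := hg
  obtain ⟨c, hc⟩ := he
  -- `S` bounds the size of every argument on which the step program is run, so `K` bounds the time
  -- of a single step.
  let S : α → ℕ := fun a => Enc.sz a + B a + b a + 2
  have hS : PBd S := ((PBd.szBd.add hB).add hbb).add (.const 2)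
  let K : α → ℕ := fun a => c * S a ^ c
  have hK : PBd K := hS.poly c
  refine .intro (.seq (.cons .skip (.cons Q P)) (.seq (.loop (.seq .tail .tail) (.cons .head (.cons
        (.seq (.cons .head (.cons (.seq .tail .head) (.seq .tail (.seq .tail .head)))) G)
        (.seq .tail (.seq .tail .tail))))) (.seq .tail .head))) _
    ((((hB.add hd).add hbb).add ((hbb.add (.const 1)).mul (hK.add (.const 40)))).add (.const 20))
    fun a => ?_
  obtain ⟨h1, t, ht, hr⟩ := h a
  obtain ⟨h2, s, hs, hr'⟩ := h' a
  obtain ⟨u, hu, hr''⟩ := foldl_run (g := g) (G := G) (K a) a (l a) (i a) (by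
    intro l₁ x l₂ hl
    obtain ⟨-, u, hu, hr''⟩ := h'' (a, l₁.foldl (g a) (i a), x)
    beta_reduce at hr''
    refine ⟨u, hu.trans ((hc _).trans ?_), hr''⟩
    have h3 := hb a l₁ _ hl
    have h4 : Enc.sz x < Enc.sz (l a) := sz_mem_lt (by simp [hl])
    have h5 : Enc.sz (a, l₁.foldl (g a) (i a), x) ≤ S a := by
      simp only [sz_pair, S]
      omega
    simp only [K]
    gcongr)
  have h6 : (l a).length ≤ b a := (length_lt_sz _).le.trans h1
  have h7 : ((l a).length + 1) * (K a + 40) ≤ (b a + 1) * (K a + 40) := by gcongr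
  refine ⟨?_, (1 + (s + t + 1) + 1) + (u + (1 + 1 + 1) + 1) + 1, by omega, ?_⟩
  · have := hb a (l a) [] (by simp)
    omega
  · exact .seq (.cons (.skip _) (.cons hr' hr)) (.seq hr'' (.seq (.tail (.cons _ (.cons _ _))) (.head (.cons _ _))))

/-- Iteration over a list, where every step adds a polynomial amount to the size. -/
theorem Poly.foldl_add {σ : Type} [Enc σ] {l : α → List β} {g : α → σ → β → σ} {i : α → σ}
    (hl : Poly l) (hi : Poly i) (hg : Poly fun p : α × σ × β => g p.1 p.2.1 p.2.2)
    {D : α → ℕ} (hD : PBd D)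
    (hb : ∀ a s, ∀ x ∈ l a, Enc.sz (g a s x) ≤ Enc.sz s + D a) :
    Poly fun a => (l a).foldl (g a) (i a) := by
  refine .foldl hl hi hg (B := fun a => Enc.sz (i a) + Enc.sz (l a) * D a)
    (hi.szBd.add (hl.szBd.mul hD)) fun a l₁ l₂ h => ?_
  have h1 : Enc.sz (l₁.foldl (g a) (i a)) ≤ Enc.sz (i a) + l₁.length * D a := by
    have hmem : ∀ x ∈ l₁, x ∈ l a := fun x hx => by simp [h, hx]
    clear h
    induction l₁ using List.reverseRecOn with
    | nil => simp
    | append_singleton l₁ x ih =>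
      have := ih fun y hy => hmem y (by simp [hy])
      have := hb a (l₁.foldl (g a) (i a)) x (hmem x (by simp))
      simp only [List.foldl_append, List.foldl_cons, List.foldl_nil, List.length_append,
        List.length_cons, List.length_nil, zero_add, add_mul, one_mul]
      omega
  refine h1.trans ?_
  have h2 : l₁.length ≤ Enc.sz (l a) := by
    refine le_trans ?_ (length_lt_sz (l a)).le
    simp [h]
  gcongr

end Bounds

/-! ### Lists -/

section Lists

variable {α β γ σ : Type} [Enc α] [Enc β] [Enc γ] [Enc σ]

@[fun_prop]
theorem Poly.cons {f : α → β} {l : α → List β} (hf : Poly f) (hl : Poly l) :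
    Poly fun a => f a :: l a :=
  .of_enc (hf.pair hl) (fun _ => rfl) ((hf.pair hl).szBd.mono fun _ => le_rfl)

@[fun_prop]
theorem Poly.some {f : α → β} (hf : Poly f) : Poly fun a => Option.some (f a) :=
  .of_enc (hf.pair (.const ())) (fun _ => rfl) ((hf.pair (.const ())).szBd.mono fun _ => by
    simp)

@[fun_prop]
theorem Poly.headD {l : α → List β} {d : α → β} (hl : Poly l) (hd : Poly d) :
    Poly fun a => (l a).headD (d a) := by
  convert Poly.list_cases (g := fun a x _ => x) hl hd (by fun_prop) using 2 with a
  cases l a <;> rfl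

@[fun_prop]
theorem Poly.tail {l : α → List β} (hl : Poly l) : Poly fun a => (l a).tail := by
  convert Poly.list_cases (f := fun _ => []) (g := fun a x r => r) hl (by fun_prop) (by fun_prop)
    using 2 with a
  cases l a <;> rfl

@[fun_prop]
theorem Poly.isEmpty {l : α → List β} (hl : Poly l) : Poly fun a => (l a).isEmpty := by
  convert Poly.list_cases (f := fun _ => true) (g := fun a x r => false) hl (by fun_prop)
    (by fun_prop) using 2 with a
  cases l a <;> rfl

@[fun_prop]
theorem Poly.reverse {l : α → List β} (hl : Poly l) : Poly fun a => (l a).reverse := by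
  have := Poly.foldl_add (l := l) (g := fun _ s x => x :: s) (i := fun _ => []) hl (by fun_prop)
    (by fun_prop) (D := fun a => Enc.sz (l a) + 1) (hl.szBd.add (.const 1)) (fun a s x hx => by
      have := sz_mem_lt hx
      simp only [sz_cons]; omega)
  simpa using this

@[fun_prop]
theorem Poly.append {l l' : α → List β} (hl : Poly l) (hl' : Poly l') :
    Poly fun a => l a ++ l' a := by
  have := Poly.foldl_add (l := fun a => (l a).reverse) (g := fun _ s x => x :: s) (i := l')
    (by fun_prop) hl'
    (by fun_prop) (D := fun a => Enc.sz (l a) + 1) (hl.szBd.add (.const 1)) (fun a s x hx => by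
      have := sz_mem_lt (List.mem_reverse.1 hx)
      simp only [sz_cons]; omega)
  simpa using this

/-- A bound for a function of an argument and an element of a list. -/
theorem Poly.bound_mem {l : α → List β} {f : α → β → γ} (hl : Poly l)
    (hf : Poly fun p : α × β => f p.1 p.2) :
    ∃ D : α → ℕ, PBd D ∧ ∀ a, ∀ x ∈ l a, Enc.sz (f a x) ≤ D a := by
  obtain ⟨c, hc⟩ := hf.szBd
  refine ⟨_, (((PBd.szBd.add hl.szBd).add (.const 1)).poly c), fun a x hx => (hc (a, x)).trans ?_⟩
  have := sz_mem_lt hx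
  simp only [sz_pair]
  gcongr

@[fun_prop]
theorem Poly.flatMap {l : α → List β} {f : α → β → List γ} (hl : Poly l)
    (hf : Poly fun p : α × β => f p.1 p.2) : Poly fun a => (l a).flatMap (f a) := by
  obtain ⟨D, hD, h⟩ := Poly.bound_mem hl hf
  have := Poly.foldl_add (l := fun a => (l a).reverse) (g := fun a s x => f a x ++ s)
    (i := fun _ => [])
    (by fun_prop) (by fun_prop) (by fun_prop) hD (fun a s x hx => by
      have := h a x (List.mem_reverse.1 hx)
      have := sz_append (f a x) s
      omega)
  convert this using 2 with a
  rw [List.foldl_reverse]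
  induction l a with
  | nil => rfl
  | cons x r ih => simp [ih]

@[fun_prop]
theorem Poly.map {l : α → List β} {f : α → β → γ} (hl : Poly l)
    (hf : Poly fun p : α × β => f p.1 p.2) : Poly fun a => (l a).map (f a) := by
  have : Poly fun a => (l a).flatMap fun x => [f a x] := by fun_prop
  convert this using 2 with a
  induction l a with
  | nil => rfl
  | cons x r ih => simp_all

@[fun_prop]
theorem Poly.filter {l : α → List β} {f : α → β → Bool} (hl : Poly l)
    (hf : Poly fun p : α × β => f p.1 p.2) : Poly fun a => (l a).filter (f a) := by
  have : Poly fun a => (l a).flatMap fun x => bif f a x then [x] else [] := by fun_prop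
  convert this using 2 with a
  induction l a with
  | nil => rfl
  | cons x r ih => cases h : f a x <;> simp_all

@[fun_prop]
theorem Poly.not {f : α → Bool} (hf : Poly f) : Poly fun a => !f a := by
  have : Poly fun a => bif f a then false else true := by fun_prop
  convert this using 2 with a
  cases f a <;> rfl

@[fun_prop]
theorem Poly.and {f g : α → Bool} (hf : Poly f) (hg : Poly g) : Poly fun a => f a && g a := by
  have : Poly fun a => bif f a then g a else false := by fun_prop
  convert this using 2 with a
  cases f a <;> rfl

@[fun_prop]
theorem Poly.or {f g : α → Bool} (hf : Poly f) (hg : Poly g) : Poly fun a => f a || g a := by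
  have : Poly fun a => bif f a then true else g a := by fun_prop
  convert this using 2 with a
  cases f a <;> rfl

@[fun_prop]
theorem Poly.any {l : α → List β} {f : α → β → Bool} (hl : Poly l)
    (hf : Poly fun p : α × β => f p.1 p.2) : Poly fun a => (l a).any (f a) := by
  have : Poly fun a => !((l a).filter (f a)).isEmpty := by fun_prop
  convert this using 2 with a
  induction l a with
  | nil => rfl
  | cons x r ih => cases h : f a x <;> simp_all

@[fun_prop]
theorem Poly.all {l : α → List β} {f : α → β → Bool} (hl : Poly l)
    (hf : Poly fun p : α × β => f p.1 p.2) : Poly fun a => (l a).all (f a) := by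
  have : Poly fun a => !(l a).any fun x => !f a x := by fun_prop
  convert this using 2 with a
  induction l a with
  | nil => rfl
  | cons x r ih => cases h : f a x <;> simp_all

/-- `take` with the number of elements given in unary. -/
@[fun_prop]
theorem Poly.takeLength {l : α → List β} {k : α → List γ} (hl : Poly l) (hk : Poly k) :
    Poly fun a => (l a).take (k a).length := by
  -- The state consists of the remaining list and the reversed prefix taken so far.
  have h : ∀ a, (k a).foldl (fun (s : List β × List β) _ => (s.1.tail, (s.1.take 1) ++ s.2))
      (l a, []) = ((l a).drop (k a).length, ((l a).take (k a).length).reverse) := by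
    intro a
    induction k a using List.reverseRecOn with
    | nil => simp
    | append_singleton r x ih =>
      simp only [List.foldl_append, ih, List.foldl_cons, List.foldl_nil, List.tail_drop,
        List.length_append, List.length_cons, List.length_nil, zero_add, Prod.mk.injEq, true_and]
      rw [List.take_add, List.reverse_append]
      congr 1
      cases h : List.drop r.length (l a) <;> simp
  have ht : Poly fun p : α × (List β × List β) × γ =>
      (p.2.1.1.tail, (p.2.1.1.take 1) ++ p.2.1.2) := by
    have : Poly fun p : α × (List β × List β) × γ => p.2.1.1.take 1 := by
      convert Poly.list_cases (l := fun p : α × (List β × List β) × γ => p.2.1.1)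
        (f := fun _ => []) (g := fun a x r => [x]) (by fun_prop) (by fun_prop)
        (by fun_prop) using 2 with a
      cases a.2.1.1 <;> simp
    fun_prop
  have := Poly.foldl (l := k) (i := fun a => (l a, ([] : List β)))
    (g := fun _ (s : List β × List β) _ => (s.1.tail, (s.1.take 1) ++ s.2)) hk (by fun_prop)
    ht (B := fun a => Enc.sz (l a) + Enc.sz (l a) + 1)
    ((hl.szBd.add hl.szBd).add (.const 1)) (fun a l₁ l₂ hlk => by
      have h' : l₁.foldl (fun (s : List β × List β) _ => (s.1.tail, (s.1.take 1) ++ s.2))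
          (l a, []) = ((l a).drop l₁.length, ((l a).take l₁.length).reverse) := by
        clear hlk
        induction l₁ using List.reverseRecOn with
        | nil => simp
        | append_singleton r x ih =>
          simp only [List.foldl_append, ih, List.foldl_cons, List.foldl_nil, List.tail_drop,
            List.length_append, List.length_cons, List.length_nil, zero_add, Prod.mk.injEq, true_and]
          rw [List.take_add, List.reverse_append]
          congr 1
          cases h : List.drop r.length (l a) <;> simp
      rw [h']
      have h1 := sz_sublist (List.drop_sublist l₁.length (l a))
      have h2 := sz_sublist (List.take_sublist l₁.length (l a))
      simp only [sz_pair, sz_reverse]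
      omega)
  have h2 : Poly fun a => ((l a).drop (k a).length, ((l a).take (k a).length).reverse) := by
    convert this using 2 with a
    exact (h a).symm
  have h3 := h2.snd.reverse
  simp only [List.reverse_reverse] at h3
  exact h3

end Lists

/-! ### Binary numbers -/

section Numbers

variable {α β γ σ : Type} [Enc α] [Enc β] [Enc γ] [Enc σ]

/-- A number and its list of bits have literally the same encoding. This is how programs get at the
digits: arithmetic is done on lists of bits. -/
theorem sz_nat_eq_bits (n : ℕ) : sz n = sz n.bits := by
  change (encList (n.bits.map encBool)).size = szList n.bits
  induction n.bits with
  | nil => rfl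
  | cons b l ih =>
    simp only [List.map_cons, encList, Val.size, szList, ih]
    rfl

theorem two_mul_size_lt_sz (n : ℕ) : 2 * n.size < sz n := by
  rw [sz_nat_eq_bits, ← Nat.size_eq_bits_len]
  induction n.bits with
  | nil => simp
  | cons b l ih =>
    have := sz_pos b
    simp only [List.length_cons, sz_cons]
    omega

theorem sz_nat_le (n : ℕ) : sz n ≤ 4 * n.size + 1 := by
  rw [sz_nat_eq_bits, ← Nat.size_eq_bits_len]
  have := sz_list_le (l := n.bits) (B := 3) fun b _ => sz_bool b
  omega

theorem Poly.size {f : α → ℕ} (h : Poly f) : PBd fun a => (f a).size :=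
  h.szBd.mono fun a => by have := two_mul_size_lt_sz (f a); omega

@[fun_prop]
theorem Poly.bits {f : α → ℕ} (hf : Poly f) : Poly fun a => (f a).bits :=
  .of_enc hf (fun _ => rfl) (hf.szBd.mono fun _ => (sz_nat_eq_bits _).ge)

theorem Poly.of_bits {f : α → ℕ} (hf : Poly fun a => (f a).bits) : Poly f :=
  .of_enc hf (fun _ => rfl) (hf.szBd.mono fun _ => (sz_nat_eq_bits _).le)

theorem bits_tail (n : ℕ) : n.bits.tail = n.div2.bits := (Nat.div2_bits_eq_tail n).symm

@[fun_prop]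
theorem Poly.div2 {f : α → ℕ} (hf : Poly f) : Poly fun a => (f a).div2 := by
  refine .of_bits ?_
  simp only [← bits_tail]
  fun_prop

@[fun_prop]
theorem Poly.bodd {f : α → ℕ} (hf : Poly f) : Poly fun a => (f a).bodd := by
  have : Poly fun a => (f a).bits.headD false := by fun_prop
  convert this using 2 with a
  rw [Nat.bodd_eq_bits_head]
  cases (f a).bits <;> rfl

@[fun_prop]
theorem Poly.beqZero {f : α → ℕ} (hf : Poly f) : Poly fun a => (f a == 0) := by
  have : Poly fun a => (f a).bits.isEmpty := by fun_prop
  convert this using 2 with a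
  cases h : f a with
  | zero => simp
  | succ n =>
    have : (n + 1).bits ≠ [] := by
      intro h
      have := Nat.size_eq_bits_len (n + 1)
      rw [h] at this
      simp at this
      have := Nat.size_eq_zero.1 this.symm
      omega
    cases h : (n + 1).bits <;> simp_all

/-- One step of binary addition: two remaining numbers, a carry bit and the digits so far. -/
def addStep (s : (ℕ × ℕ) × Bool × List Bool) : (ℕ × ℕ) × Bool × List Bool :=
  bif (s.1.1 == 0) && ((s.1.2 == 0) && !s.2.1) then s else
    ((s.1.1.div2, s.1.2.div2),
      ((s.1.1.bodd && s.1.2.bodd) || (s.2.1 && (s.1.1.bodd || s.1.2.bodd))),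
      (bif s.1.1.bodd then (bif s.1.2.bodd then s.2.1 else !s.2.1) else
        (bif s.1.2.bodd then !s.2.1 else s.2.1)) :: s.2.2)

/-- The digits already written, followed by the digits of what remains to be added, stay the same. A
step has to be idle when nothing remains, since `Nat.bits` has no leading zeros. -/
theorem addStep_inv (s : (ℕ × ℕ) × Bool × List Bool) :
    (addStep s).2.2.reverse ++ ((addStep s).1.1 + (addStep s).1.2 + (addStep s).2.1.toNat).bits =
      s.2.2.reverse ++ (s.1.1 + s.1.2 + s.2.1.toNat).bits := by
  obtain ⟨⟨m, n⟩, c, acc⟩ := s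
  by_cases h : (m = 0 ∧ n = 0 ∧ c = false)
  · obtain ⟨rfl, rfl, rfl⟩ := h
    rfl
  · have h0 : 0 < m + n + c.toNat := by
      rcases c with _ | _ <;> simp_all
      omega
    have hb : ((m == 0) && ((n == 0) && !c)) = false := by
      rw [Bool.eq_false_iff]
      simpa using h
    simp only [addStep, hb, cond_false, List.reverse_cons, List.append_assoc]
    congr 1
    have hm := Nat.bodd_add_div2 m
    have hn := Nat.bodd_add_div2 n
    rw [List.singleton_append, ← Nat.bits_append_bit]
    · congr 1
      rw [Nat.bit_val]
      cases hmb : m.bodd <;> cases hnb : n.bodd <;> cases c <;> (simp [hmb, hnb] at hm hn ⊢; omega)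
    · intro h
      cases hmb : m.bodd <;> cases hnb : n.bodd <;> cases c <;>
        simp [hmb, hnb] at hm hn h0 h ⊢ <;> omega

theorem addStep_fst (s : (ℕ × ℕ) × Bool × List Bool) :
    (addStep s).1 = (s.1.1.div2, s.1.2.div2) := by
  obtain ⟨⟨m, n⟩, c, acc⟩ := s
  cases h : ((m == 0) && ((n == 0) && !c)) with
  | false => simp [addStep, h]
  | true =>
    simp at h
    obtain ⟨rfl, rfl, rfl⟩ := h
    simp [addStep]

theorem size_div2 (n : ℕ) : n.div2.size = n.size - 1 := by
  rw [← Nat.size_eq_bits_len, ← Nat.size_eq_bits_len, ← bits_tail, List.length_tail]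

@[fun_prop]
theorem Poly.addStep {f : α → (ℕ × ℕ) × Bool × List Bool} (hf : Poly f) :
    Poly fun a => addStep (f a) := by
  unfold KSwO.addStep
  fun_prop

theorem addStep_sz (s : (ℕ × ℕ) × Bool × List Bool) : sz (addStep s) ≤ sz s + 10 := by
  obtain ⟨⟨m, n⟩, c, acc⟩ := s
  have h1 : ∀ m : ℕ, sz m.div2 ≤ sz m := fun m => by
    rw [sz_nat_eq_bits, sz_nat_eq_bits, ← bits_tail]
    exact sz_sublist (List.tail_sublist _)
  cases h : ((m == 0) && ((n == 0) && !c)) with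
  | true => simp [KSwO.addStep, h]
  | false =>
    have := h1 m
    have := h1 n
    have := sz_bool ((m.bodd && n.bodd) || (c && (m.bodd || n.bodd)))
    have := sz_bool (bif m.bodd then (bif n.bodd then c else !c) else
        (bif n.bodd then !c else c))
    simp only [KSwO.addStep, h, cond_false, sz_pair, sz_cons]
    omega

theorem addStep_foldl {δ : Type} (m n : ℕ) (l : List δ) (h : m.size < l.length)
    (h' : n.size < l.length) :
    (l.foldl (fun s _ => addStep s) ((m, n), false, [])).2.2.reverse = (m + n).bits := by
  have h1 : ∀ l : List δ,
      (l.foldl (fun s _ => addStep s) ((m, n), false, [])).2.2.reverse ++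
        ((l.foldl (fun s _ => addStep s) ((m, n), false, [])).1.1 +
          (l.foldl (fun s _ => addStep s) ((m, n), false, [])).1.2 +
            (l.foldl (fun s _ => addStep s) ((m, n), false, [])).2.1.toNat).bits = (m + n).bits ∧
        (l.foldl (fun s _ => addStep s) ((m, n), false, [])).1.1.size = m.size - l.length ∧
        (l.foldl (fun s _ => addStep s) ((m, n), false, [])).1.2.size = n.size - l.length := by
    intro l
    induction l using List.reverseRecOn with
    | nil => simp
    | append_singleton l x ih =>
      obtain ⟨ih1, ih2, ih3⟩ := ih
      simp only [List.foldl_append, List.foldl_cons, List.foldl_nil, List.length_append,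
        List.length_singleton]
      refine ⟨by rw [addStep_inv]; exact ih1, ?_, ?_⟩
      · rw [addStep_fst, size_div2, ih2]
        omega
      · rw [addStep_fst, size_div2, ih3]
        omega
  -- Before the last step both numbers are exhausted, and the last step only writes a pending carry.
  obtain ⟨l, x, rfl⟩ : ∃ l' x, l = l' ++ [x] := by
    rcases List.eq_nil_or_concat l with rfl | ⟨l', x, rfl⟩
    · simp at h
    · exact ⟨l', x, by simp⟩
  simp only [List.length_append, List.length_singleton] at h h'
  obtain ⟨h2, h3, h4⟩ := h1 (l ++ [x])
  obtain ⟨-, h5, h6⟩ := h1 l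
  have h7 : (l.foldl (fun s _ => addStep s) ((m, n), false, [])).1 = (0, 0) := by
    rw [Prod.ext_iff]
    exact ⟨Nat.size_eq_zero.1 (by omega), Nat.size_eq_zero.1 (by omega)⟩
  rw [← h2]
  simp only [List.foldl_append, List.foldl_cons, List.foldl_nil]
  generalize l.foldl (fun s _ => addStep s) ((m, n), false, []) = s at h7
  obtain ⟨p, c, acc⟩ := s
  obtain rfl : p = (0, 0) := h7
  cases c <;> simp [addStep]

@[fun_prop]
theorem Poly.add {f g : α → ℕ} (hf : Poly f) (hg : Poly g) : Poly fun a => f a + g a := by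
  refine .of_bits ?_
  -- The list serves only as a clock that is longer than both numbers.
  have := Poly.foldl_add (l := fun a => true :: ((f a).bits ++ (g a).bits))
    (i := fun a => ((f a, g a), false, ([] : List Bool))) (g := fun _ s _ => KSwO.addStep s)
    (by fun_prop) (by fun_prop) (by fun_prop) (D := fun _ => 10) (.const _)
    (fun a s _ _ => addStep_sz s)
  convert this.snd.snd.reverse using 2 with a
  rw [addStep_foldl] <;> simp [Nat.size_eq_bits_len]

/-- Comparison of binary numbers, least significant bit first. -/
def leStep (s : (ℕ × ℕ) × Bool) : (ℕ × ℕ) × Bool :=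
  ((s.1.1.div2, s.1.2.div2),
    bif s.1.1.bodd then s.1.2.bodd && s.2 else s.1.2.bodd || s.2)

/-- The flag holds the result for the digits already read. These are less significant, so it decides
only if the remaining parts are equal. -/
theorem leStep_inv (s : (ℕ × ℕ) × Bool) :
    ((leStep s).1.1 < (leStep s).1.2 ∨ (leStep s).1.1 = (leStep s).1.2 ∧ (leStep s).2 = true) ↔
      (s.1.1 < s.1.2 ∨ s.1.1 = s.1.2 ∧ s.2 = true) := by
  obtain ⟨⟨m, n⟩, c⟩ := s
  have hm := Nat.bodd_add_div2 m
  have hn := Nat.bodd_add_div2 n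
  cases hmb : m.bodd <;> cases hnb : n.bodd <;> cases c <;>
    simp [hmb, hnb, leStep] at hm hn ⊢ <;> omega

@[fun_prop]
theorem Poly.decideLe {f g : α → ℕ} (hf : Poly f) (hg : Poly g) :
    Poly fun a => decide (f a ≤ g a) := by
  have h1 : ∀ m : ℕ, sz m.div2 ≤ sz m := fun m => by
    rw [sz_nat_eq_bits, sz_nat_eq_bits, ← bits_tail]
    exact sz_sublist (List.tail_sublist _)
  have := Poly.foldl_add (l := fun a => (f a).bits ++ (g a).bits)
    (i := fun a => ((f a, g a), true)) (g := fun _ s _ => leStep s)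
    (by fun_prop) (by fun_prop) (by unfold leStep; fun_prop) (D := fun _ => 3) (.const _)
    (fun a s _ _ => by
      obtain ⟨⟨m, n⟩, c⟩ := s
      have := h1 m
      have := h1 n
      have := sz_bool (bif m.bodd then n.bodd && c else n.bodd || c)
      simp only [leStep, sz_pair]
      omega)
  convert this.snd using 2 with a
  have h2 : ∀ (l : List Bool) (s : (ℕ × ℕ) × Bool), s.1.1.size ≤ l.length → s.1.2.size ≤ l.length →
      ((l.foldl (fun s _ => leStep s) s).2 = true ↔
        (s.1.1 < s.1.2 ∨ s.1.1 = s.1.2 ∧ s.2 = true)) := by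
    intro l
    induction l with
    | nil =>
      intro s hs hs'
      simp only [List.length_nil, Nat.le_zero, Nat.size_eq_zero] at hs hs'
      simp [hs, hs']
    | cons b l ih =>
      intro s hs hs'
      rw [List.foldl_cons, ih, leStep_inv]
      · simp only [leStep, size_div2, List.length_cons] at *; omega
      · simp only [leStep, size_div2, List.length_cons] at *; omega
  rw [Bool.eq_iff_iff, h2]
  · simp; omega
  · simp [Nat.size_eq_bits_len]
  · simp [Nat.size_eq_bits_len]

@[fun_prop]
theorem Poly.decideLt {f g : α → ℕ} (hf : Poly f) (hg : Poly g) :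
    Poly fun a => decide (f a < g a) := by
  have : Poly fun a => !decide (g a ≤ f a) := by fun_prop
  convert this using 2 with a
  rw [← decide_not]
  simp

theorem size_mul_le (m n : ℕ) : (m * n).size ≤ m.size + n.size := by
  rw [Nat.size_le, pow_add]
  exact Nat.mul_lt_mul'' (Nat.lt_size_self m) (Nat.lt_size_self n)

theorem size_add_le (m n : ℕ) : (m + n).size ≤ max m.size n.size + 1 := by
  rw [Nat.size_le, pow_succ]
  have h1 : m < 2 ^ max m.size n.size :=
    (Nat.lt_size_self m).trans_le (Nat.pow_le_pow_right (by omega) (le_max_left _ _))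
  have h2 : n < 2 ^ max m.size n.size :=
    (Nat.lt_size_self n).trans_le (Nat.pow_le_pow_right (by omega) (le_max_right _ _))
  omega

/-- The value of a list of bits, most significant bit first. -/
theorem foldl_bits_reverse (m n : ℕ) :
    m.bits.reverse.foldl (fun s b => (s + s) + bif b then n else 0) 0 = m * n := by
  rw [List.foldl_reverse]
  induction m using Nat.binaryRec' with
  | zero => simp
  | bit b m h ih =>
    rw [Nat.bits_append_bit _ _ h, List.foldr_cons, ih, Nat.bit_val]
    cases b <;> simp <;> ring

/-- In Horner's scheme no intermediate value exceeds the final product, whose size therefore bounds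
all of them. -/
theorem foldl_bits_mono (l l' : List Bool) (n : ℕ) :
    l.foldl (fun s b => (s + s) + bif b then n else 0) 0 ≤
      (l ++ l').foldl (fun s b => (s + s) + bif b then n else 0) 0 := by
  induction l' using List.reverseRecOn with
  | nil => simp
  | append_singleton l' x ih =>
    rw [← List.append_assoc, List.foldl_append]
    simp only [List.foldl_cons, List.foldl_nil]
    omega

@[fun_prop]
theorem Poly.mul {f g : α → ℕ} (hf : Poly f) (hg : Poly g) : Poly fun a => f a * g a := by
  have := Poly.foldl (l := fun a => (f a).bits.reverse) (i := fun _ => 0)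
    (g := fun a s b => (s + s) + bif b then g a else 0)
    (by fun_prop) (by fun_prop) (by fun_prop) (B := fun a => 4 * ((f a).size + (g a).size) + 1)
    (((PBd.const 4).mul (hf.size.add hg.size)).add (.const 1)) (fun a l₁ l₂ h => by
      refine (sz_nat_le _).trans ?_
      have h1 := foldl_bits_mono l₁ l₂ (g a)
      rw [← h, foldl_bits_reverse] at h1
      have := (Nat.size_le_size h1).trans (size_mul_le _ _)
      omega)
  convert this using 2 with a
  exact (foldl_bits_reverse _ _).symm

/-! ### Equality tests, lengths and indexing -/

/-- Types with a decidable equality that is decided in polynomial time. -/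
class PolyEq (α : Type) [Enc α] [DecidableEq α] : Prop where
  poly : Poly fun p : α × α => decide (p.1 = p.2)

@[fun_prop]
theorem Poly.decideEq [DecidableEq β] [PolyEq β] {f g : α → β} (hf : Poly f) (hg : Poly g) :
    Poly fun a => decide (f a = g a) :=
  PolyEq.poly.comp (hf.pair hg)

instance : PolyEq ℕ where
  poly := by
    have : Poly fun p : ℕ × ℕ => decide (p.1 ≤ p.2) && decide (p.2 ≤ p.1) := by fun_prop
    convert this using 2 with p
    rw [Bool.eq_iff_iff]
    simp
    omega

instance : PolyEq Bool where
  poly := by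
    have : Poly fun p : Bool × Bool => bif p.1 then p.2 else !p.2 := by fun_prop
    convert this using 2 with p
    obtain ⟨_ | _, _ | _⟩ := p <;> rfl

instance [DecidableEq α] [DecidableEq β] [PolyEq α] [PolyEq β] : PolyEq (α × β) where
  poly := by
    have : Poly fun p : (α × β) × (α × β) => decide (p.1.1 = p.2.1) && decide (p.1.2 = p.2.2) := by
      fun_prop
    convert this using 2 with p
    rw [Bool.eq_iff_iff]
    simp [Prod.ext_iff]

instance [DecidableEq α] [PolyEq α] : PolyEq (List α) where
  poly := by
    -- The second list is consumed along the first one; the default `x` of `headD` is harmless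
    -- because emptiness is tested separately.
    let step : List α × Bool → α → List α × Bool := fun s x =>
      (s.1.tail, s.2 && (!s.1.isEmpty && decide (s.1.headD x = x)))
    have h0 : Poly fun p : (List α × List α) × (List α × Bool) × α => step p.2.1 p.2.2 := by
      fun_prop
    have := Poly.foldl_add (l := fun p : List α × List α => p.1)
      (i := fun p => (p.2, true)) (g := fun _ s x => step s x) (by fun_prop) (by fun_prop)
      h0 (D := fun _ => 3) (.const _) (fun p s x _ => by
        have h1 := sz_sublist (List.tail_sublist s.1)
        have h2 := sz_bool (s.2 && (!s.1.isEmpty && decide (s.1.headD x = x)))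
        obtain ⟨s, b⟩ := s
        simp only [step, sz_pair] at *
        omega)
    have h2 : Poly fun p : List α × List α =>
        (p.1.foldl step (p.2, true)).2 && (p.1.foldl step (p.2, true)).1.isEmpty := by fun_prop
    convert h2 using 2 with p
    obtain ⟨l, l'⟩ := p
    have h3 : ∀ (l l' : List α) (b : Bool), ((l.foldl step (l', b)).2 &&
        (l.foldl step (l', b)).1.isEmpty) = (b && decide (l = l')) := by
      intro l
      induction l with
      | nil => intro l' b; cases l' <;> simp
      | cons x l ih =>
        intro l' b
        rw [List.foldl_cons, ih]
        cases l' with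
        | nil => simp
        | cons y l' => 
          rw [Bool.eq_iff_iff]
          simp only [List.tail_cons, List.isEmpty_cons, List.headD_cons, List.cons.injEq,
            Bool.and_eq_true, decide_eq_true_iff, eq_comm (a := x), and_assoc, Bool.not_false,
            true_and]
          exact ⟨fun h => ⟨h.1, of_decide_eq_true h.2.1, of_decide_eq_true h.2.2⟩,
            fun h => ⟨h.1, decide_eq_true h.2.1, decide_eq_true h.2.2⟩⟩
    rw [h3]
    simp

@[fun_prop]
theorem Poly.length {l : α → List β} (hl : Poly l) : Poly fun a => (l a).length := by
  have := Poly.foldl (l := l) (i := fun _ => 0) (g := fun _ s _ => s + 1) hl (by fun_prop)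
    (by fun_prop) (B := fun a => 4 * sz (l a) + 1)
    (((PBd.const 4).mul hl.szBd).add (.const 1)) (fun a l₁ l₂ h => by
      refine (sz_nat_le _).trans ?_
      have h1 := length_lt_sz (l a)
      rw [h, List.length_append] at h1
      have h2 : l₁.length.size ≤ l₁.length := Nat.size_le.2 Nat.lt_two_pow_self
      simp only [List.foldl_add_const, zero_add, one_mul]
      rw [h]
      omega)
  simpa using this

-- The bound of the range is given in unary: a range up to a binary number could be exponentially
-- long.
@[fun_prop]
theorem Poly.rangeLength {l : α → List β} (hl : Poly l) :
    Poly fun a => List.range (l a).length := by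
  have hs : ∀ l : List β, l.foldl (fun (s : ℕ × List ℕ) _ => (s.1 + 1, s.1 :: s.2)) (0, []) =
      (l.length, (List.range l.length).reverse) := by
    intro l
    induction l using List.reverseRecOn with
    | nil => simp
    | append_singleton l x ih => simp [ih, List.range_succ]
  have := Poly.foldl (l := l) (i := fun _ => (0, ([] : List ℕ)))
    (g := fun _ s _ => (s.1 + 1, s.1 :: s.2)) hl (by fun_prop)
    (by fun_prop) (B := fun a => (4 * sz (l a) + 1) + (sz (l a) * ((4 * sz (l a) + 1) + 1) + 1) + 1)
    (((((PBd.const 4).mul hl.szBd).add (.const 1)).add ((hl.szBd.mul ((((PBd.const 4).mul hl.szBd).add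
      (.const 1)).add (.const 1))).add (.const 1))).add (.const 1)) (fun a l₁ l₂ h => by
      have h1 := length_lt_sz (l a)
      rw [h, List.length_append] at h1
      rw [← h] at h1
      have h2 : ∀ k ≤ l₁.length, sz k ≤ 4 * sz (l a) + 1 := fun k hk => by
        have h2 : k.size ≤ k := Nat.size_le.2 Nat.lt_two_pow_self
        have := sz_nat_le k
        omega
      rw [hs, sz_pair, sz_reverse]
      have h3 := h2 _ le_rfl
      have h4 := sz_list_le (l := List.range l₁.length) (B := 4 * sz (l a) + 1)
        fun k hk => h2 k (List.mem_range.1 hk).le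
      rw [List.length_range] at h4
      have h5 : l₁.length * ((4 * sz (l a) + 1) + 1) ≤ sz (l a) * ((4 * sz (l a) + 1) + 1) := by
        gcongr
        omega
      omega)
  have h2 : Poly fun a => ((l a).length, (List.range (l a).length).reverse) := by
    convert this using 2 with a
    exact (hs _).symm
  have h3 := h2.snd.reverse
  simp only [List.reverse_reverse] at h3
  exact h3

@[fun_prop]
theorem Poly.getD {l : α → List β} {i : α → ℕ} {d : α → β} (hl : Poly l) (hi : Poly i)
    (hd : Poly d) : Poly fun a => (l a).getD (i a) (d a) := by
  have hs : ∀ (l : List β) (i : ℕ) (d : β),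
      l.foldl (fun (s : ℕ × β) x => (s.1 + 1, bif decide (s.1 = i) then x else s.2)) (0, d) =
      (l.length, l.getD i d) := by
    intro l i d
    induction l using List.reverseRecOn with
    | nil => simp
    | append_singleton l x ih =>
      simp only [List.foldl_append, ih, List.foldl_cons, List.foldl_nil, List.length_append,
        List.length_singleton, Prod.mk.injEq, true_and]
      rcases lt_trichotomy i l.length with h | h | h
      · simp [h, h.ne', List.getElem?_append]
      · simp [h]
      · have h1 : ¬ l.length = i := by omega
        have h2 : l.length + 1 ≤ i := by omega
        rw [List.getD_eq_default _ _ h.le, List.getD_eq_default _ _ (by simpa using h2)]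
        simp [h1]
  have := Poly.foldl (l := l) (i := fun a => (0, d a))
    (g := fun a s x => (s.1 + 1, bif decide (s.1 = i a) then x else s.2)) hl (by fun_prop)
    (by fun_prop) (B := fun a => (4 * sz (l a) + 1) + (sz (l a) + sz (d a)) + 1)
    (((((PBd.const 4).mul hl.szBd).add (.const 1)).add (hl.szBd.add hd.szBd)).add (.const 1))
    (fun a l₁ l₂ h => by
      have h1 := length_lt_sz (l a)
      rw [h, List.length_append] at h1
      rw [← h] at h1
      have h2 : l₁.length.size ≤ l₁.length := Nat.size_le.2 Nat.lt_two_pow_self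
      have h3 := sz_nat_le l₁.length
      rw [hs, sz_pair]
      have h4 : sz (l₁.getD (i a) (d a)) ≤ sz (l a) + sz (d a) := by
        rcases lt_or_ge (i a) l₁.length with h' | h'
        · rw [List.getD_eq_getElem _ _ h']
          have := sz_mem_lt (a := l₁[i a]) (l := l a) (by rw [h]; simp)
          omega
        · rw [List.getD_eq_default _ _ h']
          omega
      omega)
  have h2 : Poly fun a => ((l a).length, (l a).getD (i a) (d a)) := by
    convert this using 2 with a
    exact (hs _ _ _).symm
  exact h2.snd

/-! ### Extended natural numbers -/

@[simp] theorem sz_top : sz (⊤ : ℕ∞) = 1 := rfl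
@[simp] theorem sz_coe (n : ℕ) : sz (n : ℕ∞) = sz n + 2 := rfl

@[fun_prop]
theorem Poly.coe {f : α → ℕ} (hf : Poly f) : Poly fun a => (f a : ℕ∞) := hf.some

theorem Poly.enat_cases {o : α → ℕ∞} {f : α → γ} {g : α → ℕ → γ} (ho : Poly o)
    (hf : Poly f) (hg : Poly fun p : α × ℕ => g p.1 p.2) {h : α → γ}
    (h1 : ∀ a, o a = ⊤ → h a = f a) (h2 : ∀ a (n : ℕ), o a = n → h a = g a n) : Poly h := by
  have ho' : Poly fun a => (show Option ℕ from o a) := ho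
  convert Poly.option_cases (g := g) ho' hf hg using 2 with a
  cases h : o a with
  | top => exact h1 a h
  | coe n => exact h2 a n h

@[fun_prop]
theorem Poly.enatAdd {f g : α → ℕ∞} (hf : Poly f) (hg : Poly g) : Poly fun a => f a + g a := by
  refine .enat_cases (o := f) (f := fun _ => ⊤)
    (g := fun a n => g a + n) hf (by fun_prop) ?_ (fun a h => by rw [h, top_add])
    (fun a n h => by rw [h, add_comm])
  refine .enat_cases (o := fun p : α × ℕ => g p.1) (f := fun _ => ⊤)
    (g := fun p m => ((p.2 + m : ℕ) : ℕ∞)) (by fun_prop) (by fun_prop) (by fun_prop)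
    (fun a h => by rw [h, top_add]) (fun a n h => by rw [h, Nat.cast_add, add_comm])

@[fun_prop]
theorem Poly.enatLe {f g : α → ℕ∞} (hf : Poly f) (hg : Poly g) :
    Poly fun a => decide (f a ≤ g a) := by
  refine .enat_cases (o := g) (f := fun _ => true)
    (g := fun a n => decide (f a ≤ n)) hg (by fun_prop) ?_ (fun a h => by simp [h])
    (fun a n h => by simp [h])
  refine .enat_cases (o := fun p : α × ℕ => f p.1) (f := fun _ => false)
    (g := fun p m => decide (m ≤ p.2)) (by fun_prop) (by fun_prop) (by fun_prop)
    (fun a h => by simp [h]) (fun a n h => by simp [h])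

@[fun_prop]
theorem Poly.enatMin {f g : α → ℕ∞} (hf : Poly f) (hg : Poly g) :
    Poly fun a => min (f a) (g a) := by
  have : Poly fun a => bif decide (f a ≤ g a) then f a else g a := by fun_prop
  convert this using 2 with a
  by_cases h : f a ≤ g a
  · simp [h]
  · simp [h, (not_le.1 h).le]

@[fun_prop]
theorem Poly.min {f g : α → ℕ} (hf : Poly f) (hg : Poly g) :
    Poly fun a => min (f a) (g a) := by
  have : Poly fun a => bif decide (f a ≤ g a) then f a else g a := by fun_prop
  convert this using 2 with a
  by_cases h : f a ≤ g a
  · simp [h]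
  · simp [h, (not_le.1 h).le]

/-- The list with a finite number as its only element, or the empty list. -/
def finList (x : ℕ∞) : List ℕ := bif decide (x ≤ x.toNat) then [x.toNat] else []

theorem mem_finList {x : ℕ∞} {n : ℕ} : n ∈ finList x ↔ x = n := by
  cases x with
  | top => simp [finList]
  | coe m => simp [finList, eq_comm]

@[fun_prop]
theorem Poly.finList {f : α → ℕ∞} (hf : Poly f) : Poly fun a => finList (f a) := by
  refine .enat_cases (o := f) (f := fun _ => []) (g := fun _ n => [n]) hf (by fun_prop)
    (by fun_prop) (fun a h => by simp [h, KSwO.finList]) (fun a n h => by simp [h, KSwO.finList])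

@[fun_prop]
theorem Poly.prod {l : α → List ℕ} (hl : Poly l) : Poly fun a => (l a).prod := by
  have hs : ∀ l : List ℕ, l.prod.size ≤ sz l := by
    intro l
    induction l with
    | nil => simp
    | cons x l ih =>
      have h1 := size_mul_le x l.prod
      have h2 := two_mul_size_lt_sz x
      rw [List.prod_cons, sz_cons]
      omega
  have := Poly.foldl (l := l) (i := fun _ => 1) (g := fun _ s x => s * x) hl (by fun_prop)
    (by fun_prop) (B := fun a => 4 * sz (l a) + 1)
    (((PBd.const 4).mul hl.szBd).add (.const 1)) (fun a l₁ l₂ h => by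
      refine (sz_nat_le _).trans ?_
      rw [← List.prod_eq_foldl]
      have h1 := hs l₁
      have h2 := sz_sublist (List.sublist_append_left l₁ l₂)
      rw [h]
      omega)
  convert this using 2 with a
  exact List.prod_eq_foldl

end Numbers

/-! ### Recursion over a tree of subproblems -/

section TreeRec

variable {α β γ σ : Type} [Enc α] [Enc β] [Enc γ] [Enc σ]

/-- Iteration over a list, where the result of every step is polynomially bounded. -/
theorem Poly.foldl_bdd {l : α → List β} {g : α → σ → β → σ} {i : α → σ}
    (hl : Poly l) (hi : Poly i) (hg : Poly fun p : α × σ × β => g p.1 p.2.1 p.2.2)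
    {D : α → ℕ} (hD : PBd D) (hb : ∀ a s, ∀ x ∈ l a, sz (g a s x) ≤ D a) :
    Poly fun a => (l a).foldl (g a) (i a) := by
  refine .foldl hl hi hg (B := fun a => sz (i a) + D a) (hi.szBd.add hD) fun a l₁ l₂ h => ?_
  rcases List.eq_nil_or_concat l₁ with rfl | ⟨l', x, rfl⟩
  · simp
  · have := hb a (l'.foldl (g a) (i a)) x (by simp [h])
    simp only [List.concat_eq_append, List.foldl_append, List.foldl_cons, List.foldl_nil]
    omega

/-- Divide and conquer: `ch x` is the list of subproblems of `x`, and `comb x` combines their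
results. The first argument bounds the depth of the recursion. -/
def treeRec {X Y : Type} (ch : X → List X) (comb : X → List Y → Y) (d : Y) : ℕ → X → Y
  | 0, _ => d
  | f + 1, x => comb x ((ch x).map (treeRec ch comb d f))

/-- The subproblems at a given depth. -/
def level {X : Type} (ch : X → List X) (x : X) : ℕ → List X
  | 0 => [x]
  | j + 1 => (level ch x j).flatMap ch

/-- Look up a key in an association list. -/
def assocD {X Y : Type} [DecidableEq X] (s : List (X × Y)) (x : X) (d : Y) : Y :=
  ((s.filter fun p => decide (p.1 = x)).map fun p => p.2).headD d

theorem assocD_map {X Y : Type} [DecidableEq X] (l : List X) (f : X → Y) {x : X} (hx : x ∈ l)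
    (d : Y) : assocD (l.map fun x => (x, f x)) x d = f x := by
  unfold assocD
  induction l with
  | nil => simp at hx
  | cons y l ih =>
    by_cases h : y = x
    · simp [h]
    · have : x ∈ l := by
        rcases List.mem_cons.1 hx with rfl | h'
        · exact absurd rfl h
        · exact h'
      simpa [h] using ih this

@[fun_prop]
theorem Poly.assocD {X Y : Type} [DecidableEq X] [Enc X] [Enc Y] [PolyEq X]
    {s : α → List (X × Y)} {x : α → X} {d : α → Y} (hs : Poly s) (hx : Poly x) (hd : Poly d) :
    Poly fun a => assocD (s a) (x a) (d a) := by
  unfold KSwO.assocD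
  fun_prop

/-- The recursion is evaluated without a stack, level by level from the bottom, with the results of
the level below in an association list. Equal subproblems have equal results, so duplicates do no
harm. At the bottom the list is empty and every lookup gives `d`, as `treeRec` does when its fuel is
used up. -/
theorem treeRec_foldr {X Y : Type} [DecidableEq X] (ch : X → List X) (comb : X → List Y → Y)
    (d : Y) (x : X) (n j : ℕ) :
    ((List.range' j (n + 1)).map (level ch x)).foldr (fun L s =>
      L.map fun x => (x, comb x ((ch x).map fun y => assocD s y d))) [] =
      (level ch x j).map fun y => (y, treeRec ch comb d (n + 1) y) := by
  induction n generalizing j with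
  | zero =>
    simp [assocD, treeRec]
  | succ n ih =>
    rw [List.range'_succ, List.map_cons, List.foldr_cons, ih (j + 1)]
    refine List.map_congr_left fun y hy => ?_
    rw [treeRec]
    congr 2
    refine List.map_congr_left fun z hz => ?_
    exact assocD_map _ _ (List.mem_flatMap.2 ⟨y, hy, hz⟩) d

/-- Only the total size of each level and the size of single results matter. The bound `hres` is for
arbitrary arguments of `comb`, so nothing has to be known about the results that actually occur;
clipping provides such a bound for tables. -/
theorem Poly.treeRec {X Y : Type} [DecidableEq X] [Enc X] [Enc Y] [PolyEq X]
    {ch : α → X → List X} {comb : α → X → List Y → Y} {d : Y} {x : α → X} {fuel : α → List β}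
    (hch : Poly fun p : α × X => ch p.1 p.2)
    (hcomb : Poly fun p : α × X × List Y => comb p.1 p.2.1 p.2.2)
    (hx : Poly x) (hfuel : Poly fuel)
    {B D : α → ℕ} (hB : PBd B) (hD : PBd D)
    (hlev : ∀ a, ∀ j ≤ (fuel a).length, sz (level (ch a) (x a) j) ≤ B a)
    (hres : ∀ a x l, sz (comb a x l) ≤ D a) :
    Poly fun a => treeRec (ch a) (comb a) d ((fuel a).length + 1) (x a) := by
  -- First pass, top-down: collect all levels, the deepest one at the front, so that the second pass
  -- meets them in bottom-up order.
  have hup : ∀ a (l : List β), l.foldl (fun s _ => (s.headD []).flatMap (ch a) :: s) [[x a]] =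
      ((List.range' 0 (l.length + 1)).map (level (ch a) (x a))).reverse := by
    intro a l
    induction l using List.reverseRecOn with
    | nil => simp [level]
    | append_singleton l y ih =>
      rw [List.foldl_append, ih, List.foldl_cons, List.foldl_nil, List.length_append,
        List.length_singleton, List.range'_concat (n := l.length + 1), List.map_append,
        List.reverse_append, List.map_singleton, List.reverse_singleton, List.singleton_append]
      congr 1
      rw [List.range'_concat, List.map_append, List.reverse_append]
      simp [level]
  have hszlev : ∀ a, ∀ k ≤ (fuel a).length,
      sz ((List.range' 0 (k + 1)).map (level (ch a) (x a))).reverse ≤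
        (sz (fuel a) + 1) * (B a + 1) + 1 := by
    intro a k hk
    have h1 := length_lt_sz (fuel a)
    have := sz_list_le (l := ((List.range' 0 (k + 1)).map (level (ch a) (x a))).reverse) (B := B a) (by
      intro L hL
      simp only [List.mem_reverse, List.mem_map, List.mem_range'_1] at hL
      obtain ⟨j, hj, rfl⟩ := hL
      exact hlev a j (by omega))
    refine this.trans ?_
    simp only [List.length_reverse, List.length_map, List.length_range']
    gcongr
    omega
  have hl : Poly fun a => ((List.range' 0 ((fuel a).length + 1)).map (level (ch a) (x a))).reverse := by
    have h1 : Poly fun p : α × List (List X) × β =>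
        (p.2.1.headD []).flatMap (ch p.1) :: p.2.1 := by
      have : Poly fun p : (α × List (List X) × β) × X => ch p.1.1 p.2 :=
        hch.comp (g := fun p : (α × List (List X) × β) × X => (p.1.1, p.2)) (by fun_prop)
      fun_prop
    have := Poly.foldl (l := fuel) (i := fun a => [[x a]])
      (g := fun a s _ => (s.headD []).flatMap (ch a) :: s) hfuel (by fun_prop) h1
      (B := fun a => (sz (fuel a) + 1) * (B a + 1) + 1)
      (((hfuel.szBd.add (.const 1)).mul (hB.add (.const 1))).add (.const 1))
      (fun a l₁ l₂ h => by
        rw [hup]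
        exact hszlev a _ (by simp [h]))
    simpa only [hup] using this
  have h2 : Poly fun p : α × List (X × Y) × List X =>
      p.2.2.map fun x => (x, comb p.1 x ((ch p.1 x).map fun y => KSwO.assocD p.2.1 y d)) := by
    have h1 : Poly fun p : (α × List (X × Y) × List X) × X => ch p.1.1 p.2 :=
      hch.comp (g := fun p : (α × List (X × Y) × List X) × X => (p.1.1, p.2)) (by fun_prop)
    have h2 : Poly fun p : (α × List (X × Y) × List X) × X =>
        (ch p.1.1 p.2).map fun y => KSwO.assocD p.1.2.1 y d := by fun_prop
    have h3 : Poly fun p : (α × List (X × Y) × List X) × X =>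
        comb p.1.1 p.2 ((ch p.1.1 p.2).map fun y => KSwO.assocD p.1.2.1 y d) :=
      hcomb.comp (g := fun p : (α × List (X × Y) × List X) × X =>
        (p.1.1, p.2, (ch p.1.1 p.2).map fun y => KSwO.assocD p.1.2.1 y d)) (by fun_prop)
    fun_prop
  have h3 := Poly.foldl_bdd (i := fun _ => ([] : List (X × Y)))
    (g := fun a s L => L.map fun x => (x, comb a x ((ch a x).map fun y => KSwO.assocD s y d)))
    hl (by fun_prop) h2
    (D := fun a => B a * (B a + D a + 1 + 1) + 1)
    ((hB.mul (((hB.add hD).add (.const 1)).add (.const 1))).add (.const 1)) (by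
      intro a s L hL
      simp only [List.mem_reverse, List.mem_map, List.mem_range'_1] at hL
      obtain ⟨j, hj, rfl⟩ := hL
      have hj' := hlev a j (by omega)
      refine (sz_list_le (B := B a + D a + 1) ?_).trans ?_
      · intro y hy
        obtain ⟨z, hz, rfl⟩ := List.mem_map.1 hy
        have h1 := sz_mem_lt hz
        have h2 := hres a z ((ch a z).map fun y => KSwO.assocD s y d)
        rw [sz_pair]
        omega
      · rw [List.length_map]
        have := length_lt_sz (level (ch a) (x a) j)
        gcongr
        omega)
  have h4 : Poly fun a => KSwO.assocD ((List.map (fun y => (y, KSwO.treeRec (ch a) (comb a) d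
      ((fuel a).length + 1) y)) (level (ch a) (x a) 0))) (x a) d := by
    simp only [List.foldl_reverse, treeRec_foldr] at h3
    fun_prop
  simpa [level, KSwO.assocD] using h4

end TreeRec

/-! ### The algorithm -/

section Algorithm

variable {α β γ σ : Type} [Enc α] [Enc β] [Enc γ] [Enc σ]

/-- The element of a list of numbers. -/
def mem (X : List ℕ) (u : ℕ) : Bool := X.any fun x => decide (x = u)

theorem mem_iff {X : List ℕ} {u : ℕ} : mem X u = true ↔ u ∈ X := by
  simp [mem]

@[fun_prop]
theorem Poly.mem {f : α → List ℕ} {g : α → ℕ} (hf : Poly f) (hg : Poly g) :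
    Poly fun a => mem (f a) (g a) := by
  unfold KSwO.mem
  fun_prop

@[fun_prop]
theorem Poly.takeOne {l : α → List β} (hl : Poly l) : Poly fun a => (l a).take 1 := by
  have : Poly fun a => (l a).take [()].length := by fun_prop
  exact this

/-- An entry of a matrix. -/
def get2 {δ : Type} (M : List (List δ)) (u v : ℕ) (d : δ) : δ := (M.getD u []).getD v d

@[fun_prop]
theorem Poly.get2 {M : α → List (List β)} {u v : α → ℕ} {d : α → β} (hM : Poly M) (hu : Poly u)
    (hv : Poly v) (hd : Poly d) : Poly fun a => get2 (M a) (u a) (v a) (d a) := by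
  unfold KSwO.get2
  fun_prop

/-- The matrix of a function. -/
def tab2 {δ : Type} (R : List ℕ) (f : ℕ → ℕ → δ) : List (List δ) :=
  R.map fun u => R.map fun v => f u v

theorem get2_tab2 {δ : Type} (n : ℕ) (f : ℕ → ℕ → δ) (u v : ℕ) (d : δ) :
    get2 (tab2 (List.range n) f) u v d = if u < n ∧ v < n then f u v else d := by
  unfold get2 tab2
  by_cases hu : u < n <;> by_cases hv : v < n <;> simp [hu, hv]

@[fun_prop]
theorem Poly.tab2 {R : α → List ℕ} {f : α → ℕ → ℕ → β} (hR : Poly R)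
    (hf : Poly fun p : (α × ℕ) × ℕ => f p.1.1 p.1.2 p.2) : Poly fun a => tab2 (R a) (f a) :=
  .map hR (.map (by fun_prop) hf)

/-! ### Shortest paths in polynomial time -/

/-- One round of the Floyd–Warshall algorithm. -/
def fwStep (R : List ℕ) (M : List (List ℕ∞)) (j : ℕ) : List (List ℕ∞) :=
  tab2 R fun u v => min (get2 M u v ⊤) (get2 M u j ⊤ + get2 M j v ⊤)

/-- The Floyd–Warshall algorithm. -/
def fw (R : List ℕ) (M : List (List ℕ∞)) : List (List ℕ∞) := R.foldl (fwStep R) M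

theorem sz_enat_le (x : ℕ∞) : sz x ≤ 4 * x.toNat.size + 3 := by
  cases x with
  | top => simp
  | coe n =>
    have := sz_nat_le n
    rw [sz_coe, ENat.toNat_natCast]
    omega

theorem size_le_sz_enat (x : ℕ∞) : x.toNat.size ≤ sz x := by
  cases x with
  | top => simp
  | coe n =>
    have := two_mul_size_lt_sz n
    rw [sz_coe, ENat.toNat_natCast]
    omega

theorem get2_mem_or {δ : Type} (M : List (List δ)) (u v : ℕ) (d : δ) :
    (∃ l ∈ M, get2 M u v d ∈ l) ∨ get2 M u v d = d := by
  unfold get2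
  rcases lt_or_ge u M.length with hu | hu
  · rw [List.getD_eq_getElem _ _ hu]
    rcases lt_or_ge v M[u].length with hv | hv
    · rw [List.getD_eq_getElem _ _ hv]
      exact Or.inl ⟨M[u], by simp, by simp⟩
    · exact Or.inr (List.getD_eq_default _ _ hv)
  · rw [List.getD_eq_default _ _ hu]
    exact Or.inr rfl

/-- A new finite entry is an old one or a sum of two old ones, so every round adds at most one bit.
-/
theorem size_fwStep (R : List ℕ) (M : List (List ℕ∞)) (l : List ℕ) (b : ℕ)
    (hb : ∀ x, (∃ r ∈ M, x ∈ r) → x.toNat.size ≤ b) :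
    ∀ x, (∃ r ∈ l.foldl (fwStep R) M, x ∈ r) → x.toNat.size ≤ b + l.length := by
  induction l using List.reverseRecOn with
  | nil => simpa using hb
  | append_singleton l j ih =>
    intro x hx
    rw [List.foldl_append, List.foldl_cons, List.foldl_nil] at hx
    obtain ⟨r, hr, hx⟩ := hx
    simp only [fwStep, tab2, List.mem_map] at hr
    obtain ⟨u, -, rfl⟩ := hr
    obtain ⟨v, -, rfl⟩ := List.mem_map.1 hx
    have h : ∀ u v, (get2 (l.foldl (fwStep R) M) u v ⊤).toNat.size ≤ b + l.length := by
      intro u v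
      rcases get2_mem_or (l.foldl (fwStep R) M) u v ⊤ with h | h
      · exact ih _ h
      · rw [h]; simp
    have h1 := h u v
    have h2 := h u j
    have h3 := h j v
    rw [List.length_append, List.length_singleton]
    generalize get2 (l.foldl (fwStep R) M) u v ⊤ = x at *
    generalize get2 (l.foldl (fwStep R) M) u j ⊤ = y at *
    generalize get2 (l.foldl (fwStep R) M) j v ⊤ = z at *
    rcases min_choice x (y + z) with h | h <;> rw [h]
    · omega
    · cases y with
      | top => simp
      | coe y =>
        cases z with
        | top => simp
        | coe z =>
          rw [← Nat.cast_add, ENat.toNat_natCast]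
          rw [ENat.toNat_natCast] at h2 h3
          have := size_add_le y z
          omega

@[fun_prop]
theorem Poly.fw {R : α → List ℕ} {M : α → List (List ℕ∞)} (hR : Poly R) (hM : Poly M) :
    Poly fun a => fw (R a) (M a) := by
  have h1 : Poly fun p : α × List (List ℕ∞) × ℕ => fwStep (R p.1) p.2.1 p.2.2 := by
    unfold fwStep
    fun_prop
  have hs : PBd fun a => sz (R a) * (sz (R a) * (4 * (sz (M a) + sz (R a)) + 3 + 1) + 1 + 1) + 1 :=
    (hR.szBd.mul (((hR.szBd.mul ((((PBd.const 4).mul (hM.szBd.add hR.szBd)).add (.const 3)).add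
      (.const 1))).add (.const 1)).add (.const 1))).add (.const 1)
  refine .foldl (g := fun a => fwStep (R a)) hR hM h1 (hM.szBd.add hs) fun a l₁ l₂ h => ?_
  rcases List.eq_nil_or_concat l₁ with rfl | ⟨l, j, rfl⟩
  · simp
  refine le_trans ?_ (Nat.le_add_left _ _)
  have hlen : l.length < sz (R a) := by
    have := length_lt_sz (R a)
    rw [h, List.length_append] at this
    simp only [List.concat_eq_append, List.length_append, List.length_singleton] at this
    rw [h]
    simp only [List.concat_eq_append]
    omega
  have hb := size_fwStep (R a) (M a) (l ++ [j]) (sz (M a)) (by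
    rintro x ⟨r, hr, hx⟩
    have h1 := sz_mem_lt hr
    have h2 := sz_mem_lt hx
    have h3 := size_le_sz_enat x
    omega)
  rw [List.concat_eq_append]
  rw [List.length_append, List.length_singleton] at hb
  have hRl := length_lt_sz (R a)
  refine (sz_list_le (B := sz (R a) * (4 * (sz (M a) + sz (R a)) + 3 + 1) + 1) ?_).trans ?_
  · intro r hr
    refine (sz_list_le (B := 4 * (sz (M a) + sz (R a)) + 3) ?_).trans ?_
    · intro x hx
      have h2 := hb x ⟨r, hr, hx⟩
      have h3 := sz_enat_le x
      omega
    · rw [List.foldl_append, List.foldl_cons, List.foldl_nil, fwStep, KSwO.tab2] at hr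
      obtain ⟨u, -, rfl⟩ := List.mem_map.1 hr
      rw [List.length_map]
      gcongr
  · rw [List.foldl_append, List.foldl_cons, List.foldl_nil, fwStep, KSwO.tab2, List.length_map]
    gcongr

/-- The data on which the dynamic program works. -/
structure Ctx where
  /-- the vertices -/
  R : List ℕ
  /-- the nodes of the tree decomposition -/
  Q : List ℕ
  /-- the adjacency matrix of the tree -/
  adj : List (List Bool)
  /-- the membership matrix of the bags -/
  bag : List (List Bool)
  /-- the scaled distances -/
  dist : List (List ℕ∞)
  /-- the suppliers -/
  sup : List Bool
  /-- the clients -/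
  cli : List Bool
  /-- the codes of the labels -/
  codes : List ℕ
  /-- the code of the label of unserved vertices -/
  top : ℕ
  /-- the number of grid points below the guessed radius -/
  H : ℕ
  /-- the bound for the size of tables, in unary -/
  bd : List Unit
  /-- the bound for the depth, in unary -/
  fuel : List Bool

/-- A context as a tuple. -/
def Ctx.toTuple (c : Ctx) : List ℕ × List ℕ × List (List Bool) × List (List Bool) ×
    List (List ℕ∞) × List Bool × List Bool × List ℕ × ℕ × ℕ × List Unit × List Bool :=
  (c.R, c.Q, c.adj, c.bag, c.dist, c.sup, c.cli, c.codes, c.top, c.H, c.bd, c.fuel)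

instance : Enc Ctx := ⟨fun c => enc c.toTuple, fun c => sz c.toTuple, fun _ => Enc.size_le _⟩

theorem Poly.toTuple {f : α → Ctx} (hf : Poly f) : Poly fun a => (f a).toTuple :=
  .of_enc hf (fun _ => rfl) hf.szBd

@[fun_prop] theorem Poly.ctxR {f : α → Ctx} (hf : Poly f) : Poly fun a => (f a).R :=
  hf.toTuple.fst
@[fun_prop] theorem Poly.ctxQ {f : α → Ctx} (hf : Poly f) : Poly fun a => (f a).Q :=
  hf.toTuple.snd.fst
@[fun_prop] theorem Poly.ctxAdj {f : α → Ctx} (hf : Poly f) : Poly fun a => (f a).adj :=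
  hf.toTuple.snd.snd.fst
@[fun_prop] theorem Poly.ctxBag {f : α → Ctx} (hf : Poly f) : Poly fun a => (f a).bag :=
  hf.toTuple.snd.snd.snd.fst
@[fun_prop] theorem Poly.ctxDist {f : α → Ctx} (hf : Poly f) : Poly fun a => (f a).dist :=
  hf.toTuple.snd.snd.snd.snd.fst
@[fun_prop] theorem Poly.ctxSup {f : α → Ctx} (hf : Poly f) : Poly fun a => (f a).sup :=
  hf.toTuple.snd.snd.snd.snd.snd.fst
@[fun_prop] theorem Poly.ctxCli {f : α → Ctx} (hf : Poly f) : Poly fun a => (f a).cli :=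
  hf.toTuple.snd.snd.snd.snd.snd.snd.fst
@[fun_prop] theorem Poly.ctxCodes {f : α → Ctx} (hf : Poly f) : Poly fun a => (f a).codes :=
  hf.toTuple.snd.snd.snd.snd.snd.snd.snd.fst
@[fun_prop] theorem Poly.ctxTop {f : α → Ctx} (hf : Poly f) : Poly fun a => (f a).top :=
  hf.toTuple.snd.snd.snd.snd.snd.snd.snd.snd.fst
@[fun_prop] theorem Poly.ctxH {f : α → Ctx} (hf : Poly f) : Poly fun a => (f a).H :=
  hf.toTuple.snd.snd.snd.snd.snd.snd.snd.snd.snd.fst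
@[fun_prop] theorem Poly.ctxBd {f : α → Ctx} (hf : Poly f) : Poly fun a => (f a).bd :=
  hf.toTuple.snd.snd.snd.snd.snd.snd.snd.snd.snd.snd.fst
@[fun_prop] theorem Poly.ctxFuel {f : α → Ctx} (hf : Poly f) : Poly fun a => (f a).fuel :=
  hf.toTuple.snd.snd.snd.snd.snd.snd.snd.snd.snd.snd.snd

/-! #### Pieces of the tree -/

/-- Membership of a vertex in the bag of a node. -/
def inBag (c : Ctx) (t v : ℕ) : Bool := get2 c.bag t v false

/-- Membership of a vertex in the bag of one of several nodes. -/
def inB (c : Ctx) (B : List ℕ) (v : ℕ) : Bool := B.any fun b => inBag c b v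

/-- Adjacency in the tree. -/
def adjT (c : Ctx) (s t : ℕ) : Bool := get2 c.adj s t false

/-- The vertices in the bags of several nodes. -/
def verts (c : Ctx) (B : List ℕ) : List ℕ := c.R.filter fun v => inB c B v

/-- Reachability in the tree inside a set of nodes. -/
def reachMat (c : Ctx) (X : List ℕ) : List (List ℕ∞) :=
  fw c.Q (tab2 c.Q fun u v =>
    bif mem X u && (mem X v && (decide (u = v) || adjT c u v)) then 0 else ⊤)

/-- The first node of `X` that is reachable from `y`, for a reachability matrix. -/
def rep (M : List (List ℕ∞)) (X : List ℕ) (y : ℕ) : ℕ :=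
  (X.filter fun z => decide (get2 M y z ⊤ ≤ 0)).headD y

/-- The component of `X` with the representative `x`. -/
def comp (M : List (List ℕ∞)) (X : List ℕ) (x : ℕ) : List ℕ :=
  X.filter fun y => decide (rep M X y = x)

/-- A set of nodes without a node. -/
def without (C : List ℕ) (t : ℕ) : List ℕ := C.filter fun x => !decide (x = t)

/-- The representatives of the components of `X`. -/
def reps (M : List (List ℕ∞)) (X : List ℕ) : List ℕ := X.filter fun x => decide (rep M X x = x)

/-- The nodes of a list that are adjacent to a set. -/
def nbrs (c : Ctx) (B D : List ℕ) : List ℕ := B.filter fun b => D.any fun d => adjT c b d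

/-- The components that remain when a node is removed from a piece. A piece is a pair of a set of
nodes and its boundary. -/
def split (c : Ctx) (pc : List ℕ × List ℕ) (t : ℕ) : List (List ℕ × List ℕ) :=
  (reps (reachMat c (without pc.1 t)) (without pc.1 t)).map fun x =>
    (comp (reachMat c (without pc.1 t)) (without pc.1 t) x,
      nbrs c (t :: pc.2) (comp (reachMat c (without pc.1 t)) (without pc.1 t) x))

/-- Good nodes for splitting a piece: they halve the piece, or its boundary if that is large. -/
def good (c : Ctx) (pc : List ℕ × List ℕ) (t : ℕ) : Bool :=
  (split c pc t).all fun q => bif decide (pc.2.length ≤ 2)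
    then decide (2 * q.1.length ≤ pc.1.length) else decide (q.2.length ≤ 2)

/-- The node at which a piece is split. -/
def pick (c : Ctx) (pc : List ℕ × List ℕ) : List ℕ := (pc.1.filter fun t => good c pc t).take 1

/-- The subpieces of a piece. -/
def children (c : Ctx) (pc : List ℕ × List ℕ) : List (List ℕ × List ℕ) :=
  (pick c pc).flatMap fun t => split c pc t

/-! ### Polynomial time of the operations on pieces -/

section

variable {c : α → Ctx} {B C D : α → List ℕ} {s t u v r x y : α → ℕ} {M : α → List (List ℕ∞)}
  {pc : α → List ℕ × List ℕ}

@[fun_prop]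
theorem Poly.inBag (hc : Poly c) (ht : Poly t) (hv : Poly v) :
    Poly fun a => inBag (c a) (t a) (v a) := by
  unfold KSwO.inBag
  fun_prop

@[fun_prop]
theorem Poly.inB (hc : Poly c) (hB : Poly B) (hv : Poly v) :
    Poly fun a => inB (c a) (B a) (v a) := by
  unfold KSwO.inB
  fun_prop

@[fun_prop]
theorem Poly.adjT (hc : Poly c) (hs : Poly s) (ht : Poly t) :
    Poly fun a => adjT (c a) (s a) (t a) := by
  unfold KSwO.adjT
  fun_prop

@[fun_prop]
theorem Poly.verts (hc : Poly c) (hB : Poly B) : Poly fun a => verts (c a) (B a) := by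
  unfold KSwO.verts
  fun_prop

@[fun_prop]
theorem Poly.reachMat (hc : Poly c) (hB : Poly B) : Poly fun a => reachMat (c a) (B a) := by
  unfold KSwO.reachMat
  fun_prop

@[fun_prop]
theorem Poly.rep (hM : Poly M) (hB : Poly B) (hy : Poly y) :
    Poly fun a => rep (M a) (B a) (y a) := by
  unfold KSwO.rep
  fun_prop

@[fun_prop]
theorem Poly.compOf (hM : Poly M) (hB : Poly B) (hy : Poly y) :
    Poly fun a => KSwO.comp (M a) (B a) (y a) := by
  unfold KSwO.comp
  fun_prop

@[fun_prop]
theorem Poly.without (hB : Poly B) (hy : Poly y) : Poly fun a => without (B a) (y a) := by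
  unfold KSwO.without
  fun_prop

@[fun_prop]
theorem Poly.reps (hM : Poly M) (hB : Poly B) : Poly fun a => reps (M a) (B a) := by
  unfold KSwO.reps
  fun_prop

@[fun_prop]
theorem Poly.nbrs (hc : Poly c) (hB : Poly B) (hD : Poly D) :
    Poly fun a => nbrs (c a) (B a) (D a) := by
  unfold KSwO.nbrs
  fun_prop

@[fun_prop]
theorem Poly.split (hc : Poly c) (hpc : Poly pc) (ht : Poly t) :
    Poly fun a => split (c a) (pc a) (t a) := by
  unfold KSwO.split
  fun_prop

@[fun_prop]
theorem Poly.good (hc : Poly c) (hpc : Poly pc) (ht : Poly t) :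
    Poly fun a => good (c a) (pc a) (t a) := by
  unfold KSwO.good
  fun_prop

@[fun_prop]
theorem Poly.pick (hc : Poly c) (hpc : Poly pc) : Poly fun a => pick (c a) (pc a) := by
  unfold KSwO.pick
  fun_prop

@[fun_prop]
theorem Poly.children (hc : Poly c) (hpc : Poly pc) : Poly fun a => children (c a) (pc a) := by
  unfold KSwO.children
  fun_prop

end

/-! #### Tables of partial labellings -/

/-- The code of a vertex in a partial labelling; `0` if it has no label. -/
def val (q : List ℕ) (v : ℕ) : ℕ := q.getD v 0

/-- `u` witnesses the label of `v`: the label of `u` and the distance of `u` from `v` account for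
the label of `v`. -/
def wit (c : Ctx) (r : ℕ) (q : List ℕ) (u v : ℕ) : Bool :=
  decide (0 < val q u) && (decide (val q u < val q v) &&
    (finList (get2 c.dist u v ⊤)).any fun d => decide (val q u * r + c.H * d ≤ val q v * r))

/-- The label of `v` is accounted for. -/
def sat (c : Ctx) (r : ℕ) (q : List ℕ) (v : ℕ) : Bool :=
  decide (val q v = 1) || (decide (val q v = c.top) || c.R.any fun u => wit c r q u v)

/-- The number of opened suppliers. -/
def numOpen (c : Ctx) (q : List ℕ) : ℕ := (c.R.filter fun v => decide (val q v = 1)).length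

/-- The number of unserved clients. -/
def numOut (c : Ctx) (q : List ℕ) : ℕ :=
  (c.R.filter fun v => c.cli.getD v false && decide (val q v = c.top)).length

/-- The relevant part of a partial labelling for the vertices in `Y`. -/
def key (c : Ctx) (r : ℕ) (Y : List ℕ) (q : List ℕ) : List (ℕ × Bool) × ℕ × ℕ :=
  (Y.map fun v => (val q v, sat c r q v), numOpen c q, numOut c q)

/-- Keep only one partial labelling for every key. -/
def dedupe (c : Ctx) (r : ℕ) (Y : List ℕ) (T : List (List ℕ)) : List (List ℕ) :=
  T.foldl (fun acc q => bif acc.any fun q' => decide (key c r Y q' = key c r Y q)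
    then acc else q :: acc) []

/-- The union of two partial labellings. -/
def union (c : Ctx) (q q' : List ℕ) : List ℕ :=
  c.R.map fun v => bif decide (val q v = 0) then val q' v else val q v

/-- Two partial labellings agree where both are defined. -/
def compat (c : Ctx) (q q' : List ℕ) : Bool :=
  c.R.all fun v => decide (val q v = 0) || (decide (val q' v = 0) || decide (val q v = val q' v))

/-- The unions of compatible elements of two tables. -/
def joins (c : Ctx) (T T' : List (List ℕ)) : List (List ℕ) :=
  T.flatMap fun q => (T'.filter fun q' => compat c q q').map fun q' => union c q q'

/-- Enforce the bounds for the size of a table. -/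
def clip (c : Ctx) (T : List (List ℕ)) : List (List ℕ) :=
  (T.take c.bd.length).map fun q => c.R.map fun v => min (val q v) c.top

/-- Join two tables, up to the equality of keys. -/
def join (c : Ctx) (r : ℕ) (Y : List ℕ) (T T' : List (List ℕ)) : List (List ℕ) :=
  clip c (dedupe c r Y (joins c T T'))

/-- The labellings of a single vertex. -/
def single (c : Ctx) (v : ℕ) : List (List ℕ) :=
  (c.codes.filter fun l => c.sup.getD v false || !decide (l = 1)).map fun l =>
    c.R.map fun u => bif decide (u = v) then l else 0

/-- The join of the labellings of the vertices in `Y` with several tables. -/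
def joinAll (c : Ctx) (r : ℕ) (Y : List ℕ) (tabs : List (List (List ℕ))) : List (List ℕ) :=
  ((Y.map fun v => single c v) ++ tabs).foldl (fun T T' => join c r Y T T') [c.R.map fun _ => 0]

/-- The table of a piece, from the tables of its subpieces. -/
def combine (c : Ctx) (r : ℕ) (pc : List ℕ × List ℕ) (tabs : List (List (List ℕ))) :
    List (List ℕ) :=
  clip c (dedupe c r (verts c pc.2)
    ((joinAll c r (verts c (pick c pc ++ pc.2)) tabs).filter fun q =>
      (verts c (pick c pc ++ pc.2)).all fun v => inB c pc.2 v || sat c r q v))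

/-- The table of the whole tree. -/
def table (c : Ctx) (r : ℕ) : List (List ℕ) :=
  treeRec (children c) (combine c r) [] (c.fuel.length + 1) (List.range c.Q.length, [])

/-- The guesses for the optimum. -/
def radii (c : Ctx) : List ℕ := 0 :: c.dist.flatMap fun l => l.flatMap finList

/-- The guesses for which there is a labelling within the budgets, with such a labelling. -/
def results (c : Ctx) (k p : ℕ) : List (ℕ × List ℕ) :=
  (radii c).flatMap fun r => (((table c r).filter fun q =>
    decide (numOpen c q ≤ k) && decide (numOut c q ≤ p)).take 1).map fun q => (r, q)

/-- A labelling for the smallest possible guess. -/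
def best (c : Ctx) (k p : ℕ) : List ℕ :=
  (((results c k p).filter fun x => (results c k p).all fun y => decide (x.1 ≤ y.1)).map
    fun x => x.2).headD (c.R.map fun _ => 0)

/-- The solution of a labelling. -/
def output (c : Ctx) (q : List ℕ) : List Bool × List Bool :=
  (c.R.map fun v => decide (val q v = 1),
    c.R.map fun v => c.cli.getD v false && decide (val q v = c.top))

/-! ### Polynomial time of the operations on tables -/

section

variable {c : α → Ctx} {q q' Y : α → List ℕ} {r u v k p : α → ℕ} {T T' : α → List (List ℕ)}
  {pc : α → List ℕ × List ℕ} {tabs : α → List (List (List ℕ))}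

@[fun_prop]
theorem Poly.val (hq : Poly q) (hv : Poly v) : Poly fun a => val (q a) (v a) := by
  unfold KSwO.val
  fun_prop

@[fun_prop]
theorem Poly.wit (hc : Poly c) (hr : Poly r) (hq : Poly q) (hu : Poly u) (hv : Poly v) :
    Poly fun a => wit (c a) (r a) (q a) (u a) (v a) := by
  unfold KSwO.wit
  fun_prop

@[fun_prop]
theorem Poly.sat (hc : Poly c) (hr : Poly r) (hq : Poly q) (hv : Poly v) :
    Poly fun a => sat (c a) (r a) (q a) (v a) := by
  unfold KSwO.sat
  fun_prop

@[fun_prop]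
theorem Poly.numOpen (hc : Poly c) (hq : Poly q) : Poly fun a => numOpen (c a) (q a) := by
  unfold KSwO.numOpen
  fun_prop

@[fun_prop]
theorem Poly.numOut (hc : Poly c) (hq : Poly q) : Poly fun a => numOut (c a) (q a) := by
  unfold KSwO.numOut
  fun_prop

@[fun_prop]
theorem Poly.key (hc : Poly c) (hr : Poly r) (hY : Poly Y) (hq : Poly q) :
    Poly fun a => key (c a) (r a) (Y a) (q a) := by
  unfold KSwO.key
  fun_prop

@[fun_prop]
theorem Poly.dedupe (hc : Poly c) (hr : Poly r) (hY : Poly Y) (hT : Poly T) :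
    Poly fun a => dedupe (c a) (r a) (Y a) (T a) := by
  unfold KSwO.dedupe
  refine .foldl_add hT (by fun_prop) (by fun_prop) (D := fun a => sz (T a) + 1)
    (hT.szBd.add (.const 1)) fun a s x hx => ?_
  have := sz_mem_lt hx
  cases s.any fun q' => decide (KSwO.key (c a) (r a) (Y a) q' = KSwO.key (c a) (r a) (Y a) x) <;>
    simp only [cond_true, cond_false, sz_cons] <;> omega

@[fun_prop]
theorem Poly.union (hc : Poly c) (hq : Poly q) (hq' : Poly q') :
    Poly fun a => union (c a) (q a) (q' a) := by
  unfold KSwO.union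
  fun_prop

@[fun_prop]
theorem Poly.compat (hc : Poly c) (hq : Poly q) (hq' : Poly q') :
    Poly fun a => compat (c a) (q a) (q' a) := by
  unfold KSwO.compat
  fun_prop

@[fun_prop]
theorem Poly.joins (hc : Poly c) (hT : Poly T) (hT' : Poly T') :
    Poly fun a => joins (c a) (T a) (T' a) := by
  unfold KSwO.joins
  fun_prop

@[fun_prop]
theorem Poly.clip (hc : Poly c) (hT : Poly T) : Poly fun a => clip (c a) (T a) := by
  unfold KSwO.clip
  fun_prop

@[fun_prop]
theorem Poly.join (hc : Poly c) (hr : Poly r) (hY : Poly Y) (hT : Poly T) (hT' : Poly T') :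
    Poly fun a => join (c a) (r a) (Y a) (T a) (T' a) := by
  unfold KSwO.join
  fun_prop

@[fun_prop]
theorem Poly.single (hc : Poly c) (hv : Poly v) : Poly fun a => single (c a) (v a) := by
  unfold KSwO.single
  fun_prop

/-- The bound for the size of a clipped table. -/
def clipBd (c : Ctx) : ℕ :=
  sz c.bd * (sz c.R * (4 * c.top.size + 1 + 1) + 1 + 1) + 1

/-- The bound depends on the context alone. It therefore controls folds and recursions over tables
before anything is known about their rows; for valid contexts the clipping later turns out to change
nothing. -/
theorem sz_clip_le (c : Ctx) (T : List (List ℕ)) : sz (clip c T) ≤ clipBd c := by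
  have h1 := length_lt_sz c.bd
  have h2 := length_lt_sz c.R
  unfold clip clipBd
  refine (sz_list_le (B := sz c.R * (4 * c.top.size + 1 + 1) + 1) ?_).trans ?_
  · intro q hq
    obtain ⟨q, -, rfl⟩ := List.mem_map.1 hq
    refine (sz_list_le (B := 4 * c.top.size + 1) ?_).trans ?_
    · intro x hx
      obtain ⟨v, -, rfl⟩ := List.mem_map.1 hx
      have := Nat.size_le_size (min_le_right (KSwO.val q v) c.top)
      have := sz_nat_le (min (KSwO.val q v) c.top)
      omega
    · rw [List.length_map]
      gcongr
  · have : ((T.take c.bd.length).map fun q => c.R.map fun v => min (KSwO.val q v) c.top).length ≤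
        sz c.bd := by
      rw [List.length_map, List.length_take]
      omega
    gcongr

theorem PBd.clipBd (hc : Poly c) : PBd fun a => clipBd (c a) := by
  unfold KSwO.clipBd
  have h1 := hc.ctxBd.szBd
  have h2 := hc.ctxR.szBd
  have h3 := hc.ctxTop.size
  exact (h1.mul (((h2.mul ((((PBd.const 4).mul h3).add (.const 1)).add (.const 1))).add
    (.const 1)).add (.const 1))).add (.const 1)

@[fun_prop]
theorem Poly.joinAll (hc : Poly c) (hr : Poly r) (hY : Poly Y) (ht : Poly tabs) :
    Poly fun a => joinAll (c a) (r a) (Y a) (tabs a) := by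
  unfold KSwO.joinAll
  exact .foldl_bdd (by fun_prop) (by fun_prop) (by fun_prop) (PBd.clipBd hc)
    fun a s x _ => sz_clip_le _ _

@[fun_prop]
theorem Poly.combine (hc : Poly c) (hr : Poly r) (hpc : Poly pc) (ht : Poly tabs) :
    Poly fun a => combine (c a) (r a) (pc a) (tabs a) := by
  unfold KSwO.combine
  fun_prop

end

end Algorithm

/-! ### Polynomial running time of the dynamic program -/

/-- Fibres over distinct values are disjoint. The fibres in question are the components of a piece,
indexed by their representatives. -/
theorem sum_fibers_le {ι κ : Type} [DecidableEq κ] (f : ι → κ) (X : List ι) {K : List κ}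
    (hK : K.Nodup) : (K.map fun x => (X.filter fun y => decide (f y = x)).length).sum ≤ X.length := by
  have h1 : ∀ (K : List κ) (a : κ), K.Nodup → (K.map fun x => if a = x then 1 else 0).sum ≤ 1 := by
    intro K a hK
    induction K with
    | nil => simp
    | cons b K ih =>
      rw [List.nodup_cons] at hK
      rw [List.map_cons, List.sum_cons]
      by_cases h : a = b
      · subst h
        have : (K.map fun x => if a = x then 1 else 0).sum = 0 := by
          rw [List.sum_eq_zero_iff]
          simp only [List.mem_map]
          rintro _ ⟨x, hx, rfl⟩
          rw [if_neg]
          rintro rfl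
          exact hK.1 hx
        simp [this]
      · simpa [h] using ih hK.2
  induction X with
  | nil => simp
  | cons y X ih =>
    have h2 : (K.map fun x => ((y :: X).filter fun y => decide (f y = x)).length).sum =
        (K.map fun x => if f y = x then 1 else 0).sum +
          (K.map fun x => (X.filter fun y => decide (f y = x)).length).sum := by
      rw [← List.sum_map_add]
      congr 1
      refine List.map_congr_left fun x _ => ?_
      by_cases h : f y = x
      · simp [h]; ring
      · simp [h]
    have h3 := h1 K (f y) hK
    rw [h2, List.length_cons]
    omega

theorem mem_children {c : Ctx} {pc q : List ℕ × List ℕ} (h : q ∈ children c pc) :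
    ∃ t ∈ pc.1, pick c pc = [t] ∧ good c pc t = true ∧ q ∈ split c pc t := by
  unfold children at h
  obtain ⟨t, ht, hq⟩ := List.mem_flatMap.1 h
  have h1 := List.mem_filter.1 (List.mem_of_mem_take ht)
  refine ⟨t, h1.1, ?_, h1.2, hq⟩
  unfold pick at ht ⊢
  cases h : pc.1.filter fun t => good c pc t with
  | nil => simp [h] at ht
  | cons a l =>
    rw [h] at ht
    simp at ht
    simp [ht]

theorem sum_split_le (c : Ctx) (pc : List ℕ × List ℕ) (t : ℕ) (h : pc.1.Nodup) :
    ((split c pc t).map fun q => q.1.length).sum ≤ pc.1.length := by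
  unfold split
  rw [List.map_map]
  refine (sum_fibers_le (rep (reachMat c (without pc.1 t)) (without pc.1 t)) (without pc.1 t)
    (K := reps (reachMat c (without pc.1 t)) (without pc.1 t)) ?_).trans ?_
  · exact (h.filter _).filter _
  · exact List.length_filter_le _ _

theorem sum_children_le (c : Ctx) (pc : List ℕ × List ℕ) (h : pc.1.Nodup) :
    ((children c pc).map fun q => q.1.length).sum ≤ pc.1.length := by
  unfold children
  rcases h1 : pick c pc with _ | ⟨t, _ | ⟨t', l⟩⟩
  · simp
  · simpa using sum_split_le c pc t h
  · have : (pick c pc).length ≤ 1 := by simp [pick]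
    simp [h1] at this

theorem mem_split {c : Ctx} {pc q : List ℕ × List ℕ} {t : ℕ} (h : q ∈ split c pc t) :
    ∃ x ∈ without pc.1 t, rep (reachMat c (without pc.1 t)) (without pc.1 t) x = x ∧
      q = (comp (reachMat c (without pc.1 t)) (without pc.1 t) x,
        nbrs c (t :: pc.2) (comp (reachMat c (without pc.1 t)) (without pc.1 t) x)) := by
  obtain ⟨x, hx, rfl⟩ := List.mem_map.1 h
  obtain ⟨h1, h2⟩ := List.mem_filter.1 hx
  exact ⟨x, h1, by simpa using h2, rfl⟩

/-- Splitting never increases the total number of nodes, and below the root all pieces are nonempty;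
hence there are few of them (the `+ 1` is for a root without nodes). The argument works for
arbitrary contexts, whether or not they come from a tree, so the boundary is only bounded by the
depth here, not by 3. -/
theorem level_inv (c : Ctx) (L : List ℕ) (hL : L.Nodup) (j : ℕ) :
    (∀ pc ∈ level (children c) (L, []) j,
      pc.1.Sublist L ∧ pc.2.length ≤ j ∧ ∀ b ∈ pc.2, b ∈ L) ∧
    ((level (children c) (L, []) j).map fun pc => pc.1.length).sum ≤ L.length ∧
    (level (children c) (L, []) j).length ≤ L.length + 1 := by
  have key : (∀ pc ∈ level (children c) (L, []) j,
      pc.1.Sublist L ∧ pc.2.length ≤ j ∧ ∀ b ∈ pc.2, b ∈ L) ∧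
    ((level (children c) (L, []) j).map fun pc => pc.1.length).sum ≤ L.length ∧
    (0 < j → ∀ pc ∈ level (children c) (L, []) j, 0 < pc.1.length) := by
    induction j with
    | zero => simp [level]
    | succ j ih =>
      obtain ⟨ih1, ih2, -⟩ := ih
      rw [level]
      refine ⟨?_, ?_, ?_⟩
      · intro q hq
        obtain ⟨pc, hpc, hq⟩ := List.mem_flatMap.1 hq
        obtain ⟨h1, h2, h3⟩ := ih1 pc hpc
        obtain ⟨t, ht, -, -, hq⟩ := mem_children hq
        obtain ⟨x, hx, -, rfl⟩ := mem_split hq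
        refine ⟨?_, ?_, ?_⟩
        · exact (List.filter_sublist.trans List.filter_sublist).trans h1
        · refine (List.length_filter_le _ _).trans ?_
          simp only [List.length_cons]
          omega
        · intro b hb
          rcases List.mem_cons.1 (List.mem_filter.1 hb).1 with rfl | hb
          · exact h1.subset ht
          · exact h3 b hb
      · refine le_trans ?_ ih2
        have hn : ∀ pc ∈ level (children c) (L, []) j, pc.1.Nodup := fun pc hpc =>
          (ih1 pc hpc).1.nodup hL
        clear ih1 ih2
        generalize level (children c) (L, []) j = l at hn
        induction l with
        | nil => simp
        | cons pc l ih =>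
          have h1 := sum_children_le c pc (hn pc (by simp))
          have h2 := ih fun pc h => hn pc (by simp [h])
          simp only [List.flatMap_cons, List.map_append, List.sum_append, List.map_cons,
            List.sum_cons]
          omega
      · intro _ q hq
        obtain ⟨pc, hpc, hq⟩ := List.mem_flatMap.1 hq
        obtain ⟨t, ht, -, -, hq⟩ := mem_children hq
        obtain ⟨x, hx, hr, rfl⟩ := mem_split hq
        refine List.length_pos_of_mem (a := x) ?_
        simp [comp, hx, hr]
  obtain ⟨h1, h2, h3⟩ := key
  refine ⟨h1, h2, ?_⟩
  rcases Nat.eq_zero_or_pos j with rfl | hj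
  · simp [level]
  · have h4 := h3 hj
    have : (level (children c) (L, []) j).length ≤
        ((level (children c) (L, []) j).map fun pc => pc.1.length).sum := by
      clear h1 h2 h3
      generalize level (children c) (L, []) j = l at h4
      induction l with
      | nil => simp
      | cons pc l ih =>
        have h1 := h4 pc (by simp)
        have h2 := ih fun pc h => h4 pc (by simp [h])
        simp only [List.map_cons, List.sum_cons, List.length_cons]
        omega
    omega

section

variable {α β γ σ : Type} [Enc α] [Enc β] [Enc γ] [Enc σ]
  {c : α → Ctx} {q : α → List ℕ} {r k p : α → ℕ}

@[fun_prop]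
theorem Poly.table (hc : Poly c) (hr : Poly r) : Poly fun a => table (c a) (r a) := by
  have hroot : Poly fun a => ((List.range (c a).Q.length, []) : List ℕ × List ℕ) := by fun_prop
  have hs := hroot.szBd
  have hf := hc.ctxFuel.szBd
  refine .treeRec (ch := fun a => KSwO.children (c a)) (comb := fun a => KSwO.combine (c a) (r a))
    (fuel := fun a => (c a).fuel) (B := fun a =>
      (sz (List.range (c a).Q.length, ([] : List ℕ)) + 1) *
        ((sz (List.range (c a).Q.length, ([] : List ℕ)) +
          (sz (c a).fuel * (sz (List.range (c a).Q.length, ([] : List ℕ)) + 1) + 1) + 1) + 1) + 1)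
    (by fun_prop) (by fun_prop) hroot (by fun_prop) ?_ (PBd.clipBd hc) ?_ ?_
  · exact (((hs.add (.const 1)).mul (((hs.add ((hf.mul (hs.add (.const 1))).add (.const 1))).add
      (.const 1)).add (.const 1))).add (.const 1))
  · intro a j hj
    obtain ⟨h1, h2, h3⟩ := level_inv (c a) (List.range (c a).Q.length) List.nodup_range j
    have h4 := length_lt_sz (List.range (c a).Q.length)
    refine (sz_list_le (B := (sz (List.range (c a).Q.length, ([] : List ℕ)) +
      (sz (c a).fuel * (sz (List.range (c a).Q.length, ([] : List ℕ)) + 1) + 1) + 1)) ?_).trans ?_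
    · rintro ⟨C, B⟩ hpc
      obtain ⟨h5, h6, h7⟩ := h1 _ hpc
      have h8 := sz_sublist h5
      have h9 := sz_list_le (l := B) (B := sz (List.range (c a).Q.length)) fun b hb =>
        (sz_mem_lt (h7 b hb)).le
      have h10 := length_lt_sz (c a).fuel
      have h11 : B.length * (sz (List.range (c a).Q.length) + 1) ≤
          sz (c a).fuel * (sz (List.range (c a).Q.length, ([] : List ℕ)) + 1) := by
        gcongr
        · exact h6.trans (hj.trans h10.le)
        · simp only [sz_pair]; omega
      simp only [sz_pair] at *
      omega
    · gcongr
      simp only [sz_pair]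
      omega
  · intro a x l
    exact sz_clip_le _ _

@[fun_prop]
theorem Poly.radii (hc : Poly c) : Poly fun a => radii (c a) := by
  unfold KSwO.radii
  fun_prop

@[fun_prop]
theorem Poly.results (hc : Poly c) (hk : Poly k) (hp : Poly p) :
    Poly fun a => results (c a) (k a) (p a) := by
  unfold KSwO.results
  fun_prop

@[fun_prop]
theorem Poly.best (hc : Poly c) (hk : Poly k) (hp : Poly p) :
    Poly fun a => best (c a) (k a) (p a) := by
  unfold KSwO.best
  fun_prop

@[fun_prop]
theorem Poly.output (hc : Poly c) (hq : Poly q) : Poly fun a => output (c a) (q a) := by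
  unfold KSwO.output
  fun_prop

end

/-! ### From the input to the context of the dynamic program -/

/-- An entry of the adjacency matrix: the numerator and the denominator of the length of an edge,
or nothing. -/
inductive Entry : Type
  | none : Entry
  | len : ℕ → ℕ → Entry

/-- Is there an edge? -/
def Entry.isEdge : Entry → Bool
  | .none => false
  | .len _ _ => true

/-- Numerator and denominator of the length of an edge. -/
def Entry.toPair : Entry → ℕ × ℕ
  | .none => (0, 1)
  | .len a b => (a, b)

instance : Enc Entry where
  enc
    | .none => .nil
    | .len a b => .cons (enc a) (enc b)
  sz
    | .none => 1
    | .len a b => sz a + sz b + 1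
  size_le e := by
    cases e with
    | none => exact le_rfl
    | len a b => exact Enc.size_le (a, b)

/-- The decoded input: the instance, the tree decomposition and the precision. -/
abbrev Raw : Type :=
  (List (List Entry) × List Bool × List Bool × ℕ × ℕ × Unit) ×
    (List (List Bool) × List (List Bool)) × (ℕ × ℕ) × Unit

/-- The vertices. -/
def rawR (w : Raw) : List ℕ := List.range w.1.1.length

/-- The nodes of the tree. -/
def rawQ (w : Raw) : List ℕ := List.range w.2.1.1.length

/-- The entries of the adjacency matrix. -/
def ent (w : Raw) (u v : ℕ) : Entry := get2 w.1.1 u v Entry.none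

/-- All pairs of vertices. -/
def pairs (w : Raw) : List (ℕ × ℕ) := (rawR w).flatMap fun u => (rawR w).map fun v => (u, v)

/-- The length of an edge times the product of all denominators. -/
def scaledLen (w : Raw) (u v : ℕ) : ℕ :=
  (ent w u v).toPair.1 * (((pairs w).filter fun p => !decide (p = (u, v))).map
    fun p => (ent w p.1 p.2).toPair.2).prod

/-- The scaled distances. -/
def scaledDist (w : Raw) : List (List ℕ∞) :=
  fw (rawR w) (tab2 (rawR w) fun u v => bif decide (u = v) then 0 else
    bif (ent w u v).isEdge then (scaledLen w u v : ℕ∞) else ⊤)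

/-- The size of the largest bag, in unary. -/
def maxBag (w : Raw) : List Bool :=
  w.2.1.2.foldl (fun s row => bif decide ((row.filter fun b => b).length ≤ s.length) then s
    else row.filter fun b => b) []

/-- One doubling step in the search for a power of two that is at least `1 / ε`. -/
def doubleStep (b : ℕ) (s : List Unit × ℕ) : List Unit × ℕ :=
  bif decide (b ≤ s.2) then s else (s.1 ++ s.1, s.2 + s.2)

/-- A number that is at least `1 / ε`, in unary; `1` if the treewidth is zero. -/
def invEps (w : Raw) : List Unit :=
  ((bif decide ((maxBag w).length ≤ 1) then [] else w.2.2.1.2.bits).foldl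
    (fun s _ => doubleStep w.2.2.1.2 s) ([()], w.2.2.1.1)).1

/-- The bound for the depth of the recursion, in unary. -/
def fuelL (w : Raw) : List Bool := w.2.1.1.length.bits ++ w.2.1.1.length.bits

/-- The bound for the number of hops, in unary. -/
def hopsL (w : Raw) : List Unit :=
  ((fuelL w ++ fuelL w) ++ [true, true, true]).map fun _ => ()

/-- The number of grid points below the guessed radius, in unary. -/
def gridL (w : Raw) (K : List Unit) : List Unit := K.flatMap fun _ => hopsL w

/-- The largest code of a label, in unary. -/
def topL (w : Raw) (K : List Unit) : List Unit := (gridL w K ++ hopsL w) ++ [(), ()]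

/-- The number of codes of labels times the number of truth values, in unary. -/
def alphabetL (w : Raw) (K : List Unit) : List Unit := (() :: topL w K) ++ (() :: topL w K)

/-- Powers in unary. -/
def powL {δ : Type} (A : List Unit) (l : List δ) : List Unit :=
  l.foldl (fun acc _ => acc.flatMap fun _ => A) [()]

theorem length_powL {δ : Type} (A : List Unit) (l : List δ) :
    (powL A l).length = A.length ^ l.length := by
  unfold powL
  induction l using List.reverseRecOn with
  | nil => simp
  | append_singleton l x ih =>
    rw [List.foldl_append, List.foldl_cons, List.foldl_nil, List.length_flatMap]
    simp [ih, pow_succ]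

/-- Four times the size of the largest bag, in unary. -/
def maxBags (w : Raw) : List Bool := (maxBag w ++ maxBag w) ++ (maxBag w ++ maxBag w)

/-- The bound for the size of tables, in unary. -/
def boundL (w : Raw) (K : List Unit) : List Unit :=
  (0 :: rawR w).flatMap fun _ => (0 :: rawR w).flatMap fun _ => powL (alphabetL w K) (maxBags w)

theorem length_boundL (w : Raw) (K : List Unit) : (boundL w K).length =
    ((rawR w).length + 1) * (((rawR w).length + 1) *
      (2 * ((topL w K).length + 1)) ^ (4 * (maxBag w).length)) := by
  unfold boundL
  have h1 : (alphabetL w K).length = 2 * ((topL w K).length + 1) := by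
    simp [alphabetL]; ring
  have h2 : (maxBags w).length = 4 * (maxBag w).length := by
    simp [maxBags]; ring
  rw [List.length_flatMap]
  simp only [List.length_flatMap, length_powL, h1, h2]
  simp
  ring

/-- The context of the dynamic program. -/
def ctxOf (w : Raw) (K B : List Unit) : Ctx where
  R := rawR w
  Q := rawQ w
  adj := w.2.1.1
  bag := w.2.1.2
  dist := scaledDist w
  sup := w.1.2.1
  cli := w.1.2.2.1
  codes := (List.range (() :: topL w K).length).filter fun l => !decide (l = 0)
  top := (topL w K).length
  H := (gridL w K).length
  bd := B
  fuel := fuelL w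

/-- The context of the dynamic program for an input. -/
def inputCtx (w : Raw) : Ctx := ctxOf w (invEps w) (boundL w (invEps w))

/-- The algorithm. -/
def solve (w : Raw) : List Bool × List Bool :=
  output (inputCtx w) (best (inputCtx w) w.1.2.2.2.1 w.1.2.2.2.2.1)

/-- Inputs, with a size measure that includes the bound for the size of tables. -/
structure Padded : Type where
  /-- the input -/
  raw : Raw

instance : Enc Padded where
  enc x := enc x.raw
  sz x := sz x.raw + (invEps x.raw).length + (boundL x.raw (invEps x.raw)).length
  size_le x := by
    have := Enc.size_le x.raw
    omega

/-! ### Polynomial time of the context and of the whole algorithm -/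

section

variable {α β γ σ : Type} [Enc α] [Enc β] [Enc γ] [Enc σ]
  {w : α → Raw} {u v : α → ℕ} {K B : α → List Unit}

@[fun_prop]
theorem Poly.isEdge {e : α → Entry} (he : Poly e) : Poly fun a => (e a).isEdge := by
  have : Poly fun e : Entry => e.isEdge := by
    refine .intro (.ite .skip (.cons .nil .nil) .nil) _ (.const 10) fun e => ?_
    cases e with
    | none => exact ⟨by simp [Entry.isEdge, sz, encBool, Val.size], 1 + 1 + 1, by omega,
        .ite_false (.skip _) (.nil _)⟩
    | len a b => exact ⟨by simp [Entry.isEdge, sz, encBool, Val.size], 1 + (1 + 1 + 1) + 1,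
        by omega, .ite_true (.skip _) (.cons (.nil _) (.nil _))⟩
  exact this.comp he

@[fun_prop]
theorem Poly.toPair {e : α → Entry} (he : Poly e) : Poly fun a => (e a).toPair := by
  have : Poly fun e : Entry => e.toPair := by
    refine .intro (.ite .skip .skip (constProg (enc ((0, 1) : ℕ × ℕ)))) _
      ((PBd.szBd.add (.const (sz ((0, 1) : ℕ × ℕ)))).add (.const 10)) fun e => ?_
    cases e with
    | none =>
      refine ⟨?_, 1 + _ + 1, ?_, .ite_false (.skip _) (constProg_run _ _)⟩
      · simp only [Entry.toPair]
        omega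
      · have := Enc.size_le ((0, 1) : ℕ × ℕ)
        omega
    | len a b =>
      refine ⟨?_, 1 + 1 + 1, ?_, .ite_true (.skip _) (.skip _)⟩
      · have : sz (Entry.len a b) = sz a + sz b + 1 := rfl
        simp only [Entry.toPair, sz_pair]
        omega
      · omega
  exact this.comp he

@[fun_prop]
theorem Poly.rawR (hw : Poly w) : Poly fun a => rawR (w a) := by
  unfold KSwO.rawR
  fun_prop

@[fun_prop]
theorem Poly.rawQ (hw : Poly w) : Poly fun a => rawQ (w a) := by
  unfold KSwO.rawQ
  fun_prop

@[fun_prop]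
theorem Poly.ent (hw : Poly w) (hu : Poly u) (hv : Poly v) :
    Poly fun a => ent (w a) (u a) (v a) := by
  unfold KSwO.ent
  fun_prop

@[fun_prop]
theorem Poly.pairs (hw : Poly w) : Poly fun a => pairs (w a) := by
  unfold KSwO.pairs
  fun_prop

@[fun_prop]
theorem Poly.scaledLen (hw : Poly w) (hu : Poly u) (hv : Poly v) :
    Poly fun a => scaledLen (w a) (u a) (v a) := by
  unfold KSwO.scaledLen
  fun_prop

@[fun_prop]
theorem Poly.scaledDist (hw : Poly w) : Poly fun a => scaledDist (w a) := by
  unfold KSwO.scaledDist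
  fun_prop

@[fun_prop]
theorem Poly.maxBag (hw : Poly w) : Poly fun a => maxBag (w a) := by
  unfold KSwO.maxBag
  refine .foldl_add (g := fun _ (s row : List Bool) =>
      bif decide ((row.filter fun b => b).length ≤ s.length) then s else row.filter fun b => b)
    (by fun_prop) (by fun_prop) (by fun_prop) (D := fun a => sz (w a).2.1.2)
    hw.snd.fst.snd.szBd fun a s x hx => ?_
  have h1 := sz_mem_lt hx
  have h2 : sz (x.filter fun b => b) ≤ sz x := sz_sublist List.filter_sublist
  cases decide ((x.filter fun b => b).length ≤ s.length) <;>
    simp only [cond_true, cond_false] <;> omega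

@[fun_prop]
theorem Poly.fuelL (hw : Poly w) : Poly fun a => fuelL (w a) := by
  unfold KSwO.fuelL
  fun_prop

@[fun_prop]
theorem Poly.hopsL (hw : Poly w) : Poly fun a => hopsL (w a) := by
  unfold KSwO.hopsL
  fun_prop

@[fun_prop]
theorem Poly.gridL (hw : Poly w) (hK : Poly K) : Poly fun a => gridL (w a) (K a) := by
  unfold KSwO.gridL
  fun_prop

@[fun_prop]
theorem Poly.topL (hw : Poly w) (hK : Poly K) : Poly fun a => topL (w a) (K a) := by
  unfold KSwO.topL
  fun_prop

@[fun_prop]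
theorem Poly.alphabetL (hw : Poly w) (hK : Poly K) : Poly fun a => alphabetL (w a) (K a) := by
  unfold KSwO.alphabetL
  fun_prop

@[fun_prop]
theorem Poly.maxBags (hw : Poly w) : Poly fun a => maxBags (w a) := by
  unfold KSwO.maxBags
  fun_prop

theorem Poly.ofTuple {f : α → Ctx} (hf : Poly fun a => (f a).toTuple) : Poly f :=
  .of_enc hf (fun _ => rfl) hf.szBd

@[fun_prop]
theorem Poly.ctxOf (hw : Poly w) (hK : Poly K) (hB : Poly B) :
    Poly fun a => ctxOf (w a) (K a) (B a) := by
  refine .ofTuple ?_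
  unfold KSwO.ctxOf Ctx.toTuple
  fun_prop

@[fun_prop]
theorem Poly.raw {f : α → Padded} (hf : Poly f) : Poly fun a => (f a).raw :=
  .of_enc hf (fun _ => rfl) (hf.szBd.mono fun a => by
    have : sz (f a) = sz (f a).raw + (invEps (f a).raw).length +
      (boundL (f a).raw (invEps (f a).raw)).length := rfl
    omega)

/-- The unary list only grows, so during the search it never exceeds the final `invEps`, which is
part of the padded size. -/
theorem doubleStep_mono {δ : Type} (b : ℕ) (s : List Unit × ℕ) (l l' : List δ) :
    (l.foldl (fun s _ => doubleStep b s) s).1.length ≤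
      ((l ++ l').foldl (fun s _ => doubleStep b s) s).1.length := by
  induction l' using List.reverseRecOn with
  | nil => simp
  | append_singleton l' x ih =>
    refine ih.trans ?_
    rw [← List.append_assoc, List.foldl_append (l := l ++ l'), List.foldl_cons, List.foldl_nil]
    generalize (l ++ l').foldl (fun s _ => doubleStep b s) s = s
    unfold doubleStep
    cases decide (b ≤ s.2) <;> simp

theorem size_doubleStep {δ : Type} (b : ℕ) (s : List Unit × ℕ) (l : List δ) :
    (l.foldl (fun s _ => doubleStep b s) s).2.size ≤ s.2.size + l.length := by
  induction l using List.reverseRecOn with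
  | nil => simp
  | append_singleton l x ih =>
    rw [List.foldl_append]
    rw [List.foldl_cons, List.foldl_nil, List.length_append, List.length_singleton]
    generalize l.foldl (fun s _ => doubleStep b s) s = s' at *
    have := size_add_le s'.2 s'.2
    unfold doubleStep
    cases decide (b ≤ s'.2)
    · simp only [cond_false]
      omega
    · simp only [cond_true]
      omega

theorem sz_unit_list (l : List Unit) : sz l = 2 * l.length + 1 := by
  induction l with
  | nil => simp
  | cons a l ih => simp only [sz_cons, sz_unit, List.length_cons, ih]; ring

theorem Poly.invEps' : Poly fun x : Padded => invEps x.raw := by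
  have hw : Poly fun x : Padded => x.raw := by fun_prop
  unfold KSwO.invEps
  refine .fst (.foldl (l := fun x : Padded => bif decide ((KSwO.maxBag x.raw).length ≤ 1) then []
      else x.raw.2.2.1.2.bits) (i := fun x => ([()], x.raw.2.2.1.1))
    (g := fun x s _ => doubleStep x.raw.2.2.1.2 s) (by fun_prop) (by fun_prop)
    (by unfold doubleStep; fun_prop)
    (B := fun x => 2 * sz x + 1 + (4 * (x.raw.2.2.1.1.size + sz x.raw.2.2.1.2.bits) + 1) + 1)
    ?_ ?_)
  · have h1 : Poly fun x : Padded => x.raw.2.2.1.1 := by fun_prop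
    have h2 : Poly fun x : Padded => x.raw.2.2.1.2.bits := by fun_prop
    exact ((((PBd.const 2).mul PBd.szBd).add (.const 1)).add (((PBd.const 4).mul
      (h1.size.add h2.szBd)).add (.const 1))).add (.const 1)
  · intro x l₁ l₂ h
    have h1 := doubleStep_mono x.raw.2.2.1.2 ([()], x.raw.2.2.1.1) l₁ l₂
    rw [← h] at h1
    change _ ≤ (KSwO.invEps x.raw).length at h1
    have h2 := size_doubleStep x.raw.2.2.1.2 ([()], x.raw.2.2.1.1) l₁
    have h3 : l₁.length ≤ sz x.raw.2.2.1.2.bits := by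
      have h4 : (bif decide ((KSwO.maxBag x.raw).length ≤ 1) then []
        else x.raw.2.2.1.2.bits).length ≤ x.raw.2.2.1.2.bits.length := by
        cases decide ((KSwO.maxBag x.raw).length ≤ 1) <;> simp
      have h5 := length_lt_sz x.raw.2.2.1.2.bits
      rw [h, List.length_append] at h4
      omega
    have h4 : sz x = sz x.raw + (KSwO.invEps x.raw).length +
      (boundL x.raw (KSwO.invEps x.raw)).length := rfl
    generalize l₁.foldl (fun s _ => doubleStep x.raw.2.2.1.2 s) ([()], x.raw.2.2.1.1) = s at *
    obtain ⟨s, t⟩ := s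
    have h5 := sz_nat_le t
    rw [sz_pair, sz_unit_list]
    simp only at h1 h2
    omega

@[fun_prop]
theorem Poly.invEps {f : α → Padded} (hf : Poly f) : Poly fun a => invEps (f a).raw :=
  Poly.invEps'.comp hf

/-- Exponentially long in the plain input, but all partial powers are at most the final bound, which
is counted in the padded size. -/
theorem Poly.boundL' : Poly fun x : Padded => boundL x.raw (KSwO.invEps x.raw) := by
  have h1 : Poly fun x : Padded => powL (KSwO.alphabetL x.raw (KSwO.invEps x.raw))
      (KSwO.maxBags x.raw) := by
    unfold powL
    refine .foldl (l := fun x : Padded => KSwO.maxBags x.raw)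
      (g := fun x acc _ => acc.flatMap fun _ => KSwO.alphabetL x.raw (KSwO.invEps x.raw))
      (i := fun _ => [()]) (by fun_prop) (by fun_prop) (by fun_prop) (B := fun x => 2 * sz x + 1)
      (((PBd.const 2).mul PBd.szBd).add (.const 1)) fun x l₁ l₂ h => ?_
    rw [sz_unit_list]
    change 2 * (powL (KSwO.alphabetL x.raw (KSwO.invEps x.raw)) l₁).length + 1 ≤ _
    have h4 : sz x = sz x.raw + (KSwO.invEps x.raw).length +
      (boundL x.raw (KSwO.invEps x.raw)).length := rfl
    have h5 : (powL (KSwO.alphabetL x.raw (KSwO.invEps x.raw)) l₁).length ≤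
        (powL (KSwO.alphabetL x.raw (KSwO.invEps x.raw)) (KSwO.maxBags x.raw)).length := by
      rw [length_powL, length_powL, h, List.length_append]
      refine Nat.pow_le_pow_right ?_ (by omega)
      simp [KSwO.alphabetL]
    have h6 : (powL (KSwO.alphabetL x.raw (KSwO.invEps x.raw)) (KSwO.maxBags x.raw)).length ≤
        (boundL x.raw (KSwO.invEps x.raw)).length := by
      unfold boundL
      simp only [List.flatMap_cons, List.length_append]
      omega
    omega
  unfold KSwO.boundL
  exact .flatMap (by fun_prop) (.flatMap (by fun_prop)
    (h1.comp (g := fun p : (Padded × ℕ) × ℕ => p.1.1) (by fun_prop)))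

@[fun_prop]
theorem Poly.boundL {f : α → Padded} (hf : Poly f) :
    Poly fun a => boundL (f a).raw (KSwO.invEps (f a).raw) :=
  Poly.boundL'.comp hf

/-- Polynomial in the padded size; the exponential dependence on the width is hidden in the padding.
-/
theorem Poly.solve : Poly fun x : Padded => solve x.raw := by
  unfold KSwO.solve KSwO.inputCtx
  fun_prop

end

/-! ### Correctness of the Floyd–Warshall algorithm -/

/-- Optimality is expressed without paths: entries are at most the initial ones and satisfy the
triangle inequality through all processed vertices. Attainment is expressed by an arbitrary relation
`Q` that is closed under concatenation, so that the lemma serves both reachability in the tree and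
walks in the graph. -/
theorem fw_inv {n : ℕ} (f : ℕ → ℕ → ℕ∞) {Q : ℕ → ℕ → ℕ → Prop}
    (h0 : ∀ u v, u < n → v < n → ∀ l : ℕ, f u v = l → Q u v l)
    (ht : ∀ u x v (a b : ℕ), Q u x a → Q x v b → Q u v (a + b)) (j : ℕ) (hj : j ≤ n) :
    ∀ D : ℕ → ℕ → ℕ∞, D = (fun u v => get2 ((List.range j).foldl (fwStep (List.range n))
      (tab2 (List.range n) f)) u v ⊤) →
    (∀ u v, ¬(u < n ∧ v < n) → D u v = ⊤) ∧ (∀ u v, u < n → v < n → D u v ≤ f u v) ∧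
    (∀ x u v, x < j → D u v ≤ D u x + D x v) ∧ (∀ u v (l : ℕ), D u v = l → Q u v l) := by
  induction j with
  | zero =>
    rintro _ rfl
    simp only [List.range_zero, List.foldl_nil, get2_tab2]
    refine ⟨fun u v h => if_neg h, fun u v hu hv => by rw [if_pos ⟨hu, hv⟩], by omega, ?_⟩
    intro u v l h
    split_ifs at h with huv
    · exact h0 u v huv.1 huv.2 l h
    · exact absurd h (by simp)
  | succ j ih =>
    rintro _ rfl
    have ih := ih (by omega) _ rfl
    simp only [List.range_succ, List.foldl_append, List.foldl_cons, List.foldl_nil]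
    generalize (List.range j).foldl (fwStep (List.range n)) (tab2 (List.range n) f) = M at ih
    rw [fwStep]
    simp only [get2_tab2]
    obtain ⟨D, hD⟩ : ∃ D : ℕ → ℕ → ℕ∞, ∀ u v, get2 M u v ⊤ = D u v := ⟨_, fun _ _ => rfl⟩
    simp only [hD] at ih ⊢
    obtain ⟨i1, i2, i3, i4⟩ := ih
    refine ⟨fun u v h => if_neg h, fun u v hu hv => ?_, fun x u v hx => ?_, fun u v l h => ?_⟩
    · rw [if_pos ⟨hu, hv⟩]
      exact (min_le_left _ _).trans (i2 u v hu hv)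
    · by_cases hu : u < n
      swap
      · simp [hu]
      by_cases hv : v < n
      swap
      · simp [hv]
      have hx' : x < n := by omega
      simp only [hu, hv, hx', and_self, if_true]
      rcases Nat.lt_succ_iff_lt_or_eq.1 hx with hx | rfl
      · rcases min_choice (D u x) (D u j + D j x) with h1 | h1 <;>
          rcases min_choice (D x v) (D x j + D j v) with h2 | h2 <;> rw [h1, h2]
        · exact (min_le_left _ _).trans (i3 x u v hx)
        · refine (min_le_right _ _).trans ?_
          rw [← add_assoc]
          exact add_le_add (i3 x u j hx) le_rfl
        · refine (min_le_right _ _).trans ?_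
          rw [add_assoc]
          exact add_le_add le_rfl (i3 x j v hx)
        · refine (min_le_right _ _).trans ?_
          rw [add_assoc, ← add_assoc (D j x)]
          exact add_le_add le_rfl (le_add_of_nonneg_left (by simp))
      -- The round through `x` does not lower the entries in the row and the column of `x`.
      · have h1 : D u x ≤ min (D u x) (D u x + D x x) := le_min le_rfl le_self_add
        have h2 : D x v ≤ min (D x v) (D x x + D x v) := le_min le_rfl le_add_self
        exact (min_le_right _ _).trans (add_le_add h1 h2)
    · split_ifs at h with huv
      swap
      · exact absurd h (by simp)
      rcases min_choice (D u v) (D u j + D j v) with h1 | h1 <;> rw [h1] at h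
      · exact i4 u v l h
      · cases ha : D u j with
        | top => simp [ha] at h
        | coe a =>
          cases hb : D j v with
          | top => simp [hb] at h
          | coe b =>
            rw [ha, hb] at h
            have : a + b = l := by exact_mod_cast h
            rw [← this]
            exact ht u j v a b (i4 _ _ _ ha) (i4 _ _ _ hb)

theorem fw_spec {n : ℕ} (f : ℕ → ℕ → ℕ∞) {Q : ℕ → ℕ → ℕ → Prop}
    (h0 : ∀ u v, u < n → v < n → ∀ l : ℕ, f u v = l → Q u v l)
    (ht : ∀ u x v (a b : ℕ), Q u x a → Q x v b → Q u v (a + b)) {D : ℕ → ℕ → ℕ∞}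
    (hD : D = fun u v => get2 (fw (List.range n) (tab2 (List.range n) f)) u v ⊤) :
    (∀ u v, ¬(u < n ∧ v < n) → D u v = ⊤) ∧ (∀ u v, u < n → v < n → D u v ≤ f u v) ∧
    (∀ x u v, x < n → D u v ≤ D u x + D x v) ∧ (∀ u v (l : ℕ), D u v = l → Q u v l) :=
  fw_inv f h0 ht n le_rfl D hD

/-! ### Connectedness in the tree -/

/-- Connection by a path inside a set of nodes. -/
def Conn (c : Ctx) (X : ℕ → Prop) : ℕ → ℕ → Prop :=
  Relation.ReflTransGen fun a b => X a ∧ X b ∧ adjT c a b = true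

/-- The tree decomposition of a context is valid. -/
structure TreeOK (c : Ctx) (m : ℕ) : Prop where
  Q_eq : c.Q = List.range m
  symm : ∀ s t, adjT c s t = true → adjT c t s = true
  bridge : ∀ s t, adjT c s t = true → ¬ Relation.ReflTransGen
    (fun a b => adjT c a b = true ∧ ¬(a = s ∧ b = t) ∧ ¬(a = t ∧ b = s)) s t
  conn : ∀ s t, s < m → t < m → Conn c (fun x => x < m) s t
  adj_lt : ∀ s t, adjT c s t = true → s < m
  bag_lt : ∀ t v, inBag c t v = true → t < m
  bag_conn : ∀ v s t, inBag c s v = true → inBag c t v = true →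
    Conn c (fun x => inBag c x v = true) s t

section Tree

variable {c : Ctx} {m : ℕ} {X Y : ℕ → Prop} {a b s t x : ℕ}

theorem Conn.symm (hc : TreeOK c m) (h : Conn c X a b) : Conn c X b a :=
  Relation.ReflTransGen.swap _ _ (Relation.ReflTransGen.mono
    (fun _ _ h => ⟨h.2.1, h.1, hc.symm _ _ h.2.2⟩) _ _ h)

theorem Conn.mono (h : Conn c X a b) (hXY : ∀ x, X x → Y x) : Conn c Y a b :=
  Relation.ReflTransGen.mono (fun _ _ h => ⟨hXY _ h.1, hXY _ h.2.1, h.2.2⟩) _ _ h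

theorem Conn.mem (h : Conn c X a b) (ha : X a) : X b := by
  induction h with
  | refl => exact ha
  | tail _ h _ => exact h.2.1

/-- Start the path at its last visit to `t`. -/
theorem Conn.exists_adj (h : Conn c X t x) (hxt : x ≠ t) :
    ∃ s, X s ∧ s ≠ t ∧ adjT c t s = true ∧ Conn c (fun y => X y ∧ y ≠ t) s x := by
  have key : ∀ a, Conn c X a x → (a ≠ t ∧ Conn c (fun y => X y ∧ y ≠ t) a x) ∨
      ∃ s, X s ∧ s ≠ t ∧ adjT c t s = true ∧ Conn c (fun y => X y ∧ y ≠ t) s x := by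
    intro a ha
    induction ha using Relation.ReflTransGen.head_induction_on with
    | refl => exact Or.inl ⟨hxt, .refl⟩
    | @head a b hab _ ih =>
      rcases ih with ⟨h1, h2⟩ | h
      · by_cases hat : a = t
        · subst hat
          exact Or.inr ⟨b, hab.2.1, h1, hab.2.2, h2⟩
        · exact Or.inl ⟨hat, .head ⟨⟨hab.1, hat⟩, ⟨hab.2.1, h1⟩, hab.2.2⟩ h2⟩
      · exact Or.inr h
  rcases key t h with h | h
  · exact absurd rfl h.1
  · exact h

/-- If the path visited `t`, then its remainder would connect `t` to `b`. -/
theorem Conn.avoid (h : Conn c X a b) (ht : ¬ Conn c X t b) :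
    Conn c (fun y => X y ∧ y ≠ t) a b := by
  induction h using Relation.ReflTransGen.head_induction_on with
  | refl => exact .refl
  | head hab hbc ih =>
    refine .head ⟨⟨hab.1, ?_⟩, ⟨hab.2.1, ?_⟩, hab.2.2⟩ ih
    · rintro rfl
      exact ht (.head hab hbc)
    · rintro rfl
      exact ht hbc

/-- Two paths that avoid one end each cannot bypass an edge. -/
theorem TreeOK.not_bypass (hc : TreeOK c m) (hst : adjT c s t = true)
    (h1 : Conn c (fun y => X y ∧ y ≠ t) s x) (h2 : Conn c (fun y => X y ∧ y ≠ s) x t) : False := by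
  refine hc.bridge s t hst (.trans (b := x) ?_ ?_)
  · refine Relation.ReflTransGen.mono ?_ _ _ h1
    rintro a b ⟨ha, hb, h⟩
    exact ⟨h, fun h => hb.2 h.2, fun h => ha.2 h.1⟩
  · refine Relation.ReflTransGen.mono ?_ _ _ h2
    rintro a b ⟨ha, hb, h⟩
    exact ⟨h, fun h => ha.2 h.1, fun h => hb.2 h.2⟩

open Classical in
/-- Every connected set of nodes of a tree has a weighted centroid. -/
theorem TreeOK.exists_centroid (hc : TreeOK c m) (C : Finset ℕ) (hC : C.Nonempty)
    (hconn : ∀ x ∈ C, ∀ y ∈ C, Conn c (fun y => y ∈ C) x y) (w : ℕ → ℕ) :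
    ∃ t ∈ C, ∀ x ∈ C, x ≠ t →
      2 * ∑ y ∈ C with Conn c (fun y => y ∈ C ∧ y ≠ t) x y, w y ≤ ∑ y ∈ C, w y := by
  by_contra! hcon
  -- `K (t, x)` is the component of `x` after removing `t`. If every node leaves a component of more
  -- than half the weight, choose a pair for which such a heavy component has the fewest nodes. The
  -- neighbour `s` of `t` in it leaves a heavy component too, which will be strictly smaller.
  let K : ℕ × ℕ → Finset ℕ := fun p => C.filter fun y => Conn c (fun y => y ∈ C ∧ y ≠ p.1) p.2 y
  let P : Finset (ℕ × ℕ) := (C ×ˢ C).filter fun p =>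
    p.2 ≠ p.1 ∧ ∑ y ∈ C, w y < 2 * ∑ y ∈ K p, w y
  have hP : P.Nonempty := by
    obtain ⟨t, ht⟩ := hC
    obtain ⟨x, hx, hxt, h⟩ := hcon t ht
    exact ⟨(t, x), by simp [P, K, ht, hx, hxt, h]⟩
  obtain ⟨⟨t, x⟩, htx, hmin⟩ := P.exists_min_image (fun p => (K p).card) hP
  simp only [P, Finset.mem_filter, Finset.mem_product] at htx
  obtain ⟨⟨ht, hx⟩, hxt, hheavy⟩ := htx
  obtain ⟨s, hs, hst, hadj, hsx⟩ := (hconn t ht x hx).exists_adj hxt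
  obtain ⟨x', hx', hxs', hheavy'⟩ := hcon s hs
  change _ < 2 * ∑ y ∈ K (s, x'), w y at hheavy'
  -- If the heavy component at `s` contained `t`, it would lie on the other side of the edge between
  -- `s` and `t`. Two disjoint components of more than half the weight cannot exist.
  have htK : t ∉ K (s, x') := by
    intro htK
    have hdisj : Disjoint (K (t, x)) (K (s, x')) := by
      rw [Finset.disjoint_left]
      intro z hz hz'
      have h1 := (Finset.mem_filter.1 hz).2
      have h2 := (Finset.mem_filter.1 hz').2
      have h3 := (Finset.mem_filter.1 htK).2
      exact hc.not_bypass (hc.symm _ _ hadj) (hsx.trans h1) ((h2.symm hc).trans h3)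
    have h1 : ∑ y ∈ K (t, x), w y + ∑ y ∈ K (s, x'), w y ≤ ∑ y ∈ C, w y := by
      rw [← Finset.sum_union hdisj]
      exact Finset.sum_le_sum_of_subset
        (Finset.union_subset (Finset.filter_subset _ _) (Finset.filter_subset _ _))
    omega
  -- Without `t`, the component at `s` stays on the side of `s`, and it lacks `s` itself.
  have hsub : K (s, x') ⊂ K (t, x) := by
    rw [Finset.ssubset_iff_of_subset]
    · refine ⟨s, Finset.mem_filter.2 ⟨hs, hsx.symm hc⟩, fun h => ?_⟩
      exact (Conn.mem (Finset.mem_filter.1 h).2 ⟨hx', hxs'⟩).2 rfl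
    · intro y hy
      obtain ⟨hyC, hy⟩ := Finset.mem_filter.1 hy
      have hys := (Conn.mem hy ⟨hx', hxs'⟩).2
      refine Finset.mem_filter.2 ⟨hyC, (hsx.symm hc).trans ?_⟩
      obtain ⟨s', hs', hss', hadj', h⟩ := (hconn s hs y hyC).exists_adj hys
      have hty : ∀ z, Conn c (fun y => y ∈ C ∧ y ≠ s) z y → z ≠ t := by
        rintro z hz rfl
        exact htK (Finset.mem_filter.2 ⟨ht, hy.trans (hz.symm hc)⟩)
      have h' := (h.avoid (t := t) fun h => hty t h rfl).mono (Y := fun y => y ∈ C ∧ y ≠ t)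
        fun z hz => ⟨hz.1.1, hz.2⟩
      exact .head ⟨⟨hs, hst⟩, ⟨hs', hty s' h⟩, hadj'⟩ h'
  have h1 := Finset.card_lt_card hsub
  have h2 := hmin (s, x') (by
    simp only [P, Finset.mem_filter, Finset.mem_product]
    exact ⟨⟨hs, hx'⟩, hxs', hheavy'⟩)
  omega

/-- All finite weights are zero, so distance zero means connection inside `L`. -/
theorem reachMat_le_iff (hc : TreeOK c m) {L : List ℕ} (hL : ∀ x ∈ L, x < m) {u v : ℕ}
    (hu : u ∈ L) :
    get2 (reachMat c L) u v ⊤ ≤ 0 ↔ Conn c (fun x => x ∈ L) u v := by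
  have hf : ∀ (p : Bool) (l : ℕ), ((bif p then 0 else ⊤ : ℕ∞) = l) → p = true := by
    intro p l h
    cases p
    · simp at h
    · rfl
  obtain ⟨-, h2, h3, h4⟩ := fw_spec (n := m) (fun u v =>
      bif mem L u && (mem L v && (decide (u = v) || adjT c u v)) then 0 else ⊤)
    (Q := fun u v _ => Conn c (fun x => x ∈ L) u v) (fun u v _ _ l h => by
      have := hf _ _ h
      simp only [Bool.and_eq_true, mem_iff, Bool.or_eq_true, decide_eq_true_eq] at this
      obtain ⟨h1, h2, rfl | h3⟩ := this
      · exact .refl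
      · exact .single ⟨h1, h2, h3⟩) (fun u x v _ _ h h' => h.trans h')
    (D := fun u v => get2 (reachMat c L) u v ⊤) (by rw [reachMat, hc.Q_eq])
  constructor
  · intro h
    exact h4 u v 0 (by simpa using h)
  · intro h
    have hz : ∀ u v, u ∈ L → v ∈ L → (u = v ∨ adjT c u v = true) →
        get2 (reachMat c L) u v ⊤ ≤ 0 := by
      intro u v hu hv h
      refine (h2 u v (hL u hu) (hL v hv)).trans ?_
      have : (mem L u && (mem L v && (decide (u = v) || adjT c u v))) = true := by
        simp only [Bool.and_eq_true, mem_iff, Bool.or_eq_true, decide_eq_true_eq]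
        exact ⟨hu, hv, h⟩
      simp [this]
    induction h with
    | refl => exact hz u u hu hu (Or.inl rfl)
    | tail _ h ih =>
      refine (h3 _ _ _ (hL _ h.1)).trans ?_
      have := add_le_add ih (hz _ _ h.1 h.2.1 (Or.inr h.2.2))
      simpa using this

theorem rep_spec (hc : TreeOK c m) {L : List ℕ} (hL : ∀ x ∈ L, x < m) {y : ℕ} (hy : y ∈ L) :
    rep (reachMat c L) L y ∈ L ∧ Conn c (fun x => x ∈ L) y (rep (reachMat c L) L y) := by
  have h1 : y ∈ L.filter fun z => decide (get2 (reachMat c L) y z ⊤ ≤ 0) := by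
    rw [List.mem_filter]
    exact ⟨hy, decide_eq_true ((reachMat_le_iff hc hL hy).2 .refl)⟩
  unfold rep
  cases h : L.filter fun z => decide (get2 (reachMat c L) y z ⊤ ≤ 0) with
  | nil => rw [h] at h1; simp at h1
  | cons z l =>
    have hz : z ∈ L.filter fun z => decide (get2 (reachMat c L) y z ⊤ ≤ 0) := by rw [h]; simp
    obtain ⟨h2, h3⟩ := List.mem_filter.1 hz
    exact ⟨h2, (reachMat_le_iff hc hL hy).1 (of_decide_eq_true h3)⟩

/-- Connected nodes reach the same nodes, hence have the same first reachable one; the default of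
`headD` is not used, since a node reaches itself. -/
theorem rep_eq (hc : TreeOK c m) {L : List ℕ} (hL : ∀ x ∈ L, x < m) {y z : ℕ} (hy : y ∈ L)
    (h : Conn c (fun x => x ∈ L) y z) : rep (reachMat c L) L y = rep (reachMat c L) L z := by
  have hz : z ∈ L := h.mem hy
  have h1 : (L.filter fun w => decide (get2 (reachMat c L) y w ⊤ ≤ 0)) =
      L.filter fun w => decide (get2 (reachMat c L) z w ⊤ ≤ 0) := by
    refine List.filter_congr fun w hw => ?_
    rw [Bool.eq_iff_iff, decide_eq_true_iff, decide_eq_true_iff, reachMat_le_iff hc hL hy,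
      reachMat_le_iff hc hL hz]
    exact ⟨fun h' => (h.symm hc).trans h', fun h' => h.trans h'⟩
  have h2 : z ∈ L.filter fun w => decide (get2 (reachMat c L) z w ⊤ ≤ 0) := by
    rw [List.mem_filter]
    exact ⟨hz, decide_eq_true ((reachMat_le_iff hc hL hz).2 .refl)⟩
  unfold rep
  rw [h1]
  cases h : L.filter fun w => decide (get2 (reachMat c L) z w ⊤ ≤ 0) with
  | nil => rw [h] at h2; simp at h2
  | cons a l => rfl

theorem mem_comp (hc : TreeOK c m) {L : List ℕ} (hL : ∀ x ∈ L, x < m) {y : ℕ}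
    (hx : x ∈ L) (hrep : rep (reachMat c L) L x = x) :
    y ∈ comp (reachMat c L) L x ↔ y ∈ L ∧ Conn c (fun x => x ∈ L) x y := by
  unfold comp
  rw [List.mem_filter, decide_eq_true_iff]
  refine and_congr_right fun hy => ⟨?_, fun h => ?_⟩
  · rintro rfl
    exact (rep_spec hc hL hy).2.symm hc
  · rw [← rep_eq hc hL hx h, hrep]

end Tree

/-! ### Splitting a piece of the tree -/

section Pieces

variable {c : Ctx} {m : ℕ} {pc q : List ℕ × List ℕ} {s t v : ℕ}

/-- A valid piece: a connected set of nodes and its boundary. -/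
structure PieceOK (c : Ctx) (m : ℕ) (pc : List ℕ × List ℕ) : Prop where
  nodup : pc.1.Nodup
  lt : ∀ x ∈ pc.1, x < m
  conn : ∀ x ∈ pc.1, ∀ y ∈ pc.1, Conn c (fun z => z ∈ pc.1) x y
  closed : ∀ x ∈ pc.1, ∀ y, adjT c x y = true → y ∈ pc.1 ∨ y ∈ pc.2
  disj : ∀ b ∈ pc.2, b ∉ pc.1
  card : pc.2.length ≤ 3

/-- A measure for the depth of the recursion. -/
def depth (pc : List ℕ × List ℕ) : ℕ :=
  2 * pc.1.length.size + if pc.2.length ≤ 2 then 0 else 1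

theorem PieceOK.root (hc : TreeOK c m) : PieceOK c m (List.range c.Q.length, []) where
  nodup := List.nodup_range
  lt := by simp [hc.Q_eq]
  conn := by simpa [hc.Q_eq] using fun x hx y hy => hc.conn x y hx hy
  closed := by
    intro x _ y h
    simpa [hc.Q_eq] using hc.adj_lt y x (hc.symm _ _ h)
  disj := by simp
  card := by simp

theorem mem_without {C : List ℕ} : s ∈ without C t ↔ s ∈ C ∧ s ≠ t := by
  simp [without]

theorem PieceOK.without_lt (hp : PieceOK c m pc) : ∀ x ∈ without pc.1 t, x < m :=
  fun x hx => hp.lt x (mem_without.1 hx).1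

theorem mem_split_iff (hc : TreeOK c m) (hp : PieceOK c m pc) (hq : q ∈ split c pc t) :
    ∃ x ∈ without pc.1 t, (∀ y, y ∈ q.1 ↔ y ∈ without pc.1 t ∧
      Conn c (fun z => z ∈ without pc.1 t) x y) ∧ q.2 = nbrs c (t :: pc.2) q.1 := by
  obtain ⟨x, hx, hr, rfl⟩ := mem_split hq
  exact ⟨x, hx, fun y => mem_comp hc hp.without_lt hx hr, rfl⟩

theorem exists_mem_split (hc : TreeOK c m) (hp : PieceOK c m pc) (hs : s ∈ pc.1) (hst : s ≠ t) :
    ∃ q ∈ split c pc t, s ∈ q.1 := by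
  have hs' : s ∈ without pc.1 t := mem_without.2 ⟨hs, hst⟩
  obtain ⟨h1, h2⟩ := rep_spec hc hp.without_lt hs'
  refine ⟨_, List.mem_map.2 ⟨rep (reachMat c (without pc.1 t)) (without pc.1 t) s, ?_, rfl⟩, ?_⟩
  · rw [reps, List.mem_filter, decide_eq_true_iff]
    exact ⟨h1, (rep_eq hc hp.without_lt hs' h2).symm⟩
  · simp [comp, hs']

theorem split_pairwise (hp : PieceOK c m pc) :
    (split c pc t).Pairwise fun q q' => ∀ x ∈ q.1, x ∉ q'.1 := by
  unfold split
  rw [List.pairwise_map]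
  refine List.Pairwise.imp ?_ ((hp.nodup.filter _).filter _)
  intro x y hxy z hz hz'
  simp only [comp, List.mem_filter, decide_eq_true_iff] at hz hz'
  exact hxy (hz.2.symm.trans hz'.2)

theorem PieceOK.split (hc : TreeOK c m) (hp : PieceOK c m pc) (hq : q ∈ split c pc t)
    (hcard : q.2.length ≤ 3) : PieceOK c m q := by
  have hnd : q.1.Nodup := by
    obtain ⟨x, hx, hr, rfl⟩ := mem_split hq
    exact (hp.nodup.filter _).filter _
  obtain ⟨x, hx, h1, h2⟩ := mem_split_iff hc hp hq
  refine ⟨hnd, fun y hy => hp.without_lt y ((h1 y).1 hy).1, ?_, ?_, ?_, hcard⟩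
  · have key : ∀ y ∈ q.1, Conn c (fun z => z ∈ q.1) x y := by
      intro y hy
      obtain ⟨-, h⟩ := (h1 y).1 hy
      clear hy
      induction h with
      | refl => exact .refl
      | tail hab hbc ih =>
        exact .tail ih ⟨(h1 _).2 ⟨hbc.1, hab⟩, (h1 _).2 ⟨hbc.2.1, .tail hab hbc⟩, hbc.2.2⟩
    intro y hy z hz
    exact ((key y hy).symm hc).trans (key z hz)
  · intro y hy z hyz
    obtain ⟨h3, h4⟩ := (h1 y).1 hy
    have hb : z ∈ t :: pc.2 → z ∈ q.2 := by
      intro h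
      rw [h2, nbrs, List.mem_filter, List.any_eq_true]
      exact ⟨h, y, hy, hc.symm _ _ hyz⟩
    by_cases hzt : z = t
    · exact Or.inr (hb (by simp [hzt]))
    rcases hp.closed y (mem_without.1 h3).1 z hyz with h | h
    · have h5 := mem_without.2 ⟨h, hzt⟩
      exact Or.inl ((h1 z).2 ⟨h5, .tail h4 ⟨h3, h5, hyz⟩⟩)
    · exact Or.inr (hb (by simp [h]))
  · intro b hb hbq
    rw [h2] at hb
    have h3 := mem_without.1 ((h1 b).1 hbq).1
    rcases List.mem_cons.1 (List.mem_filter.1 hb).1 with rfl | h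
    · exact h3.2 rfl
    · exact hp.disj b h h3.1

/-! ### Good splitting nodes exist and make the recursion shallow -/

theorem length_filter_any_le (f : ℕ → ℕ → Bool) (B D : List ℕ) :
    (B.filter fun b => D.any fun d => f b d).length ≤
      (D.map fun d => (B.filter fun b => f b d).length).sum := by
  induction D with
  | nil => simp
  | cons d D ih =>
    have h : ∀ B : List ℕ, (B.filter fun b => (d :: D).any fun d => f b d).length ≤
        (B.filter fun b => f b d).length + (B.filter fun b => D.any fun d => f b d).length := by
      intro B
      induction B with
      | nil => simp
      | cons b B ih =>
        simp only [List.any_cons] at ih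
        simp only [List.filter_cons, List.any_cons]
        cases f b d <;> cases D.any fun d => f b d <;> simp <;> omega
    have := h B
    simp only [List.map_cons, List.sum_cons]
    omega

/-- A node outside of a piece has at most one neighbour in the piece. -/
theorem PieceOK.card_adj_le (hc : TreeOK c m) (hp : PieceOK c m pc) {b : ℕ} (hb : b ∈ pc.2) :
    (pc.1.toFinset.filter fun x => adjT c b x = true).card ≤ 1 := by
  rw [Finset.card_le_one]
  intro x hx y hy
  simp only [Finset.mem_filter, List.mem_toFinset] at hx hy
  by_contra hxy
  have hbC := hp.disj b hb
  -- With two neighbours `x` and `y` in the piece, the route from `x` through the piece to `y` and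
  -- then to `b` would bypass the edge between `x` and `b`.
  refine hc.bridge x b (hc.symm _ _ hx.2) (.trans (b := y) ?_ (.single ⟨hc.symm _ _ hy.2, ?_, ?_⟩))
  · refine Relation.ReflTransGen.mono ?_ _ _ (hp.conn x hx.1 y hy.1)
    rintro a a' ⟨ha, ha', h⟩
    exact ⟨h, fun h => hbC (h.2 ▸ ha'), fun h => hbC (h.1 ▸ ha)⟩
  · exact fun h => hxy h.1.symm
  · rintro ⟨rfl, -⟩
    exact hbC hy.1

/-- Double counting of the edges between boundary nodes and the piece. -/
theorem sum_length_filter (f : ℕ → ℕ → Bool) (B : List ℕ) (C : Finset ℕ) :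
    ∑ x ∈ C, (B.filter fun b => f b x).length =
      (B.map fun b => (C.filter fun x => f b x = true).card).sum := by
  induction B with
  | nil => simp
  | cons b B ih =>
    rw [List.map_cons, List.sum_cons, ← ih, Finset.card_filter, ← Finset.sum_add_distrib]
    refine Finset.sum_congr rfl fun x _ => ?_
    rw [List.filter_cons]
    cases f b x <;> simp
    ring

/-- Both kinds of good nodes are centroids, for different weights. With unit weights the centroid
halves the piece. If there are three boundary nodes, every node is weighted by its number of
boundary neighbours; the total is at most 3, so a component of at most half the weight touches at
most one old boundary node. -/
theorem PieceOK.exists_good (hc : TreeOK c m) (hp : PieceOK c m pc) (hC : pc.1 ≠ []) :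
    ∃ t ∈ pc.1, good c pc t = true := by
  classical
  have hne : pc.1.toFinset.Nonempty := by
    obtain ⟨x, hx⟩ := List.exists_mem_of_ne_nil _ hC
    exact ⟨x, by simpa⟩
  obtain ⟨t, ht, h⟩ := hc.exists_centroid pc.1.toFinset hne (by simpa using hp.conn)
    fun x => if pc.2.length ≤ 2 then 1 else (pc.2.filter fun b => adjT c b x).length
  refine ⟨t, by simpa using ht, ?_⟩
  rw [good, List.all_eq_true]
  intro q hq
  have hnd : q.1.Nodup := by
    obtain ⟨x, hx, hr, rfl⟩ := mem_split hq
    exact (hp.nodup.filter _).filter _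
  obtain ⟨x, hx, h1, h2⟩ := mem_split_iff hc hp hq
  obtain ⟨hxC, hxt⟩ := mem_without.1 hx
  have h3 := h x (by simpa using hxC) hxt
  have h4 : (pc.1.toFinset.filter fun y =>
      Conn c (fun y => y ∈ pc.1.toFinset ∧ y ≠ t) x y) = q.1.toFinset := by
    ext y
    simp only [Finset.mem_filter, List.mem_toFinset, h1, mem_without]
    refine ⟨fun h => ⟨⟨h.1, (h.2.mem (X := fun y => y ∈ pc.1 ∧ y ≠ t) ⟨hxC, hxt⟩).2⟩, h.2⟩,
      fun h => ⟨h.1.1, h.2⟩⟩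
  rw [h4] at h3
  by_cases hB : pc.2.length ≤ 2
  · simp only [hB, if_true] at h3
    simpa [hB, List.toFinset_card_of_nodup hnd, List.toFinset_card_of_nodup hp.nodup] using h3
  · simp only [hB, if_false] at h3
    have h5 : ∑ x ∈ pc.1.toFinset, (pc.2.filter fun b => adjT c b x).length ≤ 3 := by
      rw [sum_length_filter]
      refine (List.sum_le_card_nsmul _ 1 ?_).trans ?_
      · simp only [List.mem_map]
        rintro _ ⟨b, hb, rfl⟩
        exact hp.card_adj_le hc hb
      · simpa using hp.card
    have h6 : ∑ x ∈ q.1.toFinset, (pc.2.filter fun b => adjT c b x).length =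
        (q.1.map fun x => (pc.2.filter fun b => adjT c b x).length).sum := by
      rw [List.sum_toFinset _ hnd]
    have h7 := length_filter_any_le (adjT c) pc.2 q.1
    -- The boundary of a component consists of the old boundary nodes that it touches and possibly
    -- `t`; this is the `+ 1`.
    have h8 : q.2.length ≤ (pc.2.filter fun b => q.1.any fun d => adjT c b d).length + 1 := by
      rw [h2, nbrs, List.filter_cons]
      split_ifs <;> simp
    simp only [hB, decide_false, cond_false, decide_eq_true_iff]
    omega

theorem PieceOK.pick_ne_nil (hc : TreeOK c m) (hp : PieceOK c m pc) (hC : pc.1 ≠ []) :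
    pick c pc ≠ [] := by
  obtain ⟨t, ht, h⟩ := hp.exists_good hc hC
  have : t ∈ pc.1.filter fun t => good c pc t := List.mem_filter.2 ⟨ht, h⟩
  unfold pick
  cases h : pc.1.filter fun t => good c pc t with
  | nil => rw [h] at this; simp at this
  | cons a l => simp

theorem mem_pick_or (hc : TreeOK c m) (hp : PieceOK c m pc) (hs : s ∈ pc.1) :
    s ∈ pick c pc ∨ ∃ q ∈ children c pc, s ∈ q.1 := by
  have h1 := hp.pick_ne_nil hc (List.ne_nil_of_mem hs)
  obtain ⟨t, ht⟩ := List.exists_mem_of_ne_nil _ h1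
  by_cases hst : s = t
  · exact Or.inl (hst ▸ ht)
  · obtain ⟨q, hq, h⟩ := exists_mem_split hc hp hs hst
    exact Or.inr ⟨q, List.mem_flatMap.2 ⟨t, ht, hq⟩, h⟩

theorem length_pick_le (c : Ctx) (pc : List ℕ × List ℕ) : (pick c pc).length ≤ 1 := by
  simp [pick]

/-- A split adds at most one boundary node. From a boundary of at most two nodes it may lead to
three, but then the piece is halved; from three it leads back to two while the piece does not grow.
The measure `depth` drops in both cases, and three boundary nodes are never exceeded. -/
theorem PieceOK.child (hc : TreeOK c m) (hp : PieceOK c m pc) (hq : q ∈ children c pc) :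
    PieceOK c m q ∧ depth q < depth pc ∧ (∀ x ∈ q.1, x ∈ pc.1 ∧ x ∉ pick c pc) ∧
      ∀ b ∈ q.2, b ∈ pick c pc ++ pc.2 := by
  obtain ⟨t, ht, hpick, hgood, hq⟩ := mem_children hq
  obtain ⟨x, hx, h1, h2⟩ := mem_split_iff hc hp hq
  have hg := List.all_eq_true.1 hgood q hq
  have hnd : q.1.Nodup := by
    obtain ⟨x, hx, hr, rfl⟩ := mem_split hq
    exact (hp.nodup.filter _).filter _
  have hsub : ∀ y ∈ q.1, y ∈ pc.1 ∧ y ∉ pick c pc := by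
    intro y hy
    have := mem_without.1 ((h1 y).1 hy).1
    simpa [hpick] using this
  have hq2 : q.2.length ≤ pc.2.length + 1 := by
    rw [h2]
    exact (List.length_filter_le _ _).trans (by simp)
  have hpos : 0 < q.1.length := List.length_pos_of_mem ((h1 x).2 ⟨hx, .refl⟩)
  have hle : q.1.length ≤ pc.1.length := by
    rw [← List.toFinset_card_of_nodup hnd, ← List.toFinset_card_of_nodup hp.nodup]
    exact Finset.card_le_card fun y hy => by simpa using (hsub y (by simpa using hy)).1
  have hcard := hp.card
  refine ⟨hp.split hc hq ?_, ?_, hsub, ?_⟩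
  · by_cases hB : pc.2.length ≤ 2
    · omega
    · simp only [hB, decide_false, cond_false, decide_eq_true_iff] at hg
      omega
  · unfold depth
    by_cases hB : pc.2.length ≤ 2
    · simp only [hB, decide_true, cond_true, decide_eq_true_iff] at hg
      have h3 := Nat.size_le_size hg
      -- Halving lowers the binary length by one, hence the measure by two, which outweighs the one
      -- unit for a third boundary node.
      have h4 : (2 * q.1.length).size = q.1.length.size + 1 := by
        rw [← Nat.bit_false_apply, Nat.size_bit]
        rw [Nat.bit_false_apply]
        omega
      rw [if_pos hB]
      split_ifs <;> omega
    · simp only [hB, decide_false, cond_false, decide_eq_true_iff] at hg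
      have h3 := Nat.size_le_size hle
      rw [if_neg hB, if_pos hg]
      omega
  · intro b hb
    rw [h2] at hb
    simpa [hpick] using (List.mem_filter.1 hb).1

theorem children_pairwise (hp : PieceOK c m pc) :
    (children c pc).Pairwise fun q q' => ∀ x ∈ q.1, x ∉ q'.1 := by
  unfold children
  rcases h1 : pick c pc with _ | ⟨t, _ | ⟨t', l⟩⟩
  · simp
  · simpa using split_pairwise hp
  · have := length_pick_le c pc
    simp [h1] at this

theorem inB_iff {B : List ℕ} : inB c B v = true ↔ ∃ b ∈ B, inBag c b v = true := by
  simp [inB]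

/-- The nodes whose bags contain `v` are connected. They meet the piece but not its boundary, the
only way out. -/
theorem PieceOK.mem_of_inBag (hc : TreeOK c m) (hp : PieceOK c m pc) (h1 : inB c pc.1 v = true)
    (h2 : ¬ inB c pc.2 v = true) (hs : inBag c s v = true) : s ∈ pc.1 := by
  obtain ⟨s₁, hs₁, h⟩ := inB_iff.1 h1
  have h3 := hc.bag_conn v s₁ s h hs
  clear hs
  induction h3 with
  | refl => exact hs₁
  | tail _ hab ih =>
    rcases hp.closed _ ih _ hab.2.2 with h | h'
    · exact h
    · exact absurd (inB_iff.2 ⟨_, h', hab.2.1⟩) h2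

/-- Otherwise all bags with `v` would belong to nodes of `q`, but neither the removed node nor the
boundary nodes of `pc` are among these. -/
theorem PieceOK.inB_child (hc : TreeOK c m) (hp : PieceOK c m pc) (hq : q ∈ children c pc)
    (h1 : inB c q.1 v = true) (h2 : inB c (pick c pc ++ pc.2) v = true) :
    inB c q.2 v = true := by
  by_contra h3
  obtain ⟨hq', -, hsub, -⟩ := hp.child hc hq
  obtain ⟨b, hb, hbv⟩ := inB_iff.1 h2
  have h4 := hsub b (hq'.mem_of_inBag hc h1 h3 hbv)
  rcases List.mem_append.1 hb with h | h
  · exact h4.2 h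
  · exact hp.disj b h h4.1

end Pieces

/-! ### Short paths can be followed by few hops inside common bags -/

/-- `Walk E u v l`: there is a walk of length `l` from `u` to `v` along the edges `E`. -/
inductive Walk (E : ℕ → ℕ → ℕ → Prop) : ℕ → ℕ → ℕ → Prop
  | refl (u : ℕ) : Walk E u u 0
  | cons {u x v a l : ℕ} (h : E u x a) (hw : Walk E x v l) : Walk E u v (a + l)

/-- `Hops E R k l u v`: there is a walk of length `l` from `u` to `v` that consists of `k` walks
between vertices that are related by `R`. -/
inductive Hops (E : ℕ → ℕ → ℕ → Prop) (R : ℕ → ℕ → Prop) : ℕ → ℕ → ℕ → ℕ → Prop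
  | refl (u : ℕ) : Hops E R 0 0 u u
  | cons {u x v k a l : ℕ} (h : R u x) (ha : Walk E u x a) (hw : Hops E R k l x v) :
      Hops E R (k + 1) (a + l) u v

/-- Two vertices appear together in the bags of a piece that are looked at during the recursion. -/
def Meet (c : Ctx) : ℕ → List ℕ × List ℕ → ℕ → ℕ → Prop
  | 0, _, _, _ => False
  | f + 1, pc, u, v => (inB c (pick c pc ++ pc.2) u = true ∧ inB c (pick c pc ++ pc.2) v = true) ∨
      ∃ q ∈ children c pc, Meet c f q u v

/-- The edges of a graph are symmetric and covered by bags. -/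
structure EdgeOK (c : Ctx) (E : ℕ → ℕ → ℕ → Prop) : Prop where
  symm : ∀ u v l, E u v l → E v u l
  bag : ∀ u v l, E u v l → ∃ t, inBag c t u = true ∧ inBag c t v = true

section

variable {c : Ctx} {m : ℕ} {E : ℕ → ℕ → ℕ → Prop} {R R' : ℕ → ℕ → Prop} {k k' a b l u v x s : ℕ}
  {pc q : List ℕ × List ℕ}

theorem Walk.trans (h : Walk E u v a) (h' : Walk E v x b) : Walk E u x (a + b) := by
  induction h with
  | refl => simpa
  | cons h _ ih => rw [add_assoc]; exact .cons h (ih h')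

theorem Walk.symm (hE : EdgeOK c E) (h : Walk E u v a) : Walk E v u a := by
  induction h with
  | refl => exact .refl _
  | @cons u x v a l h _ ih =>
    rw [add_comm]
    exact ih.trans (.cons (hE.symm _ _ _ h) (.refl u))

theorem Hops.trans (h : Hops E R k a u v) (h' : Hops E R k' b v x) :
    Hops E R (k + k') (a + b) u x := by
  induction h with
  | refl => simpa
  | @cons u x v k a l h ha _ ih =>
    rw [add_assoc a, Nat.add_right_comm k]
    exact .cons h ha (ih h')

theorem Hops.single (h : R u v) (ha : Walk E u v a) : Hops E R 1 a u v :=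
  .cons h ha (.refl v)

theorem Hops.mono (hR : ∀ u v, R u v → R' u v) (h : Hops E R k a u v) : Hops E R' k a u v := by
  induction h with
  | refl => exact .refl _
  | cons h ha _ ih => exact .cons (hR _ _ h) ha ih

theorem Meet.symm {f : ℕ} (h : Meet c f pc u v) : Meet c f pc v u := by
  induction f generalizing pc with
  | zero => exact h
  | succ f ih =>
    rcases h with h | ⟨q, hq, h⟩
    · exact Or.inl h.symm
    · exact Or.inr ⟨q, hq, ih h⟩

theorem Hops.symm {f : ℕ} (hE : EdgeOK c E) (h : Hops E (Meet c f pc) k a u v) :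
    Hops E (Meet c f pc) k a v u := by
  induction h with
  | refl => exact .refl _
  | @cons u x v k a l h ha _ ih =>
    rw [add_comm a]
    exact ih.trans (.single h.symm (ha.symm hE))

/-- A vertex lies only in bags inside a piece. -/
def Interior (c : Ctx) (pc : List ℕ × List ℕ) (v : ℕ) : Prop :=
  inB c pc.1 v = true ∧ ¬ inB c pc.2 v = true

theorem inB_append {B B' : List ℕ} :
    inB c (B ++ B') v = true ↔ inB c B v = true ∨ inB c B' v = true := by
  simp [inB]

theorem inB_mono {B B' : List ℕ} (h : ∀ b ∈ B, b ∈ B') (hv : inB c B v = true) :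
    inB c B' v = true := by
  obtain ⟨b, hb, h'⟩ := inB_iff.1 hv
  exact inB_iff.2 ⟨b, h b hb, h'⟩

/-- Every vertex of a piece is in one of the bags looked at, or interior to a subpiece. -/
theorem PieceOK.cases (hc : TreeOK c m) (hp : PieceOK c m pc)
    (hv : inB c (pc.1 ++ pc.2) v = true) :
    inB c (pick c pc ++ pc.2) v = true ∨ ∃ q ∈ children c pc, Interior c q v := by
  by_cases h : inB c (pick c pc ++ pc.2) v = true
  · exact Or.inl h
  refine Or.inr ?_
  rw [inB_append, not_or] at h
  rw [inB_append] at hv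
  obtain ⟨t, ht, htv⟩ := inB_iff.1 (hv.resolve_right h.2)
  rcases mem_pick_or hc hp ht with h1 | ⟨q, hq, hsq⟩
  · exact absurd (inB_iff.2 ⟨t, h1, htv⟩) h.1
  · refine ⟨q, hq, inB_iff.2 ⟨t, hsq, htv⟩, fun h' => ?_⟩
    have := inB_mono (hp.child hc hq).2.2.2 h'
    rw [inB_append] at this
    tauto

theorem PieceOK.not_interior (hc : TreeOK c m) (hp : PieceOK c m pc) (hq : q ∈ children c pc)
    (h : inB c (pick c pc ++ pc.2) v = true) : ¬ Interior c q v :=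
  fun h' => h'.2 (hp.inB_child hc hq h'.1 h)

/-- A walk that leaves the interior of a piece does so through its boundary. -/
theorem Walk.exit (hc : TreeOK c m) (hE : EdgeOK c E) (hp : PieceOK c m pc) (h : Walk E v u l)
    (hv : Interior c pc v) (hu : ¬ Interior c pc u) :
    ∃ y a b, inB c pc.2 y = true ∧ Walk E v y a ∧ Walk E y u b ∧ a + b = l := by
  induction h with
  | refl => exact absurd hv hu
  | @cons v x u a l h hw ih =>
    by_cases hx : Interior c pc x
    · obtain ⟨y, a', b', h1, h2, h3, h4⟩ := ih hx hu
      exact ⟨y, a + a', b', h1, .cons h h2, h3, by omega⟩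
    -- The bag that covers the edge contains the interior vertex `v`, so its node is inside the
    -- piece. Hence `x` is in the piece, and not being interior it is in a boundary bag.
    · obtain ⟨t, ht, htx⟩ := hE.bag _ _ _ h
      have h1 := hp.mem_of_inBag hc hv.1 hv.2 ht
      refine ⟨x, a, l, ?_, .cons h (.refl x), hw, rfl⟩
      by_contra h2
      exact hx ⟨inB_iff.2 ⟨t, h1, htx⟩, h2⟩

theorem Hops.child {f : ℕ} (hq : q ∈ children c pc) (h : Hops E (Meet c f q) k a u v) :
    Hops E (Meet c (f + 1) pc) k a u v :=
  h.mono fun _ _ h => Or.inr ⟨q, hq, h⟩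

/-- If `v` is interior to a subpiece, the walk leaves that subpiece through a vertex `y` of its
boundary bags. Both `y` and `u` are seen at the current stage, so the part from `y` to `u` is a
single hop, and the part from `v` to `y` is treated one level deeper: one hop per level. -/
theorem exists_hops_boundary (hc : TreeOK c m) (hE : EdgeOK c E) (f : ℕ)
    (hp : PieceOK c m pc) (hf : depth pc < f) (hv : Interior c pc v) (hu : inB c pc.2 u = true)
    (h : Walk E v u l) : ∃ k, k ≤ f ∧ Hops E (Meet c f pc) k l v u := by
  induction f generalizing pc v u l with
  | zero => omega
  | succ f ih =>
    have hu' : inB c (pick c pc ++ pc.2) u = true := inB_append.2 (Or.inr hu)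
    rcases hp.cases hc (inB_append.2 (Or.inl hv.1)) with h1 | ⟨q, hq, hvq⟩
    · exact ⟨1, by omega, .single (Or.inl ⟨h1, hu'⟩) h⟩
    · obtain ⟨hpq, hd, -, hB⟩ := hp.child hc hq
      obtain ⟨y, a, b, hy, h1, h2, rfl⟩ := h.exit hc hE hpq hvq (hp.not_interior hc hq hu')
      obtain ⟨k, hk, h3⟩ := ih hpq (by omega) hvq hy h1
      exact ⟨k + 1, by omega, (h3.child hq).trans (.single (Or.inl ⟨inB_mono hB hy, hu'⟩) h2)⟩

theorem exists_hops_mixed (hc : TreeOK c m) (hE : EdgeOK c E) (f : ℕ) (hp : PieceOK c m pc)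
    (hf : depth pc < f + 1) (hq : q ∈ children c pc) (hv : Interior c q v)
    (hu : inB c (pick c pc ++ pc.2) u = true) (h : Walk E v u l) :
    ∃ k, k ≤ f + 1 ∧ Hops E (Meet c (f + 1) pc) k l v u := by
  obtain ⟨hpq, hd, -, hB⟩ := hp.child hc hq
  obtain ⟨y, a, b, hy, h1, h2, rfl⟩ := h.exit hc hE hpq hv (hp.not_interior hc hq hu)
  obtain ⟨k, hk, h3⟩ := exists_hops_boundary hc hE f hpq (by omega) hv hy h1
  exact ⟨k + 1, by omega, (h3.child hq).trans (.single (Or.inl ⟨inB_mono hB hy, hu⟩) h2)⟩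

theorem PieceOK.eq_child (hc : TreeOK c m) (hp : PieceOK c m pc) {q' : List ℕ × List ℕ}
    (hq : q ∈ children c pc) (hq' : q' ∈ children c pc) (hv : Interior c q v)
    (hv' : inB c q'.1 v = true) : q = q' := by
  by_contra hne
  obtain ⟨t, ht, htv⟩ := inB_iff.1 hv'
  have h1 := (hp.child hc hq).1.mem_of_inBag hc hv.1 hv.2 htv
  have hsymm : Std.Symm fun q q' : List ℕ × List ℕ => ∀ x ∈ q.1, x ∉ q'.1 :=
    ⟨fun q q' h x hx hx' => h x hx' hx⟩
  exact (children_pairwise hp).forall hq hq' hne t h1 ht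

/-- Descend as long as both ends are interior to the same subpiece. Where they part, the walk is cut
at a boundary vertex of the subpiece of `v`; each half costs about one hop per remaining level,
which gives the factor 2. -/
theorem exists_hops (hc : TreeOK c m) (hE : EdgeOK c E) (f : ℕ)
    (hp : PieceOK c m pc) (hf : depth pc < f) (hv : inB c (pc.1 ++ pc.2) v = true)
    (hu : inB c (pc.1 ++ pc.2) u = true) (h : Walk E v u l) :
    ∃ k, k ≤ 2 * f + 1 ∧ Hops E (Meet c f pc) k l v u := by
  induction f generalizing pc v u l with
  | zero => omega
  | succ f ih =>
    rcases hp.cases hc hv with h1 | ⟨q, hq, hvq⟩ <;> rcases hp.cases hc hu with h2 | ⟨q', hq', huq⟩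
    · exact ⟨1, by omega, .single (Or.inl ⟨h1, h2⟩) h⟩
    · obtain ⟨k, hk, h3⟩ := exists_hops_mixed hc hE f hp hf hq' huq h1 (h.symm hE)
      exact ⟨k, by omega, h3.symm hE⟩
    · obtain ⟨k, hk, h3⟩ := exists_hops_mixed hc hE f hp hf hq hvq h2 h
      exact ⟨k, by omega, h3⟩
    · obtain ⟨hpq, hd, -, hB⟩ := hp.child hc hq
      by_cases huq' : Interior c q u
      · obtain ⟨k, hk, h3⟩ := ih hpq (by omega) (inB_append.2 (Or.inl hvq.1))
          (inB_append.2 (Or.inl huq'.1)) h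
        exact ⟨k, by omega, h3.child hq⟩
      · obtain ⟨y, a, b, hy, h1, h2, rfl⟩ := h.exit hc hE hpq hvq huq'
        obtain ⟨k, hk, h3⟩ := exists_hops_boundary hc hE f hpq (by omega) hvq hy h1
        obtain ⟨k', hk', h4⟩ := exists_hops_mixed hc hE f hp hf hq' huq (inB_mono hB hy)
          (h2.symm hE)
        exact ⟨k + k', by omega, (h3.child hq).trans (h4.symm hE)⟩

theorem Meet.inB {f : ℕ} (hc : TreeOK c m) (hp : PieceOK c m pc) (h : Meet c f pc u v) :
    inB c (pc.1 ++ pc.2) v = true := by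
  induction f generalizing pc with
  | zero => exact h.elim
  | succ f ih =>
    rcases h with h | ⟨q, hq, h⟩
    · refine inB_mono ?_ h.2
      intro b hb
      rcases List.mem_append.1 hb with hb | hb
      · exact List.mem_append.2 (Or.inl (List.mem_filter.1 (List.mem_of_mem_take hb)).1)
      · exact List.mem_append.2 (Or.inr hb)
    · obtain ⟨hpq, -, hsub, hB⟩ := hp.child hc hq
      refine inB_mono ?_ (ih hpq h)
      intro b hb
      rcases List.mem_append.1 hb with hb | hb
      · exact List.mem_append.2 (Or.inl (hsub b hb).1)
      · rcases List.mem_append.1 (hB b hb) with hb | hb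
        · exact List.mem_append.2 (Or.inl (List.mem_filter.1 (List.mem_of_mem_take hb)).1)
        · exact List.mem_append.2 (Or.inr hb)

/-- An interior vertex of `q` is seen neither at the current stage nor in other subpieces, so
everything that it meets it meets inside `q`. -/
theorem Meet.child {f : ℕ} (hc : TreeOK c m) (hp : PieceOK c m pc) (hq : q ∈ children c pc)
    (hv : Interior c q v) (h : Meet c (f + 1) pc u v) : Meet c f q u v := by
  have hv' : ¬ KSwO.inB c (pick c pc ++ pc.2) v = true := fun h => hp.not_interior hc hq h hv
  rcases h with h | ⟨q', hq', h⟩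
  · exact absurd h.2 hv'
  · obtain ⟨hpq', -, -, hB⟩ := hp.child hc hq'
    rcases inB_append.1 (h.inB hc hpq') with h1 | h1
    · rwa [hp.eq_child hc hq hq' hv h1]
    · exact absurd (inB_mono hB h1) hv'

end

/-! ### Joining tables -/

/-- The context of the dynamic program is valid. -/
structure CtxOK (c : Ctx) (n m : ℕ) : Prop where
  tree : TreeOK c m
  R_eq : c.R = List.range n
  bag_vert : ∀ t v, inBag c t v = true → v < n
  top_gt : 1 < c.top
  mem_codes : ∀ l, l ∈ c.codes ↔ 0 < l ∧ l ≤ c.top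
  bd_ge : ∀ B : List ℕ, B.length ≤ 4 →
    (n + 1) * ((n + 1) * (2 * (c.top + 1)) ^ (verts c B).length) ≤ c.bd.length

/-- A table, with the set of labelled vertices, a set of vertices for which the labels are accounted
for in every row, and a set of vertices for which they are accounted for in some row. -/
structure Item where
  /-- the table -/
  tab : List (List ℕ)
  /-- the labelled vertices -/
  dom : ℕ → Prop
  /-- the vertices whose labels are always accounted for -/
  int : ℕ → Prop
  /-- the vertices whose labels can be accounted for -/
  may : ℕ → Prop

/-- Properties of all rows of a table. -/
structure Item.Sound (c : Ctx) (n r : ℕ) (x : Item) : Prop where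
  dom_lt : ∀ v, x.dom v → v < n
  dom_iff : ∀ q ∈ x.tab, ∀ v, val q v ≠ 0 ↔ x.dom v
  le_top : ∀ q ∈ x.tab, ∀ v, val q v ≤ c.top
  sup : ∀ q ∈ x.tab, ∀ v, val q v = 1 → c.sup.getD v false = true
  int : ∀ q ∈ x.tab, ∀ v, x.int v → sat c r q v = true

open Classical in
/-- The number of elements below `n` with a property. -/
def cnt (n : ℕ) (P : ℕ → Prop) : ℕ := ((Finset.range n).filter P).card

/-- A row that represents a labelling. -/
structure Represents (c : Ctx) (n r : ℕ) (lam : ℕ → ℕ) (Y : ℕ → Prop) (x : Item) (q : List ℕ) :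
    Prop where
  val_eq : ∀ v, Y v → x.dom v → val q v = lam v
  numOpen : numOpen c q = cnt n fun v => x.dom v ∧ lam v = 1
  numOut : numOut c q = cnt n fun v => (x.dom v ∧ lam v = c.top) ∧ c.cli.getD v false = true
  sat : ∀ v, Y v → x.may v → sat c r q v = true

section

variable {c : Ctx} {n m r : ℕ} {lam : ℕ → ℕ} {Y : ℕ → Prop} {x x' : Item} {q q' : List ℕ}
  {T T' : List (List ℕ)} {u v : ℕ}

theorem cnt_congr {P Q : ℕ → Prop} (h : ∀ v, v < n → (P v ↔ Q v)) : cnt n P = cnt n Q := by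
  classical
  unfold cnt
  congr 1
  exact Finset.filter_congr fun v hv => h v (Finset.mem_range.1 hv)

theorem cnt_or (P Q : ℕ → Prop) :
    cnt n (fun v => P v ∨ Q v) + cnt n (fun v => P v ∧ Q v) = cnt n P + cnt n Q := by
  classical
  unfold cnt
  refine Eq.trans ?_ (Finset.card_union_add_card_inter _ _)
  congr 2
  · ext v; simp; tauto
  · ext v; simp; tauto

theorem cnt_le (P : ℕ → Prop) : cnt n P ≤ n := by
  classical
  unfold cnt
  simpa using Finset.card_filter_le (Finset.range n) P

theorem length_filter_range (p : ℕ → Bool) :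
    ((List.range n).filter p).length = cnt n fun v => p v = true := by
  classical
  unfold cnt
  rw [← List.toFinset_card_of_nodup (List.nodup_range.filter _)]
  congr 1
  ext v
  simp

theorem CtxOK.numOpen_eq (hc : CtxOK c n m) (q : List ℕ) :
    numOpen c q = cnt n fun v => val q v = 1 := by
  unfold numOpen
  rw [hc.R_eq, length_filter_range]
  simp

theorem CtxOK.numOut_eq (hc : CtxOK c n m) (q : List ℕ) :
    numOut c q = cnt n fun v => val q v = c.top ∧ c.cli.getD v false = true := by
  unfold numOut
  rw [hc.R_eq, length_filter_range]
  refine cnt_congr fun v _ => ?_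
  simp [and_comm]

theorem wit_iff : wit c r q u v = true ↔ 0 < val q u ∧ val q u < val q v ∧
    ∃ d : ℕ, get2 c.dist u v ⊤ = d ∧ val q u * r + c.H * d ≤ val q v * r := by
  simp only [wit, Bool.and_eq_true, decide_eq_true_iff, List.any_eq_true, mem_finList]

theorem CtxOK.sat_iff (hc : CtxOK c n m) : sat c r q v = true ↔
    val q v = 1 ∨ val q v = c.top ∨ ∃ u, u < n ∧ wit c r q u v = true := by
  simp [sat, hc.R_eq]

/-- Label 1, label `top` and the codes of a witness are all nonzero, so a justification uses only
labelled vertices and survives every extension of the labelling. -/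
theorem CtxOK.sat_mono (hc : CtxOK c n m) (h : ∀ u, val q u ≠ 0 → val q' u = val q u)
    (hs : sat c r q v = true) : sat c r q' v = true := by
  have h1 := hc.top_gt
  rw [hc.sat_iff] at hs ⊢
  rcases hs with h2 | h2 | ⟨u, hu, h2⟩
  · exact Or.inl (by rw [h v (by omega), h2])
  · exact Or.inr (Or.inl (by rw [h v (by omega), h2]))
  · refine Or.inr (Or.inr ⟨u, hu, ?_⟩)
    rw [wit_iff] at h2 ⊢
    rwa [h u (by omega), h v (by omega)]

theorem sat_congr (h : val q = val q') : sat c r q v = sat c r q' v := by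
  simp only [sat, wit, h]

theorem numOpen_congr (h : val q = val q') : numOpen c q = numOpen c q' := by
  simp only [numOpen, h]

theorem numOut_congr (h : val q = val q') : numOut c q = numOut c q' := by
  simp only [numOut, h]

/-- Rows matter only through the function `val`; clipping may change the list but not this function.
-/
theorem Item.Sound.of_val (hs : x.Sound c n r) (h : ∀ q ∈ T, ∃ q' ∈ x.tab, val q = val q') :
    Item.Sound c n r ⟨T, x.dom, x.int, x.may⟩ where
  dom_lt := hs.dom_lt
  dom_iff q hq v := by
    obtain ⟨q', hq', h⟩ := h q hq
    rw [h]
    exact hs.dom_iff q' hq' v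
  le_top q hq v := by
    obtain ⟨q', hq', h⟩ := h q hq
    rw [h]
    exact hs.le_top q' hq' v
  sup q hq v := by
    obtain ⟨q', hq', h⟩ := h q hq
    rw [h]
    exact hs.sup q' hq' v
  int q hq v := by
    obtain ⟨q', hq', h⟩ := h q hq
    rw [sat_congr h]
    exact hs.int q' hq' v

theorem Represents.of_val (hr : Represents c n r lam Y x q) (h : val q' = val q) :
    Represents c n r lam Y x q' where
  val_eq v hY hv := by rw [h, hr.val_eq v hY hv]
  numOpen := by rw [numOpen_congr h, hr.numOpen]
  numOut := by rw [numOut_congr h, hr.numOut]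
  sat v hY hv := by rw [sat_congr h, hr.sat v hY hv]

theorem val_map_range (n : ℕ) (f : ℕ → ℕ) (v : ℕ) :
    val ((List.range n).map f) v = if v < n then f v else 0 := by
  unfold val
  by_cases hv : v < n <;> simp [hv]

/-! #### Unions -/

theorem CtxOK.val_union (hc : CtxOK c n m) (hs : x.Sound c n r) (hs' : x'.Sound c n r)
    (hq : q ∈ x.tab) (hq' : q' ∈ x'.tab) (v : ℕ) :
    val (union c q q') v = if val q v = 0 then val q' v else val q v := by
  unfold union
  rw [hc.R_eq, val_map_range]
  by_cases hv : v < n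
  · rw [if_pos hv]
    by_cases h : val q v = 0 <;> simp [h]
  · have h1 : val q v = 0 := by
      by_contra h
      exact hv (hs.dom_lt v ((hs.dom_iff q hq v).1 h))
    have h2 : val q' v = 0 := by
      by_contra h
      exact hv (hs'.dom_lt v ((hs'.dom_iff q' hq' v).1 h))
    simp [hv, h1, h2]

theorem CtxOK.compat_iff (hc : CtxOK c n m) (hs : x.Sound c n r) (hq : q ∈ x.tab) :
    compat c q q' = true ↔ ∀ v, val q v ≠ 0 → val q' v ≠ 0 → val q v = val q' v := by
  unfold compat
  rw [hc.R_eq, List.all_eq_true]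
  simp only [List.mem_range, Bool.or_eq_true, decide_eq_true_iff]
  constructor
  · intro h v h1 h2
    have := h v (hs.dom_lt v ((hs.dom_iff q hq v).1 h1))
    tauto
  · intro h v _
    have := h v
    tauto

theorem mem_joins : q ∈ joins c T T' ↔
    ∃ a ∈ T, ∃ b ∈ T', compat c a b = true ∧ q = union c a b := by
  simp only [joins, List.mem_flatMap, List.mem_map, List.mem_filter]
  constructor
  · rintro ⟨a, ha, b, ⟨hb, h⟩, rfl⟩
    exact ⟨a, ha, b, hb, h, rfl⟩
  · rintro ⟨a, ha, b, hb, h, rfl⟩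
    exact ⟨a, ha, b, ⟨hb, h⟩, rfl⟩

/-- The union of two items with a given table. -/
def Item.union (x x' : Item) (T : List (List ℕ)) : Item :=
  ⟨T, fun v => x.dom v ∨ x'.dom v, fun v => x.int v ∨ x'.int v, fun v => x.may v ∨ x'.may v⟩

theorem CtxOK.union_left (hc : CtxOK c n m) (hs : x.Sound c n r) (hs' : x'.Sound c n r)
    (hq : q ∈ x.tab) (hq' : q' ∈ x'.tab) (h : val q v ≠ 0) :
    val (KSwO.union c q q') v = val q v := by
  rw [hc.val_union hs hs' hq hq', if_neg h]

theorem CtxOK.union_right (hc : CtxOK c n m) (hs : x.Sound c n r) (hs' : x'.Sound c n r)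
    (hq : q ∈ x.tab) (hq' : q' ∈ x'.tab) (hqq : compat c q q' = true) (h : val q' v ≠ 0) :
    val (KSwO.union c q q') v = val q' v := by
  rw [hc.val_union hs hs' hq hq']
  split_ifs with h'
  · rfl
  · exact (hc.compat_iff hs hq).1 hqq v h' h

theorem Item.Sound.joins (hc : CtxOK c n m) (hs : x.Sound c n r) (hs' : x'.Sound c n r) :
    (x.union x' (joins c x.tab x'.tab)).Sound c n r where
  dom_lt v hv := hv.elim (hs.dom_lt v) (hs'.dom_lt v)
  dom_iff q hq v := by
    obtain ⟨a, ha, b, hb, hab, rfl⟩ := mem_joins.1 hq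
    rw [hc.val_union hs hs' ha hb]
    change _ ↔ x.dom v ∨ x'.dom v
    rw [← hs.dom_iff a ha, ← hs'.dom_iff b hb]
    split_ifs with h <;> simp [h]
  le_top q hq v := by
    obtain ⟨a, ha, b, hb, hab, rfl⟩ := mem_joins.1 hq
    rw [hc.val_union hs hs' ha hb]
    split_ifs
    · exact hs'.le_top b hb v
    · exact hs.le_top a ha v
  sup q hq v := by
    obtain ⟨a, ha, b, hb, hab, rfl⟩ := mem_joins.1 hq
    rw [hc.val_union hs hs' ha hb]
    split_ifs
    · exact hs'.sup b hb v
    · exact hs.sup a ha v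
  int q hq v hv := by
    obtain ⟨a, ha, b, hb, hab, rfl⟩ := mem_joins.1 hq
    rcases hv with hv | hv
    · exact hc.sat_mono (fun u hu => hc.union_left hs hs' ha hb hu) (hs.int a ha v hv)
    · exact hc.sat_mono (fun u hu => hc.union_right hs hs' ha hb hab hu) (hs'.int b hb v hv)

/-- Outside `Y` the rows need not agree with `lam`; only their counts do. Since vertices labelled by
both rows lie in `Y`, the rows are compatible and the common part is counted as in `lam`. -/
theorem Represents.joins (hc : CtxOK c n m) (hs : x.Sound c n r) (hs' : x'.Sound c n r)
    (hY : ∀ v, x.dom v → x'.dom v → Y v) (hq : q ∈ x.tab) (hq' : q' ∈ x'.tab)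
    (hr : Represents c n r lam Y x q) (hr' : Represents c n r lam Y x' q') :
    KSwO.union c q q' ∈ joins c x.tab x'.tab ∧
      Represents c n r lam Y (x.union x' T) (KSwO.union c q q') := by
  have hd := hs.dom_iff q hq
  have hd' := hs'.dom_iff q' hq'
  have hcompat : compat c q q' = true := by
    rw [hc.compat_iff hs hq]
    intro v h1 h2
    rw [hd] at h1
    rw [hd'] at h2
    rw [hr.val_eq v (hY v h1 h2) h1, hr'.val_eq v (hY v h1 h2) h2]
  have hl : ∀ v, val q v ≠ 0 → val (KSwO.union c q q') v = val q v := fun v h =>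
    hc.union_left hs hs' hq hq' h
  have hr2 : ∀ v, val q' v ≠ 0 → val (KSwO.union c q q') v = val q' v := fun v h =>
    hc.union_right hs hs' hq hq' hcompat h
  -- Inclusion–exclusion on both sides; used for opened suppliers (`a = 1`) and unserved clients (`a
  -- = c.top`).
  have hcount : ∀ (a : ℕ) (w : ℕ → Prop), a ≠ 0 →
      cnt n (fun v => val q v = a ∧ w v) = cnt n (fun v => (x.dom v ∧ lam v = a) ∧ w v) →
      cnt n (fun v => val q' v = a ∧ w v) = cnt n (fun v => (x'.dom v ∧ lam v = a) ∧ w v) →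
      cnt n (fun v => val (KSwO.union c q q') v = a ∧ w v) =
        cnt n (fun v => ((x.dom v ∨ x'.dom v) ∧ lam v = a) ∧ w v) := by
    intro a w ha h1 h2
    have h3 := cnt_or (n := n) (fun v => val q v = a ∧ w v) (fun v => val q' v = a ∧ w v)
    have h4 := cnt_or (n := n) (fun v => (x.dom v ∧ lam v = a) ∧ w v)
      (fun v => (x'.dom v ∧ lam v = a) ∧ w v)
    have h5 : cnt n (fun v => (val q v = a ∧ w v) ∧ (val q' v = a ∧ w v)) =
        cnt n (fun v => ((x.dom v ∧ lam v = a) ∧ w v) ∧ ((x'.dom v ∧ lam v = a) ∧ w v)) := by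
      refine cnt_congr fun v _ => ?_
      constructor
      · rintro ⟨⟨h6, h7⟩, h8, -⟩
        have h9 := (hd v).1 (by omega)
        have h10 := (hd' v).1 (by omega)
        have h11 := hr.val_eq v (hY v h9 h10) h9
        have h12 : lam v = a := by omega
        exact ⟨⟨⟨h9, h12⟩, h7⟩, ⟨h10, h12⟩, h7⟩
      · rintro ⟨⟨⟨h9, h12⟩, h7⟩, ⟨h10, -⟩, -⟩
        have h11 := hr.val_eq v (hY v h9 h10) h9
        have h13 := hr'.val_eq v (hY v h9 h10) h10
        exact ⟨⟨by omega, h7⟩, by omega, h7⟩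
    have h6 : cnt n (fun v => val (KSwO.union c q q') v = a ∧ w v) =
        cnt n (fun v => (val q v = a ∧ w v) ∨ (val q' v = a ∧ w v)) := by
      refine cnt_congr fun v _ => ?_
      rw [← or_and_right]
      refine and_congr_left fun _ => ?_
      rw [hc.val_union hs hs' hq hq']
      constructor
      · split_ifs <;> tauto
      · rintro (h | h)
        · rw [if_neg (by omega), h]
        · have := hr2 v (by omega)
          rw [hc.val_union hs hs' hq hq'] at this
          rw [this, h]
    have h7 : cnt n (fun v => ((x.dom v ∨ x'.dom v) ∧ lam v = a) ∧ w v) =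
        cnt n (fun v => ((x.dom v ∧ lam v = a) ∧ w v) ∨ ((x'.dom v ∧ lam v = a) ∧ w v)) :=
      cnt_congr fun v _ => by tauto
    omega
  refine ⟨mem_joins.2 ⟨q, hq, q', hq', hcompat, rfl⟩, ?_, ?_, ?_, ?_⟩
  · rintro v hv (h | h)
    · rw [hl v ((hd v).2 h), hr.val_eq v hv h]
    · rw [hr2 v ((hd' v).2 h), hr'.val_eq v hv h]
  · have h1 := hr.numOpen
    have h2 := hr'.numOpen
    rw [hc.numOpen_eq] at h1 h2 ⊢
    have h3 := hcount 1 (fun _ => True) (by simp) (by simpa using h1) (by simpa using h2)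
    simp only [and_true] at h3
    exact h3
  · have h1 := hr.numOut
    have h2 := hr'.numOut
    rw [hc.numOut_eq] at h1 h2 ⊢
    exact hcount c.top _ (by have := hc.top_gt; omega) h1 h2
  · rintro v hv (h | h)
    · exact hc.sat_mono hl (hr.sat v hv h)
    · exact hc.sat_mono hr2 (hr'.sat v hv h)

/-! #### Keys -/

theorem dedupe_spec (c : Ctx) (r : ℕ) (Yl : List ℕ) (T : List (List ℕ)) :
    (∀ q ∈ dedupe c r Yl T, q ∈ T) ∧ (∀ q ∈ T, ∃ q' ∈ dedupe c r Yl T,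
      key c r Yl q' = key c r Yl q) ∧ ((dedupe c r Yl T).map (key c r Yl)).Nodup := by
  unfold dedupe
  induction T using List.reverseRecOn with
  | nil => simp
  | append_singleton T x ih =>
    rw [List.foldl_append, List.foldl_cons, List.foldl_nil]
    generalize List.foldl _ [] T = A at ih ⊢
    obtain ⟨ih1, ih2, ih3⟩ := ih
    cases h : A.any fun q' => decide (key c r Yl q' = key c r Yl x) with
    | true =>
      simp only [cond_true]
      refine ⟨fun q hq => List.mem_append.2 (Or.inl (ih1 q hq)), fun q hq => ?_, ih3⟩
      rcases List.mem_append.1 hq with hq | hq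
      · exact ih2 q hq
      · rw [List.mem_singleton.1 hq]
        simpa using h
    | false =>
      simp only [cond_false]
      refine ⟨fun q hq => ?_, fun q hq => ?_, ?_⟩
      · rcases List.mem_cons.1 hq with rfl | hq
        · simp
        · exact List.mem_append.2 (Or.inl (ih1 q hq))
      · rcases List.mem_append.1 hq with hq | hq
        · obtain ⟨q', hq', h⟩ := ih2 q hq
          exact ⟨q', List.mem_cons_of_mem _ hq', h⟩
        · rw [List.mem_singleton.1 hq]
          exact ⟨x, by simp, rfl⟩
      · rw [List.map_cons, List.nodup_cons]
        refine ⟨?_, ih3⟩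
        simpa using h

theorem Represents.of_key {Yl : List ℕ} (hYl : ∀ v, Y v → v ∈ Yl)
    (hr : Represents c n r lam Y x q) (h : key c r Yl q' = key c r Yl q) :
    Represents c n r lam Y x q' := by
  simp only [key, Prod.mk.injEq] at h
  obtain ⟨h1, h2, h3⟩ := h
  have h4 : ∀ v, Y v → val q' v = val q v ∧ KSwO.sat c r q' v = KSwO.sat c r q v := by
    intro v hv
    simpa using List.map_inj_left.1 h1 v (hYl v hv)
  exact ⟨fun v hY hv => by rw [(h4 v hY).1, hr.val_eq v hY hv], h2.trans hr.numOpen,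
    h3.trans hr.numOut, fun v hY hv => by rw [(h4 v hY).2, hr.sat v hY hv]⟩

/-- Distinct rows have distinct keys, and a key consists of two counts up to `n` and, for each
listed vertex, a code up to `top` and a truth value. -/
theorem length_dedupe_le (hc : CtxOK c n m) (hs : x.Sound c n r) (Yl : List ℕ) :
    (dedupe c r Yl x.tab).length ≤
      (n + 1) * ((n + 1) * (2 * (c.top + 1)) ^ Yl.length) := by
  obtain ⟨h1, -, h3⟩ := dedupe_spec c r Yl x.tab
  -- The minima only serve to land in `Fin`; on sound rows they change nothing.
  let g : List ℕ → (Fin (n + 1)) × (Fin (n + 1)) × (Fin Yl.length → Bool × Fin (c.top + 1)) :=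
    fun q => (⟨min (numOpen c q) n, by omega⟩, ⟨min (numOut c q) n, by omega⟩,
      fun i => (sat c r q Yl[i], ⟨min (val q Yl[i]) c.top, by omega⟩))
  have hg : ∀ q ∈ x.tab, ∀ q' ∈ x.tab, g q = g q' → key c r Yl q = key c r Yl q' := by
    intro q hq q' hq' h
    simp only [g, Prod.mk.injEq, Fin.mk.injEq, hc.numOpen_eq, hc.numOut_eq, funext_iff] at h
    rw [min_eq_left (cnt_le _), min_eq_left (cnt_le _), min_eq_left (cnt_le _),
      min_eq_left (cnt_le _)] at h
    rw [key, key, hc.numOpen_eq, hc.numOut_eq, hc.numOpen_eq, hc.numOut_eq, h.1, h.2.1]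
    congr 1
    refine List.map_inj_left.2 fun v hv => ?_
    obtain ⟨i, hi, rfl⟩ := List.mem_iff_getElem.1 hv
    obtain ⟨h4, h5⟩ := h.2.2 ⟨i, hi⟩
    rw [min_eq_left (hs.le_top q hq _), min_eq_left (hs.le_top q' hq' _)] at h5
    exact Prod.ext h5 h4
  have hnd : ((dedupe c r Yl x.tab).map g).Nodup := by
    unfold List.Nodup at h3 ⊢
    rw [List.pairwise_map] at h3 ⊢
    refine List.Pairwise.imp_of_mem ?_ h3
    intro q q' hq hq' h h'
    exact h (hg q (h1 q hq) q' (h1 q' hq') h')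
  have := hnd.length_le_card
  simpa [Fintype.card_prod] using this

theorem CtxOK.val_clip (hc : CtxOK c n m) (hs : x.Sound c n r) (hq : q ∈ x.tab) :
    val (c.R.map fun v => min (val q v) c.top) = val q := by
  ext v
  rw [hc.R_eq, val_map_range]
  split_ifs with h
  · exact min_eq_left (hs.le_top q hq v)
  · by_contra h'
    exact h (hs.dom_lt v ((hs.dom_iff q hq v).1 (Ne.symm h')))

theorem Item.Sound.clip_dedupe (hc : CtxOK c n m) (hs : x.Sound c n r) (Yl : List ℕ) :
    Item.Sound c n r ⟨clip c (dedupe c r Yl x.tab), x.dom, x.int, x.may⟩ := by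
  refine hs.of_val fun q hq => ?_
  obtain ⟨q', hq', rfl⟩ := List.mem_map.1 hq
  have h1 := (dedupe_spec c r Yl x.tab).1 q' (List.mem_of_mem_take hq')
  exact ⟨q', h1, hc.val_clip hs h1⟩

/-- The row itself may be discarded, but a row with the same key stays and represents the labelling
just as well. The table is within the bound, so clipping removes no row. -/
theorem Represents.clip_dedupe (hc : CtxOK c n m) (hs : x.Sound c n r) {Yl : List ℕ}
    (hYl : ∀ v, Y v → v ∈ Yl)
    (hbd : (n + 1) * ((n + 1) * (2 * (c.top + 1)) ^ Yl.length) ≤ c.bd.length)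
    (hq : q ∈ x.tab) (hr : Represents c n r lam Y x q) :
    ∃ q' ∈ clip c (dedupe c r Yl x.tab), Represents c n r lam Y x q' := by
  obtain ⟨h1, h2, -⟩ := dedupe_spec c r Yl x.tab
  obtain ⟨q', hq', h⟩ := h2 q hq
  refine ⟨_, List.mem_map.2 ⟨q', ?_, rfl⟩, (hr.of_key hYl h).of_val (hc.val_clip hs (h1 q' hq'))⟩
  rwa [List.take_of_length_le ((length_dedupe_le hc hs Yl).trans hbd)]

theorem Represents.congr (hr : Represents c n r lam Y x q) (hd : ∀ v, x.dom v ↔ x'.dom v)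
    (hm : ∀ v, Y v → x'.may v → KSwO.sat c r q v = true) : Represents c n r lam Y x' q where
  val_eq v hY hv := hr.val_eq v hY ((hd v).2 hv)
  numOpen := hr.numOpen.trans (cnt_congr fun v _ => by rw [hd])
  numOut := hr.numOut.trans (cnt_congr fun v _ => by rw [hd])
  sat := hm

end

/-! ### Correctness of the dynamic program -/

/-- The union of several items, with a given table. -/
def Item.unionAll (x : Item) (xs : List Item) (T : List (List ℕ)) : Item :=
  ⟨T, fun v => x.dom v ∨ ∃ y ∈ xs, y.dom v, fun v => x.int v ∨ ∃ y ∈ xs, y.int v,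
    fun v => x.may v ∨ ∃ y ∈ xs, y.may v⟩

/-- A total labelling with admissible codes. -/
structure LabOK (c : Ctx) (n : ℕ) (lam : ℕ → ℕ) : Prop where
  pos : ∀ v < n, 0 < lam v
  le_top : ∀ v < n, lam v ≤ c.top
  sup : ∀ v < n, lam v = 1 → c.sup.getD v false = true

/-- The label of a vertex is accounted for by a vertex that it meets. -/
def MeetSat (c : Ctx) (r : ℕ) (lam : ℕ → ℕ) (f : ℕ) (pc : List ℕ × List ℕ) (v : ℕ) : Prop :=
  lam v = 1 ∨ lam v = c.top ∨ ∃ u, Meet c f pc u v ∧ 0 < lam u ∧ lam u < lam v ∧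
    ∃ d : ℕ, get2 c.dist u v ⊤ = d ∧ lam u * r + c.H * d ≤ lam v * r

/-- The item of a piece. -/
def pieceItem (c : Ctx) (r : ℕ) (lam : ℕ → ℕ) (f : ℕ) (pc : List ℕ × List ℕ) : Item :=
  ⟨treeRec (children c) (combine c r) [] f pc, fun v => inB c (pc.1 ++ pc.2) v = true,
    Interior c pc, fun v => inB c pc.2 v = true ∧ MeetSat c r lam f pc v⟩

/-- The item of a single vertex. -/
def singleItem (c : Ctx) (v : ℕ) : Item :=
  ⟨single c v, fun u => u = v, fun _ => False, fun _ => False⟩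

/-- The item without labelled vertices. -/
def emptyItem (c : Ctx) : Item :=
  ⟨[c.R.map fun _ => 0], fun _ => False, fun _ => False, fun _ => False⟩

section

variable {c : Ctx} {n m r f : ℕ} {lam : ℕ → ℕ} {Y : ℕ → Prop} {x : Item} {xs : List Item}
  {q : List ℕ} {u v : ℕ} {pc : List ℕ × List ℕ} {Yl : List ℕ}

theorem unionAll_cons (x y : Item) (xs : List Item) (T T' : List (List ℕ)) :
    x.unionAll (y :: xs) T = (x.union y T').unionAll xs T := by
  simp [Item.unionAll, Item.union, or_assoc]

theorem foldl_join_sound (hc : CtxOK c n m) (hx : x.Sound c n r) (hxs : ∀ y ∈ xs, y.Sound c n r) :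
    (x.unionAll xs ((xs.map Item.tab).foldl (fun T T' => join c r Yl T T') x.tab)).Sound c n r := by
  induction xs generalizing x with
  | nil => simpa [Item.unionAll] using hx
  | cons y xs ih =>
    rw [unionAll_cons _ _ _ _ (join c r Yl x.tab y.tab), List.map_cons, List.foldl_cons]
    exact ih (x := x.union y (join c r Yl x.tab y.tab))
      ((hx.joins hc (hxs y (by simp))).clip_dedupe hc Yl) fun z hz => hxs z (by simp [hz])

/-- The pairwise condition, that vertices shared by two items lie in `Y`, passes to unions, so the
joins can be made one after the other. -/
theorem foldl_join_rep (hc : CtxOK c n m) (hYl : ∀ v, Y v → v ∈ Yl)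
    (hbd : (n + 1) * ((n + 1) * (2 * (c.top + 1)) ^ Yl.length) ≤ c.bd.length)
    (hx : x.Sound c n r) (hxs : ∀ y ∈ xs, y.Sound c n r)
    (hY : (x :: xs).Pairwise fun y z => ∀ v, y.dom v → z.dom v → Y v)
    (hr : ∃ q ∈ x.tab, Represents c n r lam Y x q)
    (hrs : ∀ y ∈ xs, ∃ q ∈ y.tab, Represents c n r lam Y y q) :
    ∃ q ∈ (xs.map Item.tab).foldl (fun T T' => join c r Yl T T') x.tab,
      Represents c n r lam Y (x.unionAll xs
        ((xs.map Item.tab).foldl (fun T T' => join c r Yl T T') x.tab)) q := by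
  induction xs generalizing x with
  | nil => simpa [Item.unionAll] using hr
  | cons y xs ih =>
    rw [unionAll_cons _ _ _ _ (join c r Yl x.tab y.tab), List.map_cons, List.foldl_cons]
    obtain ⟨h1, h2⟩ := List.pairwise_cons.1 hY
    obtain ⟨h3, h4⟩ := List.pairwise_cons.1 h2
    have hy := hxs y (by simp)
    refine ih (x := x.union y (join c r Yl x.tab y.tab))
      ((hx.joins hc hy).clip_dedupe hc Yl) (fun z hz => hxs z (by simp [hz])) ?_ ?_
      (fun z hz => hrs z (by simp [hz]))
    · rw [List.pairwise_cons]
      refine ⟨fun z hz v hv hv' => ?_, h4⟩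
      rcases hv with hv | hv
      · exact h1 z (by simp [hz]) v hv hv'
      · exact h3 z hz v hv hv'
    · obtain ⟨q, hq, hqr⟩ := hr
      obtain ⟨q', hq', hqr'⟩ := hrs y (by simp)
      obtain ⟨h5, h6⟩ := Represents.joins (T := joins c x.tab y.tab) hc hx hy
        (h1 y (by simp)) hq hq' hqr hqr'
      obtain ⟨q'', h7, h8⟩ := h6.clip_dedupe hc (hx.joins hc hy) hYl hbd h5
      exact ⟨q'', h7, h8.congr (fun _ => Iff.rfl) h8.sat⟩

theorem emptyItem_sound (hc : CtxOK c n m) : (emptyItem c).Sound c n r := by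
  have h : ∀ v, val (c.R.map fun _ => 0) v = 0 := fun v => by
    rw [hc.R_eq, val_map_range]
    simp
  refine ⟨by simp [emptyItem], ?_, ?_, ?_, by simp [emptyItem]⟩ <;>
  · intro q hq v
    rw [List.mem_singleton.1 hq, h]
    simp [emptyItem]

theorem emptyItem_rep (hc : CtxOK c n m) :
    ∃ q ∈ (emptyItem c).tab, Represents c n r lam Y (emptyItem c) q := by
  have h : ∀ v, val (c.R.map fun _ => 0) v = 0 := fun v => by
    rw [hc.R_eq, val_map_range]
    simp
  have h1 := hc.top_gt
  have h2 : ¬ 0 = c.top := by omega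
  refine ⟨_, List.mem_singleton.2 rfl, by simp [emptyItem], ?_, ?_, by simp [emptyItem]⟩
  · rw [hc.numOpen_eq]
    refine cnt_congr fun v _ => ?_
    rw [h]
    simp [emptyItem]
  · rw [hc.numOut_eq]
    refine cnt_congr fun v _ => ?_
    rw [h]
    simp [emptyItem, h2]

theorem val_single_row (hc : CtxOK c n m) (hv : v < n) (l : ℕ) (u : ℕ) :
    val (c.R.map fun u => bif decide (u = v) then l else 0) u = if u = v then l else 0 := by
  rw [hc.R_eq, val_map_range]
  by_cases h : u = v
  · simp [h, hv]
  · simp [h]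

theorem singleItem_sound (hc : CtxOK c n m) (hv : v < n) : (singleItem c v).Sound c n r := by
  refine ⟨by simpa [singleItem] using hv, ?_, ?_, ?_, by simp [singleItem]⟩ <;>
  · intro q hq u
    obtain ⟨l, hl, rfl⟩ := List.mem_map.1 hq
    obtain ⟨h1, h2⟩ := List.mem_filter.1 hl
    obtain ⟨h3, h4⟩ := (hc.mem_codes l).1 h1
    rw [val_single_row hc hv]
    by_cases h : u = v
    · simp [h, singleItem] at h2 ⊢
      try omega
      try tauto
    · simp [h, singleItem]

theorem singleItem_rep (hc : CtxOK c n m) (hl : LabOK c n lam) (hv : v < n) :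
    ∃ q ∈ (singleItem c v).tab, Represents c n r lam Y (singleItem c v) q := by
  have h1 := hc.top_gt
  refine ⟨_, List.mem_map.2 ⟨lam v, List.mem_filter.2 ⟨?_, ?_⟩, rfl⟩, ?_, ?_, ?_, ?_⟩
  · exact (hc.mem_codes _).2 ⟨hl.pos v hv, hl.le_top v hv⟩
  · have := hl.sup v hv
    by_cases h : lam v = 1
    · rw [this h]; rfl
    · simp [h]
  · rintro u - rfl
    rw [val_single_row hc hv, if_pos rfl]
  · rw [hc.numOpen_eq]
    refine cnt_congr fun u _ => ?_
    rw [val_single_row hc hv]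
    by_cases h : u = v <;> simp [h, singleItem]
  · rw [hc.numOut_eq]
    refine cnt_congr fun u _ => ?_
    rw [val_single_row hc hv]
    have : ¬ 0 = c.top := by omega
    by_cases h : u = v <;> simp [h, singleItem, this]
  · simp [singleItem]

theorem CtxOK.mem_verts (hc : CtxOK c n m) {B : List ℕ} :
    v ∈ verts c B ↔ inB c B v = true := by
  rw [verts, List.mem_filter, hc.R_eq, List.mem_range]
  refine and_iff_right_of_imp fun h => ?_
  obtain ⟨b, -, hb⟩ := inB_iff.1 h
  exact hc.bag_vert b v hb

theorem PieceOK.interior_of_child (hc : TreeOK c m) (hp : PieceOK c m pc)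
    {q : List ℕ × List ℕ} (hq : q ∈ children c pc) (hv : Interior c q v) : Interior c pc v :=
  ⟨inB_mono (fun b hb => ((hp.child hc hq).2.2.1 b hb).1) hv.1,
    fun h => hp.not_interior hc hq (inB_append.2 (Or.inr h)) hv⟩

/-- The items that are joined for a piece. -/
def pieceItems (c : Ctx) (r : ℕ) (lam : ℕ → ℕ) (f : ℕ) (pc : List ℕ × List ℕ) : List Item :=
  (verts c (pick c pc ++ pc.2)).map (singleItem c) ++ (children c pc).map (pieceItem c r lam f)

theorem joinAll_eq (c : Ctx) (r : ℕ) (lam : ℕ → ℕ) (f : ℕ) (pc : List ℕ × List ℕ) :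
    joinAll c r (verts c (pick c pc ++ pc.2))
        ((children c pc).map (treeRec (children c) (combine c r) [] f)) =
      ((pieceItems c r lam f pc).map Item.tab).foldl
        (fun T T' => join c r (verts c (pick c pc ++ pc.2)) T T') (emptyItem c).tab := by
  unfold joinAll pieceItems
  rw [List.map_append, List.map_map, List.map_map]
  rfl

theorem dom_pieceItems (hc : CtxOK c n m) (hp : PieceOK c m pc) (T : List (List ℕ)) (v : ℕ) :
    ((emptyItem c).unionAll (pieceItems c r lam f pc) T).dom v ↔
      inB c (pc.1 ++ pc.2) v = true := by
  change False ∨ _ ↔ _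
  rw [false_or]
  constructor
  · rintro ⟨y, hy, hv⟩
    rcases List.mem_append.1 hy with hy | hy
    · obtain ⟨u, hu, rfl⟩ := List.mem_map.1 hy
      have hv : v = u := hv
      subst hv
      refine inB_mono ?_ (hc.mem_verts.1 hu)
      intro b hb
      rcases List.mem_append.1 hb with hb | hb
      · exact List.mem_append.2 (Or.inl (List.mem_filter.1 (List.mem_of_mem_take hb)).1)
      · exact List.mem_append.2 (Or.inr hb)
    · obtain ⟨q, hq, rfl⟩ := List.mem_map.1 hy
      obtain ⟨hpq, -, hsub, hB⟩ := hp.child hc.tree hq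
      refine inB_mono ?_ hv
      intro b hb
      rcases List.mem_append.1 hb with hb | hb
      · exact List.mem_append.2 (Or.inl (hsub b hb).1)
      · rcases List.mem_append.1 (hB b hb) with hb | hb
        · exact List.mem_append.2 (Or.inl (List.mem_filter.1 (List.mem_of_mem_take hb)).1)
        · exact List.mem_append.2 (Or.inr hb)
  · intro hv
    rcases hp.cases hc.tree hv with h | ⟨q, hq, h⟩
    · exact ⟨singleItem c v, List.mem_append.2 (Or.inl (List.mem_map.2
        ⟨v, hc.mem_verts.2 h, rfl⟩)), rfl⟩
    · exact ⟨_, List.mem_append.2 (Or.inr (List.mem_map.2 ⟨q, hq, rfl⟩)),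
        inB_append.2 (Or.inl h.1)⟩

/-- The item of the rows that are kept for a piece. -/
def keptItem (c : Ctx) (r : ℕ) (lam : ℕ → ℕ) (f : ℕ) (pc : List ℕ × List ℕ) : Item :=
  ⟨(joinAll c r (verts c (pick c pc ++ pc.2))
      ((children c pc).map (treeRec (children c) (combine c r) [] f))).filter fun q =>
      (verts c (pick c pc ++ pc.2)).all fun v => inB c pc.2 v || sat c r q v,
    fun v => inB c (pc.1 ++ pc.2) v = true, Interior c pc,
    fun v => inB c pc.2 v = true ∧ MeetSat c r lam (f + 1) pc v⟩

/-- An interior vertex of the piece is either seen at this stage, and then the filter checks its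
justification, or interior to a subpiece, whose rows already justify it. -/
theorem keptItem_sound (hc : CtxOK c n m) (hp : PieceOK c m pc)
    (hxs : ∀ y ∈ pieceItems c r lam f pc, y.Sound c n r) :
    (keptItem c r lam f pc).Sound c n r := by
  have h1 := foldl_join_sound (Yl := verts c (pick c pc ++ pc.2)) hc (emptyItem_sound hc) hxs
  rw [← joinAll_eq] at h1
  refine ⟨fun v hv => h1.dom_lt v ((dom_pieceItems hc hp _ v).2 hv), fun q hq v => ?_,
    fun q hq => h1.le_top q (List.mem_filter.1 hq).1,
    fun q hq => h1.sup q (List.mem_filter.1 hq).1, fun q hq v hv => ?_⟩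
  · rw [h1.dom_iff q (List.mem_filter.1 hq).1, dom_pieceItems hc hp]
    rfl
  · obtain ⟨h3, h4⟩ := List.mem_filter.1 hq
    rcases hp.cases hc.tree (inB_append.2 (Or.inl hv.1)) with h | ⟨q', hq', h⟩
    · have h5 := List.all_eq_true.1 h4 v (hc.mem_verts.2 h)
      have h6 : inB c pc.2 v = false := by simpa using hv.2
      simpa [h6] using h5
    · exact h1.int q h3 v (Or.inr ⟨_, List.mem_append.2 (Or.inr (List.mem_map.2
        ⟨q', hq', rfl⟩)), h⟩)

theorem pieceItem_sound (hc : CtxOK c n m) (hp : PieceOK c m pc) :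
    (pieceItem c r lam f pc).Sound c n r := by
  induction f generalizing pc with
  | zero =>
    refine ⟨fun v hv => ?_, ?_, ?_, ?_, ?_⟩
    · obtain ⟨b, -, hb⟩ := inB_iff.1 hv
      exact hc.bag_vert b v hb
    all_goals simp [pieceItem, treeRec]
  | succ f ih =>
    refine (keptItem_sound (lam := lam) (f := f) hc hp fun y hy => ?_).clip_dedupe hc
      (verts c pc.2)
    rcases List.mem_append.1 hy with hy | hy
    · obtain ⟨u, hu, rfl⟩ := List.mem_map.1 hy
      obtain ⟨b, -, hb⟩ := inB_iff.1 (hc.mem_verts.1 hu)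
      exact singleItem_sound hc (hc.bag_vert b u hb)
    · obtain ⟨q, hq, rfl⟩ := List.mem_map.1 hy
      exact ih (hp.child hc.tree hq).1

/-- Completeness of the dynamic program. The row found need not be the restriction of `lam`: inside
subpieces it may have been exchanged for another row with the same key. It agrees with `lam` on the
boundary bags, in both counts, and has at least the justifications that `lam` has by vertices met
inside the piece. -/
theorem pieceItem_rep (hc : CtxOK c n m) (hl : LabOK c n lam) (hp : PieceOK c m pc)
    (hf : depth pc < f) (hv : ∀ v, Interior c pc v → MeetSat c r lam f pc v) :
    ∃ q ∈ (pieceItem c r lam f pc).tab,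
      Represents c n r lam (fun v => inB c pc.2 v = true) (pieceItem c r lam f pc) q := by
  induction f generalizing pc with
  | zero => omega
  | succ f ih =>
    have hxs : ∀ y ∈ pieceItems c r lam f pc, y.Sound c n r := by
      intro y hy
      rcases List.mem_append.1 hy with hy | hy
      · obtain ⟨u, hu, rfl⟩ := List.mem_map.1 hy
        obtain ⟨b, -, hb⟩ := inB_iff.1 (hc.mem_verts.1 hu)
        exact singleItem_sound hc (hc.bag_vert b u hb)
      · obtain ⟨q, hq, rfl⟩ := List.mem_map.1 hy
        exact pieceItem_sound hc (hp.child hc.tree hq).1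
    have hrs : ∀ y ∈ pieceItems c r lam f pc, ∃ q ∈ y.tab, Represents c n r lam
        (fun v => inB c (pick c pc ++ pc.2) v = true) y q := by
      intro y hy
      rcases List.mem_append.1 hy with hy | hy
      · obtain ⟨u, hu, rfl⟩ := List.mem_map.1 hy
        obtain ⟨b, -, hb⟩ := inB_iff.1 (hc.mem_verts.1 hu)
        exact singleItem_rep hc hl (hc.bag_vert b u hb)
      · obtain ⟨q, hq, rfl⟩ := List.mem_map.1 hy
        obtain ⟨hpq, hd, -, hB⟩ := hp.child hc.tree hq
        -- Justifications of interior vertices of a subpiece come from inside that subpiece, as the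
        -- induction hypothesis requires.
        obtain ⟨row, hrow, h⟩ := ih hpq (by omega) fun v hvq => by
          rcases hv v (hp.interior_of_child hc.tree hq hvq) with h | h | ⟨u, h, h'⟩
          · exact Or.inl h
          · exact Or.inr (Or.inl h)
          · exact Or.inr (Or.inr ⟨u, h.child hc.tree hp hq hvq, h'⟩)
        refine ⟨row, hrow, ⟨fun v hv hdom => h.val_eq v ?_ hdom, h.numOpen, h.numOut,
          fun v _ hmay => h.sat v hmay.1 hmay⟩⟩
        rcases inB_append.1 hdom with h1 | h1
        · exact hp.inB_child hc.tree hq h1 hv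
        · exact h1
    have hpw : (emptyItem c :: pieceItems c r lam f pc).Pairwise fun y z =>
        ∀ v, y.dom v → z.dom v → inB c (pick c pc ++ pc.2) v = true := by
      rw [List.pairwise_cons]
      refine ⟨fun _ _ v hv => hv.elim, ?_⟩
      unfold pieceItems
      rw [List.pairwise_append]
      refine ⟨?_, ?_, ?_⟩
      · rw [List.pairwise_map]
        refine List.pairwise_of_forall_mem_list fun u hu u' _ v hvu _ => ?_
        have hvu : v = u := hvu
        exact hvu ▸ hc.mem_verts.1 hu
      -- A vertex of two subpieces that is in neither boundary would have all its bags inside the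
      -- first one, which is disjoint from the second.
      · rw [List.pairwise_map]
        refine List.Pairwise.imp_of_mem ?_ (children_pairwise hp)
        intro q q' hq hq' hdisj v hv1 hv2
        obtain ⟨hpq, -, -, hB⟩ := hp.child hc.tree hq
        obtain ⟨hpq', -, -, hB'⟩ := hp.child hc.tree hq'
        by_contra h
        have h1 : ¬ inB c q.2 v = true := fun h' => h (inB_mono hB h')
        have h2 : ¬ inB c q'.2 v = true := fun h' => h (inB_mono hB' h')
        have h3 := (inB_append.1 hv1).resolve_right h1
        obtain ⟨s, hs, hsv⟩ := inB_iff.1 ((inB_append.1 hv2).resolve_right h2)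
        exact hdisj s (hpq.mem_of_inBag hc.tree h3 h1 hsv) hs
      · intro y hy z _ v hv _
        obtain ⟨u, hu, rfl⟩ := List.mem_map.1 hy
        have hvu : v = u := hv
        exact hvu ▸ hc.mem_verts.1 hu
    have hlen : (pick c pc ++ pc.2).length ≤ 4 := by
      have h1 := length_pick_le c pc
      have h2 := hp.card
      rw [List.length_append]
      omega
    obtain ⟨q, hq, hqr⟩ := foldl_join_rep (Yl := verts c (pick c pc ++ pc.2)) hc
      (fun v => hc.mem_verts.2) (hc.bd_ge _ hlen) (emptyItem_sound hc) hxs hpw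
      (emptyItem_rep hc) hrs
    rw [← joinAll_eq] at hq hqr
    have hval : ∀ v, inB c (pick c pc ++ pc.2) v = true → val q v = lam v := fun v hv =>
      hqr.val_eq v hv (Or.inr ⟨singleItem c v, List.mem_append.2 (Or.inl (List.mem_map.2
        ⟨v, hc.mem_verts.2 hv, rfl⟩)), rfl⟩)
    -- A witness seen at this stage has its label from `lam` in the row. A witness met inside a
    -- subpiece may have lost its label, but the justification was recorded by the truth value in
    -- the key of the subpiece.
    have hsat : ∀ v, inB c (pick c pc ++ pc.2) v = true → MeetSat c r lam (f + 1) pc v →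
        sat c r q v = true := by
      intro v hv hm
      rcases hm with h | h | ⟨u, h, h1, h2, h3⟩
      · exact hc.sat_iff.2 (Or.inl ((hval v hv).trans h))
      · exact hc.sat_iff.2 (Or.inr (Or.inl ((hval v hv).trans h)))
      rcases h with h | ⟨q', hq', h⟩
      · have hu := hval u h.1
        obtain ⟨b, -, hb⟩ := inB_iff.1 h.1
        refine hc.sat_iff.2 (Or.inr (Or.inr ⟨u, hc.bag_vert b u hb, wit_iff.2 ?_⟩))
        rw [hu, hval v hv]
        exact ⟨h1, h2, h3⟩
      · obtain ⟨hpq, -, -, -⟩ := hp.child hc.tree hq'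
        have h4 : inB c q'.2 v = true := by
          rcases inB_append.1 (h.inB hc.tree hpq) with h5 | h5
          · exact hp.inB_child hc.tree hq' h5 hv
          · exact h5
        exact hqr.sat v hv (Or.inr ⟨_, List.mem_append.2 (Or.inr (List.mem_map.2
          ⟨q', hq', rfl⟩)), h4, Or.inr (Or.inr ⟨u, h, h1, h2, h3⟩)⟩)
    have hB : ∀ v, inB c pc.2 v = true → inB c (pick c pc ++ pc.2) v = true :=
      fun v hv => inB_append.2 (Or.inr hv)
    have hqf : q ∈ (keptItem c r lam f pc).tab := by
      refine List.mem_filter.2 ⟨hq, List.all_eq_true.2 fun v hv' => ?_⟩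
      rw [hc.mem_verts] at hv'
      rw [Bool.or_eq_true]
      by_cases h : inB c pc.2 v = true
      · exact Or.inl h
      · refine Or.inr (hsat v hv' (hv v ⟨?_, h⟩))
        refine inB_mono ?_ ((inB_append.1 hv').resolve_right h)
        exact fun b hb => (List.mem_filter.1 (List.mem_of_mem_take hb)).1
    have hqr' : Represents c n r lam (fun v => inB c pc.2 v = true) (keptItem c r lam f pc) q :=
      ⟨fun v hv _ => hval v (hB v hv),
        hqr.numOpen.trans (cnt_congr fun v _ => by rw [dom_pieceItems hc hp]; rfl),
        hqr.numOut.trans (cnt_congr fun v _ => by rw [dom_pieceItems hc hp]; rfl),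
        fun v hv hm => hsat v (hB v hv) hm.2⟩
    obtain ⟨q', hq', h⟩ := hqr'.clip_dedupe (Yl := verts c pc.2) hc (keptItem_sound hc hp hxs)
      (fun v => hc.mem_verts.2) (hc.bd_ge _ (by have := hp.card; omega)) hqf
    exact ⟨q', hq', h.congr (fun _ => Iff.rfl) h.sat⟩

end

/-! ### The guarantee of the algorithm -/

/-- The context comes from a graph with the edges `E`. -/
structure InputOK (c : Ctx) (n m : ℕ) (E : ℕ → ℕ → ℕ → Prop) : Prop extends CtxOK c n m where
  edge : EdgeOK c E
  cover : ∀ v < n, ∃ t, inBag c t v = true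
  dist_walk : ∀ u v (l : ℕ), get2 c.dist u v ⊤ = l → Walk E u v l
  walk_dist : ∀ u v (l : ℕ), u < n → Walk E u v l → get2 c.dist u v ⊤ ≤ l
  fuel : 2 * m.size ≤ c.fuel.length
  top_eq : c.top = c.H + (2 * (c.fuel.length + 1) + 1) + 2

/-- The label `a` can be certified by few hops to an opened supplier. -/
def Certified (c : Ctx) (E : ℕ → ℕ → ℕ → Prop) (r : ℕ) (S : ℕ → Prop) (v a : ℕ) : Prop :=
  ∃ s k e, S s ∧ Hops E (Meet c (c.fuel.length + 1) (List.range c.Q.length, [])) k e v s ∧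
    k ≤ 2 * (c.fuel.length + 1) + 1 ∧ e ≤ r ∧ a = k + c.H * e / r

open Classical in
/-- The labelling for a set of opened suppliers. -/
def labelling (c : Ctx) (E : ℕ → ℕ → ℕ → Prop) (r : ℕ) (S : ℕ → Prop) (v : ℕ) : ℕ :=
  if h : ∃ a, Certified c E r S v a then Nat.find h + 1 else c.top

section

variable {c : Ctx} {n m r k p : ℕ} {E : ℕ → ℕ → ℕ → Prop} {S O : ℕ → Prop} {q : List ℕ}
  {u v a l s : ℕ}

theorem InputOK.inB_root (hc : InputOK c n m E) (hv : v < n) :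
    inB c (List.range c.Q.length ++ []) v = true := by
  obtain ⟨t, ht⟩ := hc.cover v hv
  have := hc.tree.bag_lt t v ht
  exact inB_iff.2 ⟨t, by simpa [hc.tree.Q_eq] using this, ht⟩

theorem InputOK.interior_root (hc : InputOK c n m E) (hv : v < n) :
    Interior c (List.range c.Q.length, []) v :=
  ⟨by simpa using hc.inB_root hv, by simp [inB]⟩

theorem InputOK.depth_root (hc : InputOK c n m E) :
    depth (List.range c.Q.length, []) < c.fuel.length + 1 := by
  have := hc.fuel
  simp [depth, hc.tree.Q_eq]
  omega

theorem Certified.le (h : Certified c E r S v a) :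
    a ≤ 2 * (c.fuel.length + 1) + 1 + c.H := by
  obtain ⟨s, k, e, -, -, h1, h2, rfl⟩ := h
  have : c.H * e / r ≤ c.H := Nat.div_le_of_le_mul (by rw [mul_comm r]; gcongr)
  omega

/-- Certified values are at most `h + H`, with `h` the maximal number of hops; adding one still
stays below `top = H + h + 2`. -/
theorem labelling_lt (hc : InputOK c n m E) (h : Certified c E r S v a) :
    labelling c E r S v ≤ a + 1 ∧ labelling c E r S v < c.top := by
  classical
  have h1 : ∃ a, Certified c E r S v a := ⟨a, h⟩
  have h2 := Nat.find_min' h1 h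
  have h3 := h.le
  have h4 := hc.top_eq
  have h5 : labelling c E r S v = Nat.find h1 + 1 := dif_pos h1
  omega

theorem labelling_eq (h : labelling c E r S v ≠ c.top) :
    ∃ a, Certified c E r S v a ∧ labelling c E r S v = a + 1 := by
  classical
  by_cases h1 : ∃ a, Certified c E r S v a
  · exact ⟨Nat.find h1, Nat.find_spec h1, dif_pos h1⟩
  · exact absurd (dif_neg h1) h

theorem labelling_pos (hc : InputOK c n m E) : 0 < labelling c E r S v := by
  have := hc.top_gt
  by_cases h : labelling c E r S v = c.top
  · omega
  · obtain ⟨a, -, h⟩ := labelling_eq h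
    omega

theorem labelling_le (hc : InputOK c n m E) : labelling c E r S v ≤ c.top := by
  by_cases h : labelling c E r S v = c.top
  · exact h.le
  · obtain ⟨a, h, -⟩ := labelling_eq h
    exact (labelling_lt hc h).2.le

theorem Certified.of_mem (h : S v) : Certified c E r S v 0 :=
  ⟨v, 0, 0, h, .refl v, by omega, by omega, by simp⟩

/-- Label 1 means value 0, hence no hops, hence `v` itself is opened. Counting hops thus separates
suppliers from vertices at tiny distance. -/
theorem labelling_eq_one (hc : InputOK c n m E) : labelling c E r S v = 1 ↔ S v := by
  have h1 := hc.top_gt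
  constructor
  · intro h
    obtain ⟨a, ⟨s, k, e, hs, hk, -, -, h2⟩, h3⟩ := labelling_eq (c := c) (E := E) (r := r)
      (S := S) (v := v) (by omega)
    generalize c.H * e / r = x at h2
    have : k = 0 := by omega
    subst this
    cases hk
    exact hs
  · intro h
    have h2 := (labelling_lt (r := r) hc (.of_mem h)).1
    have h3 := labelling_pos (r := r) (S := S) (v := v) hc
    omega

theorem Certified.exists (hc : InputOK c n m E) (hS : S s) (hs : s < n) (hv : v < n)
    (h : Walk E v s l) (hl : l ≤ r) : ∃ a, Certified c E r S v a := by
  obtain ⟨k, hk, h1⟩ := exists_hops hc.tree hc.edge _ (PieceOK.root hc.tree) hc.depth_root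
    (hc.inB_root hv) (hc.inB_root hs) h
  exact ⟨_, s, k, l, hS, h1, hk, hl, rfl⟩

/-- Drop the first hop of a best certificate of `v`. The vertex `u` reached by it has a certificate
with one hop less, so its label is smaller, and the saved unit makes up for rounding down `c.H * e /
r`. -/
theorem labelling_meetSat (hc : InputOK c n m E) :
    MeetSat c r (labelling c E r S) (c.fuel.length + 1) (List.range c.Q.length, []) v := by
  by_cases h : labelling c E r S v = c.top
  · exact Or.inr (Or.inl h)
  obtain ⟨a, ⟨s, k, e, hs, hk, hkh, her, rfl⟩, h1⟩ := labelling_eq h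
  cases hk with
  | refl => exact Or.inl ((labelling_eq_one hc).2 hs)
  | @cons _ u _ k a l hvu ha hw =>
    have h2 : Certified c E r S u (k + c.H * l / r) :=
      ⟨s, k, l, hs, hw, by omega, by omega, rfl⟩
    have h3 := (labelling_lt hc h2).1
    have h4 : c.H * l / r ≤ c.H * (a + l) / r := Nat.div_le_div_right (by gcongr; omega)
    have hu : u < n := by
      obtain ⟨t, -, ht⟩ := inB_iff.1 (hvu.inB hc.tree (PieceOK.root hc.tree))
      exact hc.bag_vert t u ht
    have h5 := hc.walk_dist u v a hu (ha.symm hc.edge)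
    obtain ⟨d, hd⟩ := ENat.ne_top_iff_exists.1 (ne_top_of_le_ne_top (ENat.natCast_ne_top a) h5)
    refine Or.inr (Or.inr ⟨u, hvu.symm, labelling_pos hc, by omega, d, hd.symm, ?_⟩)
    have hda : d ≤ a := by rw [← hd] at h5; exact_mod_cast h5
    rw [h1]
    refine (Nat.add_le_add_right (Nat.mul_le_mul_right r h3) _).trans ?_
    have h6 : c.H * l / r * r ≤ c.H * l := Nat.div_mul_le_self _ _
    have h7 : c.H * (a + l) ≤ (c.H * (a + l) / r + 1) * r := by
      -- For `r = 0` the quotient is 0 by convention, but then the walk has length 0 as well.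
      rcases Nat.eq_zero_or_pos r with rfl | hr
      · have : a + l = 0 := by omega
        simp [this]
      · have := Nat.lt_div_mul_add (a := c.H * (a + l)) hr
        rw [add_mul, one_mul]
        omega
    have h8 : c.H * d ≤ c.H * a := by gcongr
    calc (k + c.H * l / r + 1) * r + c.H * d
        = (k + 1) * r + (c.H * l / r * r + c.H * d) := by ring
      _ ≤ (k + 1) * r + (c.H * l + c.H * a) := by gcongr
      _ = (k + 1) * r + c.H * (a + l) := by ring
      _ ≤ (k + 1) * r + (c.H * (a + l) / r + 1) * r := by gcongr
      _ = (k + 1 + c.H * (a + l) / r + 1) * r := by ring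

theorem cnt_mono {P Q : ℕ → Prop} (h : ∀ v, v < n → P v → Q v) : cnt n P ≤ cnt n Q := by
  classical
  unfold cnt
  refine Finset.card_le_card fun v hv => ?_
  simp only [Finset.mem_filter, Finset.mem_range] at hv ⊢
  exact ⟨hv.1, h v hv.1 hv.2⟩

/-- If some solution has radius `r`, then the table for `r` has a row that obeys the budgets. -/
theorem exists_mem_table (hc : InputOK c n m E) (hS : ∀ v, S v → v < n)
    (hsup : ∀ v, S v → c.sup.getD v false = true)
    (hr : ∀ v, v < n → c.cli.getD v false = true → ¬ O v → ∃ s l, S s ∧ Walk E v s l ∧ l ≤ r) :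
    ∃ q ∈ table c r, numOpen c q ≤ cnt n S ∧ numOut c q ≤ cnt n O := by
  have hl : LabOK c n (labelling c E r S) :=
    ⟨fun v _ => labelling_pos hc, fun v _ => labelling_le hc,
      fun v _ h => hsup v ((labelling_eq_one hc).1 h)⟩
  obtain ⟨q, hq, h⟩ := pieceItem_rep hc.toCtxOK hl (PieceOK.root hc.tree) hc.depth_root
    fun v _ => labelling_meetSat hc
  refine ⟨q, hq, h.numOpen.le.trans ?_, h.numOut.le.trans ?_⟩
  · exact cnt_mono fun v _ hv => (labelling_eq_one hc).1 hv.2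
  · refine cnt_mono fun v hv h => ?_
    by_contra hO
    obtain ⟨s, l, hs, hw, hl⟩ := hr v hv h.2 hO
    obtain ⟨a, ha⟩ := Certified.exists hc hs (hS s hs) hv hw hl
    exact (labelling_lt hc ha).2.ne h.1.2

theorem table_sound (hc : InputOK c n m E) (hq : q ∈ table c r) :
    (∀ v, val q v = 1 → c.sup.getD v false = true) ∧ (∀ v, val q v ≤ c.top) ∧
      ∀ v, v < n → val q v ≠ 0 ∧ sat c r q v = true := by
  -- Soundness does not involve the labelling, so any `lam` will do.
  have h := pieceItem_sound (r := r) (lam := fun _ => 0) (f := c.fuel.length + 1) hc.toCtxOK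
    (PieceOK.root hc.tree)
  refine ⟨h.sup q hq, h.le_top q hq, fun v hv => ⟨(h.dom_iff q hq v).2 (hc.inB_root hv),
    h.int q hq v (hc.interior_root hv)⟩⟩

/-- Follow the witnesses. Their codes strictly decrease, so the chain ends, and only at code 1; the
inequalities add up, the end contributing `r`. -/
theorem exists_walk_of_row (hc : InputOK c n m E) (hq : q ∈ table c r) (hv : v < n)
    (hvt : val q v ≠ c.top) :
    ∃ s l, s < n ∧ val q s = 1 ∧ Walk E s v l ∧ r + c.H * l ≤ val q v * r := by
  obtain ⟨-, hle, hsat⟩ := table_sound hc hq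
  induction h : val q v using Nat.strong_induction_on generalizing v with
  | _ a ih =>
    rcases hc.sat_iff.1 (hsat v hv).2 with h1 | h1 | ⟨u, hu, h1⟩
    · exact ⟨v, 0, hv, h1, .refl v, by rw [← h, h1]; simp⟩
    · exact absurd h1 hvt
    · obtain ⟨h2, h3, d, hd, h4⟩ := wit_iff.1 h1
      have h5 := hle v
      obtain ⟨s, l, hs, hs1, hw, h6⟩ := ih (val q u) (h ▸ h3) hu (by omega) rfl
      refine ⟨s, l + d, hs, hs1, hw.trans (hc.dist_walk u v d hd), ?_⟩
      rw [← h, mul_add]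
      omega

/-- Every served vertex is close to an opened supplier. -/
theorem exists_walk_le_of_row (hc : InputOK c n m E) {K : ℕ}
    (hH : c.H = (2 * (c.fuel.length + 1) + 1) * K) (hq : q ∈ table c r) (hv : v < n)
    (hvt : val q v ≠ c.top) :
    ∃ s l, s < n ∧ val q s = 1 ∧ Walk E s v l ∧ K * l ≤ (K + 1) * r := by
  obtain ⟨s, l, hs, h1, hw, h2⟩ := exists_walk_of_row hc hq hv hvt
  refine ⟨s, l, hs, h1, hw, ?_⟩
  have h3 := (table_sound hc hq).2.1 v
  have h4 := hc.top_eq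
  have h5 : val q v ≤ c.H + (2 * (c.fuel.length + 1) + 1) + 1 := by omega
  have h6 := h2.trans (Nat.mul_le_mul_right r h5)
  rw [hH] at h6
  obtain ⟨h, hh⟩ : ∃ h, h = 2 * (c.fuel.length + 1) + 1 := ⟨_, rfl⟩
  rw [add_assoc, ← hh] at h6
  refine Nat.le_of_mul_le_mul_left (c := h) ?_ (by omega)
  have h7 : (h * K + (h + 1)) * r = r + h * ((K + 1) * r) := by ring
  rw [h7, mul_assoc] at h6
  exact Nat.le_of_add_le_add_left h6

/-! ### The smallest successful guess -/

theorem mem_results {x : ℕ × List ℕ} (hx : x ∈ results c k p) :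
    x.2 ∈ table c x.1 ∧ numOpen c x.2 ≤ k ∧ numOut c x.2 ≤ p := by
  obtain ⟨r, -, hx⟩ := List.mem_flatMap.1 hx
  obtain ⟨q, hq, rfl⟩ := List.mem_map.1 hx
  have h := List.mem_filter.1 (List.mem_of_mem_take hq)
  simpa using h

theorem exists_mem_results (hr : r ∈ radii c) (hq : q ∈ table c r) (h1 : numOpen c q ≤ k)
    (h2 : numOut c q ≤ p) : ∃ x ∈ results c k p, x.1 = r := by
  have h : q ∈ (table c r).filter fun q =>
      decide (numOpen c q ≤ k) && decide (numOut c q ≤ p) := by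
    simp [hq, h1, h2]
  cases hf : (table c r).filter fun q =>
      decide (numOpen c q ≤ k) && decide (numOut c q ≤ p) with
  | nil => rw [hf] at h; simp at h
  | cons q' l =>
    refine ⟨(r, q'), List.mem_flatMap.2 ⟨r, hr, ?_⟩, rfl⟩
    rw [hf]
    simp

theorem best_eq (c : Ctx) (k p : ℕ) :
    (results c k p = [] ∧ best c k p = c.R.map fun _ => 0) ∨
      ∃ r, (r, best c k p) ∈ results c k p ∧ ∀ x ∈ results c k p, r ≤ x.1 := by
  unfold best
  cases hf : (results c k p).filter fun x =>
      (results c k p).all fun y => decide (x.1 ≤ y.1) with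
  | nil =>
    refine Or.inl ⟨?_, by simp⟩
    by_contra hne
    obtain ⟨x, hx⟩ := List.exists_mem_of_ne_nil _ hne
    obtain ⟨y, hy, hmin⟩ := (results c k p).toFinset.exists_min_image (fun x => x.1)
      ⟨x, by simpa⟩
    have : y ∈ (results c k p).filter fun x =>
        (results c k p).all fun y => decide (x.1 ≤ y.1) := by
      rw [List.mem_filter, List.all_eq_true]
      exact ⟨by simpa using hy, fun z hz => decide_eq_true (hmin z (by simpa using hz))⟩
    rw [hf] at this
    simp at this
  | cons x l =>
    have h1 : x ∈ (results c k p).filter fun x =>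
        (results c k p).all fun y => decide (x.1 ≤ y.1) := by rw [hf]; simp
    obtain ⟨h2, h3⟩ := List.mem_filter.1 h1
    exact Or.inr ⟨x.1, h2, fun y hy => of_decide_eq_true (List.all_eq_true.1 h3 y hy)⟩

/-- If no guess succeeds, the zero row is used. It opens nothing and, since `0 ≠ c.top`, declares no
outliers, so it is feasible for all budgets. -/
theorem best_feasible (hc : InputOK c n m E) : numOpen c (best c k p) ≤ k ∧
    numOut c (best c k p) ≤ p ∧ ∀ v, val (best c k p) v = 1 → c.sup.getD v false = true := by
  rcases best_eq c k p with ⟨-, h⟩ | ⟨r, h, -⟩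
  · have h0 : ∀ v, val (best c k p) v = 0 := fun v => by
      rw [h, hc.R_eq, val_map_range]
      simp
    have h1 := hc.top_gt
    have h2 : ¬ 0 = c.top := by omega
    refine ⟨?_, ?_, ?_⟩
    · simp [hc.numOpen_eq, h0, cnt]
    · simp [hc.numOut_eq, h0, cnt, h2]
    · simp [h0]
  · obtain ⟨h1, h2, h3⟩ := mem_results h
    exact ⟨h2, h3, (table_sound hc h1).1⟩

theorem best_mem_table (hc : InputOK c n m E) (hr : r ∈ radii c) (hS : ∀ v, S v → v < n)
    (hsup : ∀ v, S v → c.sup.getD v false = true) (hk : cnt n S ≤ k) (hp : cnt n O ≤ p)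
    (h : ∀ v, v < n → c.cli.getD v false = true → ¬ O v → ∃ s l, S s ∧ Walk E v s l ∧ l ≤ r) :
    ∃ r' ≤ r, best c k p ∈ table c r' := by
  obtain ⟨q, hq, h1, h2⟩ := exists_mem_table hc hS hsup h
  obtain ⟨x, hx, hxr⟩ := exists_mem_results hr hq (h1.trans hk) (h2.trans hp)
  rcases best_eq c k p with ⟨h3, -⟩ | ⟨r', h3, h4⟩
  · rw [h3] at hx
    simp at hx
  · exact ⟨r', hxr ▸ h4 x hx, (mem_results h3).1⟩

theorem mem_radii (h : get2 c.dist u v ⊤ = (l : ℕ∞)) : l ∈ radii c := by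
  rcases get2_mem_or c.dist u v ⊤ with ⟨row, hrow, hx⟩ | h'
  · refine List.mem_cons_of_mem _ (List.mem_flatMap.2 ⟨row, hrow, List.mem_flatMap.2
      ⟨_, hx, (mem_finList).2 h⟩⟩)
  · rw [h] at h'
    simp at h'

end

/-! ### The encoded input -/

open Classical in
/-- The decoded form of an input. -/
def rawInput (I : Instance) (T : TreeDecomposition I.graph) (ε : ℚ) : Raw :=
  ((List.ofFn fun u => List.ofFn fun v => if I.graph.Adj u v then
      Entry.len (I.len s(u, v)).num.natAbs (I.len s(u, v)).den else Entry.none,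
    List.ofFn fun v => decide (v ∈ I.suppliers), List.ofFn fun v => decide (v ∈ I.clients),
    I.k, I.p, ()),
   (List.ofFn fun s => List.ofFn fun t => decide (T.tree.Adj s t),
    List.ofFn fun t => List.ofFn fun v => decide (v ∈ T.bag t)),
   (ε.num.natAbs, ε.den), ())

theorem enc_list_ofFn {α : Type} [Enc α] {n : ℕ} (f : Fin n → α) :
    enc (List.ofFn f) = encFun fun i => enc (f i) := by
  change encList _ = encList _
  rw [List.map_ofFn]
  rfl

theorem enc_rawInput (I : Instance) (T : TreeDecomposition I.graph) (ε : ℚ) :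
    enc (rawInput I T ε) = encInput I T ε := by
  classical
  have h1 : ∀ (u v : Fin I.n), enc (if I.graph.Adj u v then
      Entry.len (I.len s(u, v)).num.natAbs (I.len s(u, v)).den else Entry.none) =
      if I.graph.Adj u v then encRat (I.len s(u, v)) else .nil := by
    intro u v
    split_ifs <;> rfl
  have h2 : ∀ b : Bool, enc b = encBool b := fun _ => rfl
  have h3 : ∀ {α β : Type} [Enc α] [Enc β] (a : α) (b : β), enc (a, b) = .cons (enc a) (enc b) :=
    fun _ _ => rfl
  simp only [rawInput, h3, enc_list_ofFn, h1, h2]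
  rfl

theorem sz_list_eq {α : Type} [Enc α] (h : ∀ a : α, sz a = (enc a).size) (l : List α) :
    sz l = (enc l).size := by
  induction l with
  | nil => rfl
  | cons a l ih =>
    rw [sz_cons, h, ih]
    rfl

/-- Without padding the measure is exactly the size of the tree, so bounds in it are bounds in `N`.
-/
theorem sz_raw_eq (w : Raw) : sz w = (enc w).size := by
  have hb : ∀ b : Bool, sz b = (enc b).size := fun _ => rfl
  have hn : ∀ b : ℕ, sz b = (enc b).size := fun _ => rfl
  have he : ∀ e : Entry, sz e = (enc e).size := fun e => by cases e <;> rfl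
  have hp : ∀ {α β : Type} [Enc α] [Enc β] (a : α) (b : β),
      (enc (a, b)).size = (enc a).size + (enc b).size + 1 := fun _ _ => rfl
  obtain ⟨⟨a, b, c, d, e, f⟩, ⟨g, h⟩, ⟨i, j⟩, k⟩ := w
  simp only [sz_pair, hp, sz_list_eq (sz_list_eq he), sz_list_eq hb, hn,
    sz_list_eq (sz_list_eq hb)]
  rfl

theorem get2_ofFn {δ : Type} {a b : ℕ} (f : Fin a → Fin b → δ) (u v : ℕ) (d : δ) :
    get2 (List.ofFn fun i => List.ofFn fun j => f i j) u v d =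
      if h : u < a ∧ v < b then f ⟨u, h.1⟩ ⟨v, h.2⟩ else d := by
  unfold get2
  by_cases hu : u < a <;> by_cases hv : v < b <;> simp [hu, hv]

theorem getD_ofFn {δ : Type} {a : ℕ} (f : Fin a → δ) (u : ℕ) (d : δ) :
    (List.ofFn f).getD u d = if h : u < a then f ⟨u, h⟩ else d := by
  by_cases hu : u < a <;> simp [hu]

/-! #### The size of the largest bag and the precision -/

theorem foldl_longest (rows : List (List Bool)) :
    let res := rows.foldl (fun s row => bif decide ((row.filter fun b => b).length ≤ s.length)
      then s else row.filter fun b => b) []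
    (∀ row ∈ rows, (row.filter fun b => b).length ≤ res.length) ∧
      (res.length = 0 ∨ ∃ row ∈ rows, res.length = (row.filter fun b => b).length) := by
  induction rows using List.reverseRecOn with
  | nil => simp
  | append_singleton rows x ih =>
    rw [List.foldl_append, List.foldl_cons, List.foldl_nil]
    generalize List.foldl _ [] rows = s at ih ⊢
    obtain ⟨h1, h2⟩ := ih
    cases h : decide ((x.filter fun b => b).length ≤ s.length) with
    | true =>
      simp only [decide_eq_true_iff] at h
      refine ⟨fun row hrow => ?_, h2.imp id ?_⟩
      · rcases List.mem_append.1 hrow with hr | hr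
        · exact h1 row hr
        · rw [List.mem_singleton.1 hr]
          exact h
      · rintro ⟨row, hr, h⟩
        exact ⟨row, by simp [hr], h⟩
    | false =>
      simp only [decide_eq_false_iff_not] at h
      refine ⟨fun row hrow => ?_, Or.inr ⟨x, by simp, rfl⟩⟩
      rcases List.mem_append.1 hrow with hr | hr
      · exact (h1 row hr).trans (by simp only [cond_false]; omega)
      · rw [List.mem_singleton.1 hr]
        rfl

theorem length_filter_ofFn {n : ℕ} (s : Finset (Fin n)) :
    ((List.ofFn fun v => decide (v ∈ s)).filter fun b => b).length = s.card := by
  rw [List.ofFn_eq_map, List.filter_map, List.length_map]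
  rw [← List.toFinset_card_of_nodup ((List.nodup_finRange n).filter _)]
  congr 1
  ext v
  simp

theorem length_maxBag (I : Instance) (T : TreeDecomposition I.graph) (ε : ℚ) :
    (maxBag (rawInput I T ε)).length = Finset.univ.sup fun t : Fin T.m => (T.bag t).card := by
  obtain ⟨h1, h2⟩ := foldl_longest (rawInput I T ε).2.1.2
  change (∀ row ∈ _, _ ≤ (maxBag (rawInput I T ε)).length) at h1
  change (maxBag (rawInput I T ε)).length = 0 ∨ ∃ row ∈ _, (maxBag (rawInput I T ε)).length = _
    at h2
  simp only [rawInput, List.mem_ofFn, forall_exists_index,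
    forall_apply_eq_imp_iff, length_filter_ofFn, exists_exists_eq_and] at h1 h2
  refine le_antisymm ?_ (Finset.sup_le fun t _ => h1 t)
  rcases h2 with h2 | ⟨t, h2⟩
  · exact h2.le.trans (Nat.zero_le _)
  · exact h2.le.trans (Finset.le_sup (f := fun t : Fin T.m => (T.bag t).card) (Finset.mem_univ t))

/-- For `ε = a / b` the factor is doubled until its product with `a` reaches `b`. The last doubling
overshoots by less than a factor 2, and as many doublings as `b` has bits suffice if `a` is
positive. -/
theorem doubleStep_spec {δ : Type} (a b : ℕ) (l : List δ) :
    let s := l.foldl (fun s _ => doubleStep b s) ([()], a)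
    s.2 = s.1.length * a ∧ 0 < s.1.length ∧ (s.1.length = 1 ∨ s.1.length * a < 2 * b) ∧
      (b ≤ s.2 ∨ s.1.length = 2 ^ l.length) := by
  induction l using List.reverseRecOn with
  | nil => simp
  | append_singleton l x ih =>
    rw [List.foldl_append, List.foldl_cons, List.foldl_nil]
    generalize l.foldl (fun s _ => doubleStep b s) ([()], a) = s at ih ⊢
    obtain ⟨h1, h2, h3, h4⟩ := ih
    unfold doubleStep
    by_cases h : b ≤ s.2
    · simp only [h, decide_true, cond_true]
      exact ⟨h1, h2, h3, Or.inl trivial⟩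
    · simp only [h, decide_false, cond_false, List.length_append, List.length_singleton]
      have h5 := h4.resolve_left h
      refine ⟨by rw [h1]; ring, by omega, Or.inr ?_, Or.inr (by rw [h5, pow_succ]; ring)⟩
      rw [add_mul, ← h1]
      omega

theorem length_invEps_pos (w : Raw) : 0 < (invEps w).length :=
  (doubleStep_spec w.2.2.1.1 w.2.2.1.2 _).2.1

theorem length_invEps_le (w : Raw) :
    (invEps w).length = 1 ∨ (invEps w).length * w.2.2.1.1 < 2 * w.2.2.1.2 :=
  (doubleStep_spec w.2.2.1.1 w.2.2.1.2 _).2.2.1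

theorem length_invEps_eq (w : Raw) (h : (maxBag w).length ≤ 1) : (invEps w).length = 1 := by
  simp [invEps, h]

theorem le_length_invEps (w : Raw) (ha : 0 < w.2.2.1.1)
    (h : ¬ (maxBag w).length ≤ 1) : w.2.2.1.2 ≤ (invEps w).length * w.2.2.1.1 := by
  obtain ⟨h1, h2, h3, h4⟩ := doubleStep_spec w.2.2.1.1 w.2.2.1.2 w.2.2.1.2.bits
  have h5 : (invEps w).length =
      (w.2.2.1.2.bits.foldl (fun s _ => doubleStep w.2.2.1.2 s) ([()], w.2.2.1.1)).1.length := by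
    simp [invEps, h]
  rw [h5]
  rcases h4 with h4 | h4
  · rwa [← h1]
  · rw [h4, Nat.size_eq_bits_len]
    exact (Nat.lt_size_self _).le.trans (Nat.le_mul_of_pos_right _ ha)

/-! ### The context of an input is valid -/

/-- The scaled edges of an instance. -/
def edgeRel (I : Instance) (w : Raw) (u v l : ℕ) : Prop :=
  ∃ a b : Fin I.n, a.1 = u ∧ b.1 = v ∧ I.graph.Adj a b ∧ l = scaledLen w u v

/-- The common multiple of the denominators of all edge lengths. -/
def commonDen (w : Raw) : ℕ := ((pairs w).map fun p => (ent w p.1 p.2).toPair.2).prod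

/-- Leaving out one factor replaces a division: this is how a length is multiplied by the common
denominator within the integers. -/
theorem prod_split {α : Type} [DecidableEq α] (l : List α) (hl : l.Nodup) (a : α) (ha : a ∈ l)
    (f : α → ℕ) : (l.map f).prod = f a * ((l.filter fun p => !decide (p = a)).map f).prod := by
  induction l with
  | nil => simp at ha
  | cons b l ih =>
    rw [List.nodup_cons] at hl
    rcases List.mem_cons.1 ha with rfl | ha
    · have : l.filter (fun p => !decide (p = a)) = l := by
        rw [List.filter_eq_self]
        rintro p hp
        have : p ≠ a := by rintro rfl; exact hl.1 hp
        simpa using this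
      simp [this]
    · have hb : b ≠ a := by rintro rfl; exact hl.1 ha
      simp only [List.map_cons, List.prod_cons, ih hl.2 ha, hb, decide_false, Bool.not_false,
        List.filter_cons_of_pos]
      ring

theorem cnt_fin {n : ℕ} (s : Finset (Fin n)) :
    cnt n (fun v => ∃ hv : v < n, (⟨v, hv⟩ : Fin n) ∈ s) = s.card := by
  classical
  unfold cnt
  rw [← Finset.card_map Fin.valEmbedding]
  congr 1
  ext v
  simp only [Finset.mem_filter, Finset.mem_range, Finset.mem_map, Fin.valEmbedding_apply]
  constructor
  · rintro ⟨-, hv, h⟩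
    exact ⟨_, h, rfl⟩
  · rintro ⟨a, h, rfl⟩
    exact ⟨a.2, a.2, h⟩

section

variable (I : Instance) (T : TreeDecomposition I.graph) (ε : ℚ)

theorem ent_rawInput (a b : Fin I.n) [Decidable (I.graph.Adj a b)] :
    ent (rawInput I T ε) a b = if I.graph.Adj a b then
      Entry.len (I.len s(a, b)).num.natAbs (I.len s(a, b)).den else Entry.none := by
  classical
  unfold ent rawInput
  simp only [get2_ofFn]
  rw [dif_pos ⟨a.2, b.2⟩]
  congr

theorem rawR_rawInput : rawR (rawInput I T ε) = List.range I.n := by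
  simp [rawR, rawInput]

theorem rawQ_rawInput : rawQ (rawInput I T ε) = List.range T.m := by
  simp [rawQ, rawInput]

theorem commonDen_pos : 0 < commonDen (rawInput I T ε) := by
  classical
  unfold commonDen
  refine List.prod_pos fun x hx => ?_
  simp only [List.mem_map, pairs, rawR_rawInput, List.mem_flatMap, List.mem_range] at hx
  obtain ⟨_, ⟨u, hu, v, hv, rfl⟩, rfl⟩ := hx
  have := ent_rawInput I T ε ⟨u, hu⟩ ⟨v, hv⟩
  simp only at this
  rw [this]
  split_ifs
  · exact Rat.den_pos _
  · exact Nat.one_pos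

theorem scaledLen_eq (a b : Fin I.n) (h : I.graph.Adj a b) :
    (scaledLen (rawInput I T ε) a b : ℚ) = I.len s(a, b) * commonDen (rawInput I T ε) := by
  classical
  have hnd : (pairs (rawInput I T ε)).Nodup := by
    unfold pairs
    exact List.nodup_range.product List.nodup_range
  have hmem : ((a : ℕ), (b : ℕ)) ∈ pairs (rawInput I T ε) := by
    simp [pairs, rawR_rawInput]
  unfold scaledLen commonDen
  rw [prod_split _ hnd _ hmem]
  simp only [ent_rawInput, if_pos h, Entry.toPair]
  have hpos := I.len_pos s(a, b) h
  have h1 : ((I.len s(a, b)).num.natAbs : ℚ) = (I.len s(a, b)).num := by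
    rw [← Int.cast_natCast, Int.natAbs_of_nonneg (Rat.num_nonneg.2 hpos.le)]
  push_cast
  rw [h1, ← mul_assoc, Rat.mul_den_eq_num]

theorem adjT_inputCtx {s t : ℕ} : adjT (inputCtx (rawInput I T ε)) s t = true ↔
    ∃ (hs : s < T.m) (ht : t < T.m), T.tree.Adj ⟨s, hs⟩ ⟨t, ht⟩ := by
  change get2 (rawInput I T ε).2.1.1 s t false = true ↔ _
  simp only [rawInput, get2_ofFn]
  split_ifs with h
  · simp [h]
  · simp only [false_iff]
    rintro ⟨hs, ht, -⟩
    exact h ⟨hs, ht⟩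

theorem inBag_inputCtx {t v : ℕ} : inBag (inputCtx (rawInput I T ε)) t v = true ↔
    ∃ (ht : t < T.m) (hv : v < I.n), (⟨v, hv⟩ : Fin I.n) ∈ T.bag ⟨t, ht⟩ := by
  change get2 (rawInput I T ε).2.1.2 t v false = true ↔ _
  simp only [rawInput, get2_ofFn]
  split_ifs with h
  · simp [h]
  · simp only [false_iff]
    rintro ⟨hs, ht, -⟩
    exact h ⟨hs, ht⟩

theorem treeOK_inputCtx : TreeOK (inputCtx (rawInput I T ε)) T.m where
  Q_eq := rawQ_rawInput I T ε
  symm s t h := by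
    rw [adjT_inputCtx] at h ⊢
    obtain ⟨hs, ht, h⟩ := h
    exact ⟨ht, hs, h.symm⟩
  bridge s t h hst := by
    obtain ⟨hs, ht, h⟩ := (adjT_inputCtx I T ε).1 h
    have hb := SimpleGraph.isAcyclic_iff_forall_adj_isBridge.1 T.isTree.isAcyclic h
    rw [SimpleGraph.isBridge_iff] at hb
    apply hb
    have key : ∀ x, Relation.ReflTransGen
        (fun a b => adjT (inputCtx (rawInput I T ε)) a b = true ∧ ¬(a = s ∧ b = t) ∧
          ¬(a = t ∧ b = s)) s x → ∃ hx : x < T.m,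
        (T.tree.deleteEdges {s(⟨s, hs⟩, ⟨t, ht⟩)}).Reachable ⟨s, hs⟩ ⟨x, hx⟩ := by
      intro x hx
      induction hx with
      | refl => exact ⟨hs, .refl _⟩
      | @tail a b _ hab ih =>
        obtain ⟨ha, h1⟩ := ih
        obtain ⟨_, hb, h2⟩ := (adjT_inputCtx I T ε).1 hab.1
        refine ⟨hb, h1.trans (SimpleGraph.Adj.reachable ?_)⟩
        rw [SimpleGraph.deleteEdges_adj]
        refine ⟨h2, fun h4 => ?_⟩
        simp only [Set.mem_singleton_iff, Sym2.eq_iff, Fin.mk.injEq] at h4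
        tauto
    obtain ⟨_, h'⟩ := key t hst
    exact h'
  conn s t hs ht := by
    obtain ⟨w⟩ := T.isTree.connected ⟨s, hs⟩ ⟨t, ht⟩
    have key : ∀ (a b : Fin T.m) (w : T.tree.Walk a b),
        Conn (inputCtx (rawInput I T ε)) (fun x => x < T.m) a b := by
      intro a b w
      induction w with
      | nil => exact .refl
      | @cons a b c h _ ih =>
        exact .head ⟨a.2, b.2, (adjT_inputCtx I T ε).2 ⟨a.2, b.2, h⟩⟩ ih
    exact key _ _ w
  adj_lt s t h := by
    obtain ⟨hs, -⟩ := (adjT_inputCtx I T ε).1 h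
    exact hs
  bag_lt t v h := by
    obtain ⟨ht, -⟩ := (inBag_inputCtx I T ε).1 h
    exact ht
  bag_conn v s t hs ht := by
    obtain ⟨hs', hv, hs⟩ := (inBag_inputCtx I T ε).1 hs
    obtain ⟨ht', _, ht'v⟩ := (inBag_inputCtx I T ε).1 ht
    obtain ⟨w⟩ := (T.connected ⟨v, hv⟩).preconnected ⟨⟨s, hs'⟩, hs⟩ ⟨⟨t, ht'⟩, ht'v⟩
    have key : ∀ (a b : {t : Fin T.m | (⟨v, hv⟩ : Fin I.n) ∈ T.bag t})
        (w : (T.tree.induce {t : Fin T.m | (⟨v, hv⟩ : Fin I.n) ∈ T.bag t}).Walk a b),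
        Conn (inputCtx (rawInput I T ε))
          (fun x => inBag (inputCtx (rawInput I T ε)) x v = true) a.1 b.1 := by
      intro a b w
      induction w with
      | nil => exact .refl
      | @cons a b c h _ ih =>
        exact .head ⟨(inBag_inputCtx I T ε).2 ⟨a.1.2, hv, a.2⟩,
          (inBag_inputCtx I T ε).2 ⟨b.1.2, hv, b.2⟩,
          (adjT_inputCtx I T ε).2 ⟨a.1.2, b.1.2, h⟩⟩ ih
    exact key _ _ w

theorem length_verts_le (B : List ℕ) : (verts (inputCtx (rawInput I T ε)) B).length ≤
    B.length * (maxBag (rawInput I T ε)).length := by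
  classical
  have h0 : (inputCtx (rawInput I T ε)).R = List.range I.n := rawR_rawInput I T ε
  induction B with
  | nil => simp [verts, inB]
  | cons b B ih =>
    have h1 : (verts (inputCtx (rawInput I T ε)) (b :: B)).length ≤
        (verts (inputCtx (rawInput I T ε)) [b]).length +
          (verts (inputCtx (rawInput I T ε)) B).length := by
      unfold verts
      rw [h0, length_filter_range, length_filter_range, length_filter_range]
      refine le_trans ?_ ((cnt_or _ _).le)
      refine le_trans (cnt_mono fun v _ hv => ?_) (Nat.le_add_right _ _)
      simpa [inB] using hv
    have h2 : (verts (inputCtx (rawInput I T ε)) [b]).length ≤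
        (maxBag (rawInput I T ε)).length := by
      unfold verts
      rw [h0, length_filter_range, length_maxBag]
      by_cases hb : b < T.m
      · refine le_trans ?_ (Finset.le_sup (f := fun t : Fin T.m => (T.bag t).card)
          (Finset.mem_univ ⟨b, hb⟩))
        rw [← cnt_fin]
        refine cnt_mono fun v _ hv => ?_
        obtain ⟨t, ht, htv⟩ := inB_iff.1 hv
        rw [List.mem_singleton.1 ht] at htv
        obtain ⟨hb', hv', h⟩ := (inBag_inputCtx I T ε).1 htv
        exact ⟨hv', h⟩
      · have : cnt I.n (fun v => inB (inputCtx (rawInput I T ε)) [b] v = true) ≤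
            cnt I.n fun _ => False := by
          refine cnt_mono fun v _ h => ?_
          obtain ⟨t, ht, htv⟩ := inB_iff.1 h
          rw [List.mem_singleton.1 ht] at htv
          obtain ⟨hb', -⟩ := (inBag_inputCtx I T ε).1 htv
          exact hb hb'
        exact this.trans ((by simp [cnt] : cnt I.n (fun _ => False) = 0).le.trans (Nat.zero_le _))
    rw [List.length_cons, add_mul, one_mul]
    omega

theorem length_fuelL : (fuelL (rawInput I T ε)).length = 2 * T.m.size := by
  simp [fuelL, rawInput, Nat.size_eq_bits_len]
  ring

theorem length_hopsL (w : Raw) : (hopsL w).length = 2 * ((fuelL w).length + 1) + 1 := by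
  simp [hopsL]
  ring

theorem length_gridL (w : Raw) (K : List Unit) :
    (gridL w K).length = (2 * ((fuelL w).length + 1) + 1) * K.length := by
  rw [gridL, List.length_flatMap]
  simp [length_hopsL]
  ring

theorem length_topL (w : Raw) (K : List Unit) : (topL w K).length =
    (gridL w K).length + (2 * ((fuelL w).length + 1) + 1) + 2 := by
  simp [topL, length_hopsL]
  ring

theorem edgeOK_inputCtx :
    EdgeOK (inputCtx (rawInput I T ε)) (edgeRel I (rawInput I T ε)) where
  symm := by
    rintro _ _ _ ⟨a, b, rfl, rfl, h, rfl⟩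
    refine ⟨b, a, rfl, rfl, h.symm, ?_⟩
    have h1 := scaledLen_eq I T ε a b h
    have h2 := scaledLen_eq I T ε b a h.symm
    rw [Sym2.eq_swap, ← h1] at h2
    exact_mod_cast h2.symm
  bag := by
    rintro _ _ _ ⟨a, b, rfl, rfl, h, -⟩
    obtain ⟨t, h1, h2⟩ := T.edge_mem a b h
    exact ⟨t, (inBag_inputCtx I T ε).2 ⟨t.2, a.2, h1⟩, (inBag_inputCtx I T ε).2 ⟨t.2, b.2, h2⟩⟩

theorem isEdge_rawInput {u v : ℕ} (hu : u < I.n) (hv : v < I.n) :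
    (ent (rawInput I T ε) u v).isEdge = true ↔ I.graph.Adj ⟨u, hu⟩ ⟨v, hv⟩ := by
  classical
  have := ent_rawInput I T ε ⟨u, hu⟩ ⟨v, hv⟩
  simp only at this
  rw [this]
  split_ifs with h <;> simp [Entry.isEdge, h]

theorem dist_inputCtx :
    (∀ u v (l : ℕ), get2 (inputCtx (rawInput I T ε)).dist u v ⊤ = l →
      Walk (edgeRel I (rawInput I T ε)) u v l) ∧
    ∀ u v (l : ℕ), u < I.n → Walk (edgeRel I (rawInput I T ε)) u v l →
      get2 (inputCtx (rawInput I T ε)).dist u v ⊤ ≤ l := by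
  obtain ⟨-, h2, h3, h4⟩ := fw_spec (n := I.n) (fun u v => bif decide (u = v) then 0 else
      bif (ent (rawInput I T ε) u v).isEdge then (scaledLen (rawInput I T ε) u v : ℕ∞) else ⊤)
    (Q := Walk (edgeRel I (rawInput I T ε))) (fun u v hu hv l h => by
      by_cases huv : u = v
      · subst huv
        simp only [decide_true, cond_true] at h
        have : l = 0 := by exact_mod_cast h.symm
        subst this
        exact .refl u
      · cases he : (ent (rawInput I T ε) u v).isEdge with
        | false => simp [huv, he] at h
        | true =>
          simp only [huv, decide_false, cond_false, he, cond_true] at h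
          have : scaledLen (rawInput I T ε) u v = l := by exact_mod_cast h
          have h1 := Walk.cons (E := edgeRel I (rawInput I T ε)) (u := u) (x := v) (a := l)
            ⟨⟨u, hu⟩, ⟨v, hv⟩, rfl, rfl, (isEdge_rawInput I T ε hu hv).1 he, this.symm⟩ (.refl v)
          simpa using h1) (fun u x v _ _ h h' => h.trans h')
    (D := fun u v => get2 (inputCtx (rawInput I T ε)).dist u v ⊤) (by
      change (fun u v => get2 (scaledDist (rawInput I T ε)) u v ⊤) = _
      unfold scaledDist
      rw [rawR_rawInput])
  refine ⟨h4, fun u v l hu h => ?_⟩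
  induction h with
  | refl u => exact (h2 u u hu hu).trans (by simp)
  | cons h _ ih =>
    obtain ⟨a, b, rfl, rfl, hab, rfl⟩ := h
    have h5 := h2 a b a.2 b.2
    have h6 : (a : ℕ) ≠ b := fun h => hab.ne (Fin.ext h)
    simp only [h6, decide_false, cond_false, (isEdge_rawInput I T ε a.2 b.2).2 hab,
      cond_true] at h5
    refine (h3 b a _ b.2).trans ?_
    push_cast
    exact add_le_add h5 (ih b.2)

theorem inputOK : InputOK (inputCtx (rawInput I T ε)) I.n T.m (edgeRel I (rawInput I T ε)) where
  tree := treeOK_inputCtx I T ε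
  R_eq := rawR_rawInput I T ε
  bag_vert t v h := by
    obtain ⟨-, hv, -⟩ := (inBag_inputCtx I T ε).1 h
    exact hv
  top_gt := by
    change 1 < (topL (rawInput I T ε) _).length
    rw [length_topL]
    omega
  mem_codes l := by
    change l ∈ (List.range (() :: topL (rawInput I T ε) _).length).filter _ ↔
      _ ∧ _ ≤ (topL (rawInput I T ε) _).length
    rw [List.mem_filter, List.mem_range, List.length_cons]
    simp only [Bool.not_eq_true', decide_eq_false_iff_not]
    omega
  bd_ge B hB := by
    change _ ≤ (boundL (rawInput I T ε) _).length
    rw [length_boundL, rawR_rawInput, List.length_range]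
    change (I.n + 1) * ((I.n + 1) * (2 * ((topL (rawInput I T ε) _).length + 1)) ^ _) ≤ _
    -- Four nodes at a time: the removed node and at most three boundary nodes.
    have h := (length_verts_le I T ε B).trans (Nat.mul_le_mul_right _ hB)
    gcongr
    omega
  edge := edgeOK_inputCtx I T ε
  cover v hv := by
    obtain ⟨t, ht⟩ := T.vertex_mem ⟨v, hv⟩
    exact ⟨t, (inBag_inputCtx I T ε).2 ⟨t.2, hv, ht⟩⟩
  dist_walk := (dist_inputCtx I T ε).1
  walk_dist := (dist_inputCtx I T ε).2
  fuel := (length_fuelL I T ε).ge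
  top_eq := length_topL _ _

end

/-! ### The approximation guarantee -/

section

variable (I : Instance) (T : TreeDecomposition I.graph) (ε : ℚ)

theorem exists_walk_of_graph {a b : Fin I.n} (w : I.graph.Walk a b) :
    ∃ l : ℕ, Walk (edgeRel I (rawInput I T ε)) a b l ∧
      (l : ℚ) = I.walkLength w * commonDen (rawInput I T ε) := by
  induction w with
  | nil => exact ⟨0, .refl _, by simp [Instance.walkLength]⟩
  | @cons a b c h w ih =>
    obtain ⟨l, hl, h1⟩ := ih
    refine ⟨_, .cons ⟨a, b, rfl, rfl, h, rfl⟩ hl, ?_⟩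
    push_cast
    rw [h1, scaledLen_eq I T ε a b h]
    simp only [Instance.walkLength, SimpleGraph.Walk.edges_cons, List.map_cons, List.sum_cons]
    ring

theorem exists_graph_of_walk {u v l : ℕ} (h : Walk (edgeRel I (rawInput I T ε)) u v l)
    (hu : u < I.n) : ∃ (hv : v < I.n) (w : I.graph.Walk ⟨u, hu⟩ ⟨v, hv⟩),
      (l : ℚ) = I.walkLength w * commonDen (rawInput I T ε) := by
  induction h with
  | refl => exact ⟨hu, .nil, by simp [Instance.walkLength]⟩
  | cons h _ ih =>
    obtain ⟨a, b, rfl, rfl, hab, rfl⟩ := h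
    obtain ⟨hv, w, h1⟩ := ih b.2
    refine ⟨hv, .cons hab w, ?_⟩
    push_cast
    rw [h1, scaledLen_eq I T ε a b hab]
    simp only [Instance.walkLength, SimpleGraph.Walk.edges_cons, List.map_cons, List.sum_cons]
    ring

theorem dist_le_of_walk {a b : Fin I.n} {l : ℕ}
    (h : Walk (edgeRel I (rawInput I T ε)) a b l) :
    I.dist a b ≤ ENNReal.ofReal (l / commonDen (rawInput I T ε)) := by
  obtain ⟨_, w, h1⟩ := exists_graph_of_walk I T ε h a.2
  refine (iInf_le _ w).trans (le_of_eq ?_)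
  congr 1
  have h2 : (commonDen (rawInput I T ε) : ℝ) ≠ 0 := by
    exact_mod_cast (commonDen_pos I T ε).ne'
  rw [eq_div_iff h2]
  exact_mod_cast h1.symm

/-- The computed entry is the length of a walk and at most the length of every walk, so the infimum
that defines the distance is attained. -/
theorem exists_of_dist_ne_top {a b : Fin I.n} (h : I.dist a b ≠ ⊤) :
    ∃ l : ℕ, get2 (inputCtx (rawInput I T ε)).dist a b ⊤ = l ∧
      Walk (edgeRel I (rawInput I T ε)) a b l ∧
      ENNReal.ofReal (l / commonDen (rawInput I T ε)) ≤ I.dist a b := by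
  have hOK := inputOK I T ε
  have hP : (0 : ℝ) < commonDen (rawInput I T ε) := by exact_mod_cast commonDen_pos I T ε
  obtain ⟨w⟩ : Nonempty (I.graph.Walk a b) := by
    by_contra hne
    rw [not_nonempty_iff] at hne
    exact h (by simp [Instance.dist])
  obtain ⟨l₀, hl₀, -⟩ := exists_walk_of_graph I T ε w
  have h1 := hOK.walk_dist a b l₀ a.2 hl₀
  obtain ⟨l, hl⟩ := ENat.ne_top_iff_exists.1 (ne_top_of_le_ne_top (ENat.natCast_ne_top l₀) h1)
  refine ⟨l, hl.symm, hOK.dist_walk a b l hl.symm, le_iInf fun w => ?_⟩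
  obtain ⟨l', hl', h2⟩ := exists_walk_of_graph I T ε w
  have h3 := hOK.walk_dist a b l' a.2 hl'
  rw [← hl] at h3
  have h4 : l ≤ l' := by exact_mod_cast h3
  refine ENNReal.ofReal_le_ofReal ?_
  rw [div_le_iff₀ hP]
  have h5 : ((l' : ℕ) : ℝ) = (I.walkLength w : ℚ) * commonDen (rawInput I T ε) := by
    exact_mod_cast h2
  rw [← h5]
  exact_mod_cast h4

/-- The opened suppliers of a labelling. -/
def openedSet (q : List ℕ) : Finset (Fin I.n) := Finset.univ.filter fun v => val q v = 1

/-- The outliers of a labelling. -/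
def outlierSet (q : List ℕ) : Finset (Fin I.n) :=
  I.clients.filter fun v => val q v = (inputCtx (rawInput I T ε)).top

theorem map_range_eq_ofFn {α : Type} (n : ℕ) (f : ℕ → α) :
    (List.range n).map f = List.ofFn fun i : Fin n => f i := by
  rw [List.ofFn_eq_map, ← List.map_coe_finRange_eq_range, List.map_map]
  rfl

theorem cli_inputCtx (v : ℕ) : (inputCtx (rawInput I T ε)).cli.getD v false = true ↔
    ∃ hv : v < I.n, (⟨v, hv⟩ : Fin I.n) ∈ I.clients := by
  change (rawInput I T ε).1.2.2.1.getD v false = true ↔ _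
  simp only [rawInput, getD_ofFn]
  split_ifs with h <;> simp [h]

theorem sup_inputCtx (v : ℕ) : (inputCtx (rawInput I T ε)).sup.getD v false = true ↔
    ∃ hv : v < I.n, (⟨v, hv⟩ : Fin I.n) ∈ I.suppliers := by
  change (rawInput I T ε).1.2.1.getD v false = true ↔ _
  simp only [rawInput, getD_ofFn]
  split_ifs with h <;> simp [h]

theorem enc_output (q : List ℕ) : enc (output (inputCtx (rawInput I T ε)) q) =
    encOutput (openedSet I q) (outlierSet I T ε q) := by
  have hR : (inputCtx (rawInput I T ε)).R = List.range I.n := rawR_rawInput I T ε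
  unfold output encOutput encSet
  rw [hR, map_range_eq_ofFn, map_range_eq_ofFn]
  change Val.cons (enc (List.ofFn _)) (enc (List.ofFn _)) = _
  rw [enc_list_ofFn, enc_list_ofFn]
  congr 2
  · funext v
    simp only [openedSet, Finset.mem_filter, Finset.mem_univ, true_and]
    rfl
  · funext v
    change encBool _ = _
    congr 1
    rw [Bool.eq_iff_iff, Bool.and_eq_true, cli_inputCtx]
    simp [outlierSet]

theorem card_openedSet (q : List ℕ) :
    (openedSet I q).card = cnt I.n fun v => v < I.n ∧ val q v = 1 := by
  rw [← cnt_fin]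
  refine cnt_congr fun v hv => ?_
  simp [openedSet, hv]

theorem isSolution_best :
    I.IsSolution (openedSet I (best (inputCtx (rawInput I T ε)) I.k I.p))
      (outlierSet I T ε (best (inputCtx (rawInput I T ε)) I.k I.p)) := by
  have hOK := inputOK I T ε
  obtain ⟨h1, h2, h3⟩ := best_feasible (k := I.k) (p := I.p) hOK
  generalize best (inputCtx (rawInput I T ε)) I.k I.p = q at *
  refine ⟨fun v hv => ?_, ?_, Finset.filter_subset _ _, ?_⟩
  · obtain ⟨_, h⟩ := (sup_inputCtx I T ε v).1 (h3 v (Finset.mem_filter.1 hv).2)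
    exact h
  · rw [card_openedSet]
    rw [hOK.numOpen_eq] at h1
    exact (cnt_mono fun v _ h => h.2).trans h1
  · rw [← cnt_fin]
    rw [hOK.numOut_eq] at h2
    refine (cnt_mono fun v _ h => ?_).trans h2
    obtain ⟨hv, h⟩ := h
    simp only [outlierSet, Finset.mem_filter] at h
    exact ⟨h.2, (cli_inputCtx I T ε v).2 ⟨hv, h.1⟩⟩

/-- In a graph without edges all walks are trivial. -/
theorem walk_trivial (h : (maxBag (rawInput I T ε)).length ≤ 1) {u v l : ℕ}
    (hw : Walk (edgeRel I (rawInput I T ε)) u v l) : l = 0 := by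
  cases hw with
  | refl => rfl
  | cons h' _ =>
    obtain ⟨a, b, -, -, hab, -⟩ := h'
    obtain ⟨t, ha, hb⟩ := T.edge_mem a b hab
    rw [length_maxBag] at h
    have h1 := (Finset.le_sup (f := fun t : Fin T.m => (T.bag t).card)
      (Finset.mem_univ t)).trans h
    exact absurd (Finset.card_le_one.1 h1 a ha b hb) hab.ne

/-- If all bags have at most one vertex, there are no edges and `l = 0`, whatever the precision.
Otherwise `K ≥ 1 / ε`, so `(K + 1) / K ≤ 1 + ε`. -/
theorem le_of_precision (hε : 0 < ε) {l r r' u v : ℕ} (hr : r' ≤ r)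
    (hw : Walk (edgeRel I (rawInput I T ε)) u v l)
    (h : (invEps (rawInput I T ε)).length * l ≤ ((invEps (rawInput I T ε)).length + 1) * r') :
    (l : ℝ) ≤ (1 + (ε : ℝ)) * r := by
  have hε' : (0 : ℝ) < ε := by exact_mod_cast hε
  by_cases hb : (maxBag (rawInput I T ε)).length ≤ 1
  · rw [walk_trivial I T ε hb hw]
    push_cast
    positivity
  have hnum : 0 < ε.num.natAbs := Int.natAbs_pos.2 (Rat.num_pos.2 hε).ne'
  have h1 := le_length_invEps (rawInput I T ε) hnum hb
  have h2 := length_invEps_pos (rawInput I T ε)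
  have h3 : ((rawInput I T ε).2.2.1.1 : ℝ) = ε * ((rawInput I T ε).2.2.1.2 : ℕ) := by
    have h4 : ((ε.num.natAbs : ℕ) : ℚ) = ε.num := by
      rw [← Int.cast_natCast, Int.natAbs_of_nonneg (Rat.num_nonneg.2 hε.le)]
    have h5 : ((ε.num.natAbs : ℕ) : ℚ) = ε * (ε.den : ℕ) := by rw [h4, Rat.mul_den_eq_num]
    exact_mod_cast h5
  have hden : (0 : ℝ) < ((rawInput I T ε).2.2.1.2 : ℕ) := by exact_mod_cast Rat.den_pos ε
  have h1' : (((rawInput I T ε).2.2.1.2 : ℕ) : ℝ) ≤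
      (invEps (rawInput I T ε)).length * ((rawInput I T ε).2.2.1.1 : ℕ) := by exact_mod_cast h1
  rw [h3] at h1'
  generalize (invEps (rawInput I T ε)).length = K at *
  generalize ((rawInput I T ε).2.2.1.2 : ℕ) = d at *
  have hK : (0 : ℝ) < K := by exact_mod_cast h2
  have h6 : 1 ≤ K * (ε : ℝ) := by
    have : (d : ℝ) * 1 ≤ d * (K * ε) := by linarith
    exact le_of_mul_le_mul_left this hden
  have h7 : (K : ℝ) * l ≤ (K + 1) * r := by
    have : K * l ≤ (K + 1) * r := h.trans (Nat.mul_le_mul_left _ hr)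
    exact_mod_cast this
  refine le_of_mul_le_mul_left (a := (K : ℝ)) (h7.trans ?_) hK
  have : (0 : ℝ) ≤ r := by positivity
  nlinarith

theorem cost_best_le (hε : 0 < ε) {S O : Finset (Fin I.n)} (h : I.IsSolution S O) :
    I.cost (openedSet I (best (inputCtx (rawInput I T ε)) I.k I.p))
      (outlierSet I T ε (best (inputCtx (rawInput I T ε)) I.k I.p)) ≤
      ENNReal.ofReal (1 + (ε : ℝ)) * I.cost S O := by
  have hOK := inputOK I T ε
  have hε' : (0 : ℝ) < ε := by exact_mod_cast hε
  have hP : (0 : ℝ) < commonDen (rawInput I T ε) := by exact_mod_cast commonDen_pos I T ε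
  by_cases htop : I.cost S O = ⊤
  · rw [htop, ENNReal.mul_top (by simpa using by linarith)]
    exact le_top
  have h1 : ∀ a ∈ I.clients \ O, ∃ s ∈ S, ∃ l : ℕ,
      get2 (inputCtx (rawInput I T ε)).dist a s ⊤ = l ∧
      Walk (edgeRel I (rawInput I T ε)) a s l ∧
      ENNReal.ofReal (l / commonDen (rawInput I T ε)) ≤ I.cost S O := by
    intro a ha
    have h2 : ⨅ s ∈ S, I.dist a s ≤ I.cost S O :=
      le_iSup₂ (f := fun a (_ : a ∈ I.clients \ O) => ⨅ s ∈ S, I.dist a s) a ha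
    have hne : S.Nonempty := by
      by_contra hne
      rw [Finset.not_nonempty_iff_eq_empty] at hne
      have h3 : ⨅ s ∈ S, I.dist a s = ⊤ := by simp [hne]
      rw [h3, top_le_iff] at h2
      exact htop h2
    obtain ⟨s, hs, hmin⟩ := S.exists_min_image (fun s => I.dist a s) hne
    have h3 : I.dist a s ≤ I.cost S O :=
      (le_iInf₂ fun s' hs' => hmin s' hs').trans h2
    obtain ⟨l, hl, hw, h4⟩ := exists_of_dist_ne_top I T ε (ne_top_of_le_ne_top htop h3)
    exact ⟨s, hs, l, hl, hw, h4.trans h3⟩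
  choose! s hs l hl hw hcost using h1
  -- The largest distance of a served client is an entry of the distance matrix and hence a guess;
  -- the guess 0 is there for solutions that serve no client.
  have h2 : ∃ r ∈ radii (inputCtx (rawInput I T ε)), (∀ a ∈ I.clients \ O, l a ≤ r) ∧
      ENNReal.ofReal (r / commonDen (rawInput I T ε)) ≤ I.cost S O := by
    rcases (I.clients \ O).eq_empty_or_nonempty with he | hne
    · exact ⟨0, by simp [radii], by simp [he], by simp⟩
    · obtain ⟨a, ha, hmax⟩ := (I.clients \ O).exists_max_image l hne
      exact ⟨l a, mem_radii (hl a ha), hmax, hcost a ha⟩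
  obtain ⟨r, hr, hlr, hrc⟩ := h2
  obtain ⟨r', hr', hq⟩ := best_mem_table (r := r) (k := I.k) (p := I.p)
    (S := fun v => ∃ hv : v < I.n, (⟨v, hv⟩ : Fin I.n) ∈ S)
    (O := fun v => ∃ hv : v < I.n, (⟨v, hv⟩ : Fin I.n) ∈ O) hOK hr
    (fun v hv => hv.1) (fun v ⟨hv, h'⟩ => (sup_inputCtx I T ε v).2 ⟨hv, h.subset_suppliers h'⟩)
    (by rw [cnt_fin]; exact h.card_le_k) (by rw [cnt_fin]; exact h.card_le_p)
    (fun v hv hcli hO => by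
      obtain ⟨_, hcli⟩ := (cli_inputCtx I T ε v).1 hcli
      have ha : (⟨v, hv⟩ : Fin I.n) ∈ I.clients \ O :=
        Finset.mem_sdiff.2 ⟨hcli, fun h => hO ⟨hv, h⟩⟩
      exact ⟨s ⟨v, hv⟩, l ⟨v, hv⟩, ⟨(s ⟨v, hv⟩).2, hs _ ha⟩, hw _ ha, hlr _ ha⟩)
  generalize best (inputCtx (rawInput I T ε)) I.k I.p = q at *
  refine iSup₂_le fun a ha => ?_
  obtain ⟨ha1, ha2⟩ := Finset.mem_sdiff.1 ha
  have hat : val q a ≠ (inputCtx (rawInput I T ε)).top := fun h =>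
    ha2 (Finset.mem_filter.2 ⟨ha1, h⟩)
  obtain ⟨s', l', hs', hs1, hw', h3⟩ := exists_walk_le_of_row (K := (invEps (rawInput I T ε)).length)
    hOK (length_gridL _ _) hq a.2 hat
  have h4 := le_of_precision I T ε hε hr' hw' h3
  have h5 := dist_le_of_walk I T ε (a := a) (b := ⟨s', hs'⟩) (hw'.symm hOK.edge)
  refine (iInf₂_le ⟨s', hs'⟩ (by simpa [openedSet] using hs1)).trans (h5.trans ?_)
  calc ENNReal.ofReal (l' / commonDen (rawInput I T ε))
      ≤ ENNReal.ofReal ((1 + (ε : ℝ)) * (r / commonDen (rawInput I T ε))) := by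
        refine ENNReal.ofReal_le_ofReal ?_
        rw [← mul_div_assoc]
        gcongr
    _ = ENNReal.ofReal (1 + (ε : ℝ)) * ENNReal.ofReal (r / commonDen (rawInput I T ε)) :=
        ENNReal.ofReal_mul (by positivity)
    _ ≤ _ := by gcongr

theorem cost_best_le_opt (hε : 0 < ε) :
    I.cost (openedSet I (best (inputCtx (rawInput I T ε)) I.k I.p))
      (outlierSet I T ε (best (inputCtx (rawInput I T ε)) I.k I.p)) ≤
      ENNReal.ofReal (1 + (ε : ℝ)) * I.opt := by
  have hε' : (0 : ℝ) < ε := by exact_mod_cast hε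
  have h0 : ENNReal.ofReal (1 + (ε : ℝ)) ≠ 0 := by simpa using by linarith
  -- With the factor moved to the left, the bound by the infimum can be checked for each solution.
  rw [← ENNReal.div_le_iff' h0 ENNReal.ofReal_ne_top]
  refine le_iInf fun S => le_iInf fun O => le_iInf fun h => ?_
  rw [ENNReal.div_le_iff' h0 ENNReal.ofReal_ne_top]
  exact cost_best_le I T ε hε h

end

/-! ### The running time -/

/-- Bounds of the form `c * N ^ c * x ^ (c * t)`. -/
def FptBd {ι : Type*} (N x : ι → ℝ) (t : ι → ℕ) (g : ι → ℝ) : Prop :=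
  ∃ c : ℕ, ∀ i, g i ≤ c * N i ^ c * x i ^ (c * t i)

/-! ### Calculus of parameterized bounds -/

section

variable {ι : Type*} {N x : ι → ℝ} {t : ι → ℕ} {f g : ι → ℝ}

theorem FptBd.mono (hg : FptBd N x t g) (h : ∀ i, f i ≤ g i) : FptBd N x t f :=
  let ⟨c, hc⟩ := hg
  ⟨c, fun i => (h i).trans (hc i)⟩

/-- The base is below 1 only for width 0, where the power is `0 ^ 0 = 1`. -/
theorem one_le_pow_of (hx : ∀ i, t i = 0 ∨ 1 ≤ x i) (i : ι) : 1 ≤ x i ^ t i := by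
  rcases hx i with h | h
  · simp [h]
  · exact one_le_pow₀ h

theorem fptBd_le (hN : ∀ i, 1 ≤ N i) (hx : ∀ i, t i = 0 ∨ 1 ≤ x i) {c d : ℕ} (hcd : c ≤ d)
    (i : ι) : N i ^ c * x i ^ (c * t i) ≤ N i ^ d * x i ^ (d * t i) := by
  rw [mul_comm c, mul_comm d, pow_mul, pow_mul]
  have h1 := one_le_pow_of hx i
  have h2 := hN i
  gcongr

theorem FptBd.intro (hN : ∀ i, 1 ≤ N i) (hx : ∀ i, t i = 0 ∨ 1 ≤ x i) {a b c : ℕ}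
    (h : ∀ i, g i ≤ a * N i ^ b * (x i ^ t i) ^ c) : FptBd N x t g := by
  refine ⟨a + b + c, fun i => (h i).trans ?_⟩
  rw [mul_comm (a + b + c) (t i), pow_mul]
  have h1 := one_le_pow_of hx i
  have h2 := hN i
  have h3 : (a : ℝ) ≤ ((a + b + c : ℕ) : ℝ) := by exact_mod_cast (by omega : a ≤ a + b + c)
  have h4 : N i ^ b ≤ N i ^ (a + b + c) := pow_le_pow_right₀ h2 (by omega)
  have h5 : (x i ^ t i) ^ c ≤ (x i ^ t i) ^ (a + b + c) := pow_le_pow_right₀ h1 (by omega)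
  gcongr

theorem FptBd.const (hN : ∀ i, 1 ≤ N i) (hx : ∀ i, t i = 0 ∨ 1 ≤ x i) (k : ℕ) :
    FptBd N x t fun _ => k :=
  .intro (a := k) (b := 0) (c := 0) hN hx fun i => by simp

theorem FptBd.add (hN : ∀ i, 1 ≤ N i) (hx : ∀ i, t i = 0 ∨ 1 ≤ x i) (hf : FptBd N x t f)
    (hg : FptBd N x t g) : FptBd N x t fun i => f i + g i := by
  obtain ⟨c, hc⟩ := hf
  obtain ⟨d, hd⟩ := hg
  refine ⟨c + d, fun i => (add_le_add (hc i) (hd i)).trans ?_⟩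
  have h1 := fptBd_le hN hx (Nat.le_add_right c d) i
  have h2 := fptBd_le hN hx (Nat.le_add_left d c) i
  push_cast
  rw [mul_assoc, mul_assoc, mul_assoc, add_mul]
  gcongr

theorem FptBd.mul (hN : ∀ i, 1 ≤ N i) (hx : ∀ i, t i = 0 ∨ 1 ≤ x i) (hf : FptBd N x t f)
    (hg : FptBd N x t g) (h0 : ∀ i, 0 ≤ g i) : FptBd N x t fun i => f i * g i := by
  obtain ⟨c, hc⟩ := hf
  obtain ⟨d, hd⟩ := hg
  refine .intro (a := c * d) (b := c + d) (c := c + d) hN hx fun i => ?_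
  have h1 := one_le_pow_of hx i
  have h2 := hN i
  have h3 : 0 ≤ (c : ℝ) * N i ^ c * x i ^ (c * t i) := by
    rw [mul_comm c (t i), pow_mul]
    positivity
  refine (mul_le_mul (hc i) (hd i) (h0 i) h3).trans (le_of_eq ?_)
  push_cast
  ring

theorem FptBd.pow (hN : ∀ i, 1 ≤ N i) (hx : ∀ i, t i = 0 ∨ 1 ≤ x i) (hf : FptBd N x t f)
    (h0 : ∀ i, 0 ≤ f i) (k : ℕ) : FptBd N x t fun i => f i ^ k := by
  induction k with
  | zero => simpa using FptBd.const hN hx 1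
  | succ k ih => simpa only [pow_succ] using ih.mul hN hx hf h0

/-- Constants to the power of the parameter are absorbed. -/
theorem FptBd.const_pow (hN : ∀ i, 1 ≤ N i) (hx : ∀ i, t i = 0 ∨ 1 ≤ x i)
    (ht : ∀ i, (t i : ℝ) ≤ x i) (k : ℕ) : FptBd N x t fun i => (k : ℝ) ^ t i := by
  refine .intro (a := k + 1) (b := 0) (c := k) hN hx fun i => ?_
  have h1 := one_le_pow_of hx i
  have h2 : 1 ≤ (x i ^ t i) ^ k := one_le_pow₀ h1
  push_cast
  rw [pow_zero, mul_one]
  -- For exponents below 2 the factor `k + 1` suffices. From 2 on the base is at least 2, so `k ≤ 2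
  -- ^ k ≤ x i ^ k`.
  rcases Nat.lt_or_ge (t i) 2 with h | h
  · have h3 : (k : ℝ) ^ t i ≤ k + 1 := by
      interval_cases t i <;> simp
    exact h3.trans (le_mul_of_one_le_right (by positivity) h2)
  · have h3 : (2 : ℝ) ≤ x i := le_trans (by exact_mod_cast h) (ht i)
    have h4 : (k : ℝ) ≤ x i ^ k :=
      le_trans (by exact_mod_cast Nat.lt_two_pow_self.le) (pow_le_pow_left₀ (by norm_num) h3 k)
    calc (k : ℝ) ^ t i ≤ (x i ^ k) ^ t i := pow_le_pow_left₀ (by positivity) h4 _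
      _ = (x i ^ t i) ^ k := by rw [← pow_mul, ← pow_mul, mul_comm]
      _ ≤ (k + 1) * (x i ^ t i) ^ k := le_mul_of_one_le_left (by positivity) (by simp)

end

/-- Powers of logarithms are bounded by a polynomial times a power of the exponent. -/
theorem size_add_one_pow_le (m t : ℕ) :
    ((m.size + 1 : ℕ) : ℝ) ^ t ≤ (t : ℝ) ^ t * (16 * (m + 1 : ℝ) ^ 2) := by
  -- The exponential of a binary length is polynomial in the number, and `t! ≤ t ^ t`.
  have h1 := Real.pow_div_factorial_le_exp ((m.size + 1 : ℕ) : ℝ) (by positivity) t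
  rw [div_le_iff₀ (by positivity)] at h1
  have h2 : (t.factorial : ℝ) ≤ (t : ℝ) ^ t := by exact_mod_cast Nat.factorial_le_pow t
  have h3 : Real.exp ((m.size + 1 : ℕ) : ℝ) ≤ 16 * (m + 1 : ℝ) ^ 2 := by
    have h4 : Real.exp ((m.size + 1 : ℕ) : ℝ) = Real.exp 1 ^ (m.size + 1) := by
      rw [← Real.exp_nat_mul, mul_one]
    have h5 : Real.exp 1 ≤ 4 := by have := Real.exp_one_lt_three; linarith
    have h6 : 2 ^ m.size ≤ 2 * (m + 1) := by
      rcases Nat.eq_zero_or_pos m with rfl | hm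
      · simp
      · have h7 : m.size - 1 < m.size := by
          have := Nat.size_pos.2 hm
          omega
        have h8 := Nat.lt_size.1 h7
        have h9 : 2 ^ m.size = 2 * 2 ^ (m.size - 1) := by
          rw [← pow_succ']
          congr 1
          omega
        omega
    have h7 : ((2 : ℝ) ^ m.size) ≤ 2 * (m + 1) := by exact_mod_cast h6
    calc Real.exp ((m.size + 1 : ℕ) : ℝ) ≤ 4 ^ (m.size + 1) := by
          rw [h4]
          exact pow_le_pow_left₀ (Real.exp_pos _).le h5 _
      _ = 4 * ((2 : ℝ) ^ m.size) ^ 2 := by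
          rw [pow_succ, ← pow_mul, mul_comm m.size 2, pow_mul]
          norm_num
          ring
      _ ≤ 4 * (2 * (m + 1)) ^ 2 := by gcongr
      _ = _ := by ring
  calc ((m.size + 1 : ℕ) : ℝ) ^ t ≤ Real.exp ((m.size + 1 : ℕ) : ℝ) * t.factorial := h1
    _ ≤ 16 * (m + 1 : ℝ) ^ 2 * (t : ℝ) ^ t := by gcongr
    _ = _ := by ring

/-! ### The parameters of the algorithm obey the claimed bound -/

/-- The inputs of the algorithm. -/
structure Input where
  /-- the instance -/
  inst : Instance
  /-- the tree decomposition -/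
  dec : TreeDecomposition inst.graph
  /-- the precision -/
  eps : ℚ
  eps_pos : 0 < eps

namespace Input

/-- The size of an input. -/
def size (i : Input) : ℝ := ((encInput i.inst i.dec i.eps).size : ℝ)

/-- The width of the tree decomposition. -/
def width (i : Input) : ℕ := i.dec.width

/-- The ratio of the width and the precision. -/
def ratio (i : Input) : ℝ := (i.dec.width : ℝ) / min (i.eps : ℝ) 1

/-- The decoded input. -/
def raw (i : Input) : Raw := rawInput i.inst i.dec i.eps

variable (i : Input)

theorem prec_pos : 0 < min (i.eps : ℝ) 1 := lt_min (by exact_mod_cast i.eps_pos) one_pos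

theorem width_le_ratio : (i.width : ℝ) ≤ i.ratio :=
  le_div_self (by positivity) i.prec_pos (min_le_right _ _)

theorem ratio_cases : i.width = 0 ∨ 1 ≤ i.ratio := by
  rcases Nat.eq_zero_or_pos i.width with h | h
  · exact Or.inl h
  · exact Or.inr (le_trans (by exact_mod_cast h) i.width_le_ratio)

theorem sz_raw : (sz i.raw : ℝ) = i.size := by
  rw [size, ← enc_rawInput, sz_raw_eq]
  rfl

theorem one_le_size : 1 ≤ i.size := by
  rw [← sz_raw]
  exact_mod_cast sz_pos i.raw

theorem n_add_one_le : ((i.inst.n + 1 : ℕ) : ℝ) ≤ i.size := by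
  rw [← sz_raw]
  have h1 := length_lt_sz i.raw.1.1
  have h2 : i.raw.1.1.length = i.inst.n := by simp [raw, rawInput]
  have h3 : sz i.raw.1.1 ≤ sz i.raw := by
    obtain ⟨⟨a, b⟩, c⟩ := i.raw
    simp only [sz_pair]
    omega
  exact_mod_cast (by omega : i.inst.n + 1 ≤ sz i.raw)

theorem m_add_one_le : ((i.dec.m + 1 : ℕ) : ℝ) ≤ i.size := by
  rw [← sz_raw]
  have h1 := length_lt_sz i.raw.2.1.1
  have h2 : i.raw.2.1.1.length = i.dec.m := by simp [raw, rawInput]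
  have h3 : sz i.raw.2.1.1 ≤ sz i.raw := by
    obtain ⟨a, ⟨b, c⟩, d⟩ := i.raw
    simp only [sz_pair]
    omega
  exact_mod_cast (by omega : i.dec.m + 1 ≤ sz i.raw)

theorem length_maxBag : (maxBag i.raw).length - 1 = i.width := by
  rw [raw, KSwO.length_maxBag]
  rfl

theorem invEps_le : ((invEps i.raw).length : ℝ) ≤ 2 / min (i.eps : ℝ) 1 := by
  have hμ := i.prec_pos
  rcases length_invEps_le i.raw with h | h
  · rw [h, le_div_iff₀ hμ]
    have := min_le_right (i.eps : ℝ) 1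
    push_cast
    linarith
  · have hden : (0 : ℝ) < (i.eps.den : ℕ) := by exact_mod_cast i.eps.den_pos
    have h5 : ((i.eps.num.natAbs : ℕ) : ℚ) = i.eps * (i.eps.den : ℕ) := by
      rw [← Int.cast_natCast, Int.natAbs_of_nonneg (Rat.num_nonneg.2 i.eps_pos.le),
        Rat.mul_den_eq_num]
    have h6 : ((i.eps.num.natAbs : ℕ) : ℝ) = i.eps * (i.eps.den : ℕ) := by exact_mod_cast h5
    have h7 : ((invEps i.raw).length : ℝ) * (i.eps.num.natAbs : ℕ) < 2 * (i.eps.den : ℕ) := by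
      exact_mod_cast h
    rw [h6, ← mul_assoc] at h7
    have h8 := lt_of_mul_lt_mul_right h7 hden.le
    rw [le_div_iff₀ hμ]
    refine le_trans ?_ h8.le
    have := min_le_left (i.eps : ℝ) 1
    gcongr

/-- For width 0 the right side is 2 and does not grow with `1 / ε`; this is why the algorithm takes
`K = 1` there. For positive width `1 / min ε 1` is at most the ratio. -/
theorem invEps_le' : ((invEps i.raw).length : ℝ) ≤ 2 * i.ratio ^ i.width := by
  rcases Nat.eq_zero_or_pos i.width with h | h
  · have h1 := i.length_maxBag
    rw [length_invEps_eq i.raw (by omega), h]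
    norm_num
  · refine i.invEps_le.trans ?_
    have h1 : (1 : ℝ) ≤ i.width := by exact_mod_cast h
    have h2 : 1 ≤ i.ratio := i.ratio_cases.resolve_left h.ne'
    have h3 : i.ratio ≤ i.ratio ^ i.width := le_self_pow₀ h2 h.ne'
    have h4 : 1 / min (i.eps : ℝ) 1 ≤ i.ratio :=
      div_le_div_of_nonneg_right h1 i.prec_pos.le
    calc 2 / min (i.eps : ℝ) 1 = 2 * (1 / min (i.eps : ℝ) 1) := by ring
      _ ≤ _ := by linarith

theorem invEps_pow_le : ((invEps i.raw).length : ℝ) ^ i.width ≤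
    (2 : ℕ) ^ i.width * i.ratio ^ i.width := by
  rcases Nat.eq_zero_or_pos i.width with h | h
  · simp [h]
  · rw [← mul_pow]
    refine pow_le_pow_left₀ (by positivity) (i.invEps_le.trans ?_) _
    have h1 : (1 : ℝ) ≤ i.width := by exact_mod_cast h
    have h4 : 1 / min (i.eps : ℝ) 1 ≤ i.ratio :=
      div_le_div_of_nonneg_right h1 i.prec_pos.le
    calc 2 / min (i.eps : ℝ) 1 = 2 * (1 / min (i.eps : ℝ) 1) := by ring
      _ ≤ _ := by push_cast; linarith

/-- The predicate that a quantity has the bound of the theorem. -/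
abbrev Bd (g : Input → ℝ) : Prop := FptBd size ratio width g

theorem bd_const (k : ℕ) : Bd fun _ => k := .const one_le_size ratio_cases k

theorem bd_size : Bd size :=
  .intro (a := 1) (b := 1) (c := 0) one_le_size ratio_cases fun i => by simp

theorem bd_invEps : Bd fun i => (invEps i.raw).length :=
  .intro (a := 2) (b := 0) (c := 1) one_le_size ratio_cases fun i => by
    simpa using i.invEps_le'

theorem bd_log : Bd fun i => ((i.dec.m.size + 1 : ℕ) : ℝ) := by
  refine bd_size.mono fun i => le_trans ?_ i.m_add_one_le
  have : i.dec.m.size ≤ i.dec.m := Nat.size_le.2 Nat.lt_two_pow_self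
  exact_mod_cast (by omega : i.dec.m.size + 1 ≤ i.dec.m + 1)

/-- The factor `width ^ width` is at most `ratio ^ width`, and the rest is polynomial in the number
of nodes. -/
theorem bd_log_pow : Bd fun i => ((i.dec.m.size + 1 : ℕ) : ℝ) ^ i.width := by
  refine .intro (a := 16) (b := 2) (c := 1) one_le_size ratio_cases fun i => ?_
  refine (size_add_one_pow_le _ _).trans ?_
  have h1 := pow_le_pow_left₀ (by positivity) i.width_le_ratio i.width
  have h2 := i.m_add_one_le
  push_cast at h2
  have h3 : (0 : ℝ) ≤ i.ratio ^ i.width := le_trans (by positivity) h1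
  calc (i.width : ℝ) ^ i.width * (16 * (i.dec.m + 1 : ℝ) ^ 2)
      ≤ i.ratio ^ i.width * (16 * i.size ^ 2) := by gcongr
    _ = _ := by push_cast; ring

theorem bd_invEps_pow : Bd fun i => ((invEps i.raw).length : ℝ) ^ i.width :=
  ((FptBd.const_pow one_le_size ratio_cases width_le_ratio 2).mul one_le_size ratio_cases
    (g := fun i => i.ratio ^ i.width)
    (.intro (a := 1) (b := 0) (c := 1) one_le_size ratio_cases fun i => by simp)
    fun i => le_trans zero_le_one (one_le_pow_of ratio_cases i)).mono fun i => i.invEps_pow_le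

/-- The size of the alphabet of the labels. -/
theorem alphabet_le : 2 * ((topL i.raw (invEps i.raw)).length + 1) ≤
    24 * ((i.dec.m.size + 1) * (invEps i.raw).length) := by
  have h1 := length_invEps_pos i.raw
  -- With `l` the binary length of the number of nodes, there are `4 * l + 3` hops and `top = (4 * l
  -- + 3) * (K + 1) + 2`; the constant 24 suffices because `K ≥ 1`.
  rw [length_topL, length_gridL, raw, length_fuelL]
  rw [raw] at h1
  generalize (invEps (rawInput i.inst i.dec i.eps)).length = K at *
  generalize i.dec.m.size = l
  obtain ⟨K, rfl⟩ : ∃ K', K = K' + 1 := ⟨K - 1, by omega⟩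
  ring_nf
  nlinarith [Nat.zero_le (l * K)]

/-- The power with exponent `4 * (width + 1)` is split into the fourth power of `A ^ width` and the
factor `A ^ 4`, where `A` is 24 times a logarithm times `K`. Each of the three factors of `A` is
bounded, both by itself and raised to the width. -/
theorem bd_boundL : Bd fun i => (boundL i.raw (invEps i.raw)).length := by
  have hA : Bd fun i => (24 : ℕ) * (((i.dec.m.size + 1 : ℕ) : ℝ) * (invEps i.raw).length) :=
    (bd_const 24).mul one_le_size ratio_cases
      (bd_log.mul one_le_size ratio_cases bd_invEps fun i => by positivity) fun i => by positivity
  have hA' : Bd fun i => ((24 : ℕ) : ℝ) ^ i.width *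
      (((i.dec.m.size + 1 : ℕ) : ℝ) ^ i.width * ((invEps i.raw).length : ℝ) ^ i.width) :=
    (FptBd.const_pow one_le_size ratio_cases width_le_ratio 24).mul one_le_size ratio_cases
      (bd_log_pow.mul one_le_size ratio_cases bd_invEps_pow fun i => by positivity)
      fun i => by positivity
  have hn : Bd fun i => ((i.inst.n + 1 : ℕ) : ℝ) := bd_size.mono n_add_one_le
  refine (hn.mul one_le_size ratio_cases (hn.mul one_le_size ratio_cases
    ((hA'.pow one_le_size ratio_cases (fun i => by positivity) 4).mul one_le_size ratio_cases
      (hA.pow one_le_size ratio_cases (fun i => by positivity) 4) fun i => by positivity)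
    fun i => by positivity) fun i => by positivity).mono fun i => ?_
  have h1 : (rawR i.raw).length = i.inst.n := by rw [raw, rawR_rawInput, List.length_range]
  have h2 : (2 * ((topL i.raw (invEps i.raw)).length + 1)) ^ (4 * (maxBag i.raw).length) ≤
      (24 * ((i.dec.m.size + 1) * (invEps i.raw).length)) ^ (4 * (i.width + 1)) := by
    have h3 := i.length_maxBag
    have h4 := i.alphabet_le
    calc _ ≤ (2 * ((topL i.raw (invEps i.raw)).length + 1)) ^ (4 * (i.width + 1)) :=
          Nat.pow_le_pow_right (by omega) (by omega)
      _ ≤ _ := Nat.pow_le_pow_left h4 _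
  rw [length_boundL, h1]
  have h3 : (((2 * ((topL i.raw (invEps i.raw)).length + 1)) ^
      (4 * (maxBag i.raw).length) : ℕ) : ℝ) ≤
      ((24 * ((i.dec.m.size + 1) * (invEps i.raw).length)) ^ (4 * (i.width + 1)) : ℕ) := by
    exact_mod_cast h2
  rw [Nat.cast_mul, Nat.cast_mul]
  gcongr
  refine h3.trans (le_of_eq ?_)
  push_cast
  rw [← mul_pow, ← mul_pow, ← mul_pow, ← pow_succ, ← pow_mul, mul_comm 4]

theorem bd_padded : Bd fun i => (sz (Padded.mk i.raw) : ℝ) := by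
  refine ((bd_size.add one_le_size ratio_cases bd_invEps).add one_le_size ratio_cases
    bd_boundL).mono fun i => le_of_eq ?_
  rw [← sz_raw]
  exact_mod_cast rfl

/-- The claimed bounds are closed under polynomials, so polynomial time in the padded size is
enough. -/
theorem bd_pbd {b : Padded → ℕ} (hb : PBd b) : Bd fun i => (b ⟨i.raw⟩ : ℝ) := by
  obtain ⟨c, hc⟩ := hb
  refine ((bd_const c).mul one_le_size ratio_cases (bd_padded.pow one_le_size ratio_cases
    (fun i => by positivity) c) fun i => by positivity).mono fun i => ?_
  exact_mod_cast hc ⟨i.raw⟩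

end Input

end KSwO

end

/-! ### The theorem -/

open KSwO in
theorem mainTheorem1 :
    ∃ (P : Prog) (c : ℕ), ∀ (I : Instance) (T : TreeDecomposition I.graph) (ε : ℚ), 0 < ε →
      ∃ (S O : Finset (Fin I.n)) (t : ℕ),
        P.Run (encInput I T ε) (encOutput S O) t ∧
        I.IsSolution S O ∧
        I.cost S O ≤ ENNReal.ofReal (1 + (ε : ℝ)) * I.opt ∧
        (t : ℝ) ≤ c * ((encInput I T ε).size : ℝ) ^ c *
          ((T.width : ℝ) / min (ε : ℝ) 1) ^ (c * T.width) := by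
  -- Padding changes the size measure but not the encoding, so the program runs on the original
  -- input.
  obtain ⟨P, b, hb, h⟩ := Poly.solve
  obtain ⟨c, hc⟩ := Input.bd_pbd hb
  refine ⟨P, c, fun I T ε hε => ?_⟩
  obtain ⟨-, t, ht, hrun⟩ := h ⟨rawInput I T ε⟩
  refine ⟨_, _, t, ?_, isSolution_best I T ε, cost_best_le_opt I T ε hε,
    le_trans (Nat.cast_le.2 ht) (hc ⟨I, T, ε, hε⟩)⟩
  rw [← enc_output, ← enc_rawInput]
  exact hrun
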